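/- Let $\mathfrak{o}$ be a complete discrete valuation ring with maximal ideal $\mathfrak{m}$ and perfect residue field $k$, with absolute value normalized so that a generator of $\mathfrak{m}$ has absolute value $\rho\in(0,1)$, and fix $\omega\in(0,1)$. For $r>0$ and $m,n\ge 0$ let $\mathbf{A}_{m,n}^{\dagger,r}$ be the completion of $\mathfrak{o}[\pi,T_1,\dots,T_m][\![U_1,\dots,U_n]\!][\pi^{-1}]$ for the $r$-Gauss norm $|\sum a_{i,j,l}\pi^iT^jU^l|_r=\max |a_{i,j,l}|\,\omega^{ri}$, and let $\mathbf{A}_{m,n}^{\dagger}=\bigcup_{r>0}\mathbf{A}_{m,n}^{\dagger,r}$; reduction modulo $\mathfrak{m}$ maps it onto $B_{m,n}=k[\![\pi]\!]\langle T_1,\dots,T_m\rangle[\![U_1,\dots,U_n]\!][\pi^{-1}]$, which carries the $\pi$-adic norm with $|\pi|=\omega$. A *mixed affinoid algebra* over $k((\pi))$ is a quotient $A$ of some $k((\pi))$-algebra $B_{m,n}$, normed by the quotient norm. A *dagger lift* of $A$ is a flat $\mathfrak{o}$-algebra $S$ with an isomorphism $S/\mathfrak{m}S\cong A$ which admits a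 *presentation*, i.e. a surjection $f:\mathbf{A}_{m,n}^{\dagger}\to S$ of $\mathfrak{o}$-algebras for some $m,n$, whose reduction $B_{m,n}\to A$ is a homomorphism of $k((\pi))$-algebras. The *weak topology* of $S$ is the inverse limit topology of the quotient topologies on the $S/\mathfrak{m}^nS$ induced, for sufficiently small $r>0$, by the quotient norm on $S_r=f(\mathbf{A}_{m,n}^{\dagger,r})$; it does not depend on $f$. For $i=1,2$ let $A_i$ be a mixed affinoid algebra over $k((\pi))$ and let $S_i$ be a dagger lift of $A_i$. Let $g:S_1\to S_2$ be a ring homomorphism (not necessarily $\mathfrak{o}$-linear) with $g(\mathfrak{m}S_1)\subseteq\mathfrak{m}S_2$, and let $\overline{g}:A_1\to A_2$ be its reduction. If $\mathfrak{o}$ has equal characteristic, assume moreover that $\mathfrak{m}S_2$ is generated by $g(\mathfrak{m}S_1)$ (this is automatic in mixed characteristics, and also if $g$ is $\mathfrak{o}$-linear). 1. Suppose that $g$ is continuous for the weak topologies and that, for the quotient norm $|\cdot|_2$ on $A_2$ induced by some surjection $B_{m,n}\to A_2$ of $k((\pi))$-algebras, the restriction of $|\cdot|_2$ to $\overline{g}(k((\pi)))$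 is multiplicative. If $\overline{g}$ is (a) injective, (b) surjective, (c) finite, (d) flat, or (e) faithfully flat, then so is $g$. 2. If $\overline{g}$ is an isomorphism, then $g$ is an isomorphism. -/

import Mathlib

noncomputable section

namespace Dagger

open IsLocalRing

universe u v w

/-! ### Topology attached to a norm function -/

/-- The topology in which `U` is open iff it contains, around each of its points `x`, some ball
`{y : N (y - x) < ε}`; for a (semi)norm `N` this is the usual topology of `N`. -/
abbrev topologyOfNorm {G : Type v} [AddGroup G] (N : G → ℝ) : TopologicalSpace G where
  IsOpen U := ∀ x ∈ U, ∃ ε : ℝ, 0 < ε ∧ ∀ y, N (y - x) < ε → y ∈ U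
  isOpen_univ := fun _ _ => ⟨1, one_pos, fun _ _ => trivial⟩
  isOpen_inter := by
    intro U V hU hV x hx
    obtain ⟨a, ha, hUa⟩ := hU x hx.1
    obtain ⟨b, hb, hVb⟩ := hV x hx.2
    exact ⟨min a b, lt_min ha hb, fun y hy =>
      ⟨hUa y (lt_of_lt_of_le hy (min_le_left _ _)), hVb y (lt_of_lt_of_le hy (min_le_right _ _))⟩⟩
  isOpen_sUnion := by
    intro 𝒰 h𝒰 x hx
    obtain ⟨U, hU, hxU⟩ := hx
    obtain ⟨ε, hε, h⟩ := h𝒰 U hU x hxU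
    exact ⟨ε, hε, fun y hy => ⟨U, hU, h y hy⟩⟩

/-! ### Gauss norms and convergence of series in `π`, `T₁, …, T_m`, `U₁, …, U_n`

Such a series is a power series in the variables `T` (indexed by `Fin m`) and `U` (indexed by
`Fin n`) whose coefficients lie in a ring `E` of Laurent series in `π`.  A weight
`wt : E → ℤ → ℝ` gives the size `wt x i` of the `i`-th term of `x`. -/

section Gauss

variable {E : Type u} [CommRing E] {m n : ℕ}

/-- The terms of the series `F` of size at least `ε` have exponents of `π` bounded below and, for
each fixed exponent `β` of `U`, there are only finitely many of them.  Equivalently, `F` is a limit,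
for the Gauss norm, of series whose exponents of `π` are bounded below and whose coefficient at each
`U^β` is a polynomial in `π`, `π⁻¹`, `T₁, …, T_m`. -/
def IsConvergent (wt : E → ℤ → ℝ) (F : MvPowerSeries (Fin m ⊕ Fin n) E) : Prop :=
  ∀ ε : ℝ, 0 < ε →
    (∃ N : ℤ, ∀ i γ, ε ≤ wt (MvPowerSeries.coeff γ F) i → N ≤ i) ∧
    ∀ β : Fin n → ℕ, {p : ℤ × (Fin m ⊕ Fin n →₀ ℕ) |
      (∀ l, p.2 (Sum.inr l) = β l) ∧ ε ≤ wt (MvPowerSeries.coeff p.2 F) p.1}.Finite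

/-- The Gauss norm: the supremum of the sizes of all terms. -/
def gaussNorm (wt : E → ℤ → ℝ) (F : MvPowerSeries (Fin m ⊕ Fin n) E) : ℝ :=
  ⨆ p : ℤ × (Fin m ⊕ Fin n →₀ ℕ), wt (MvPowerSeries.coeff p.2 F) p.1

/-- The properties of the weights below that make convergent series into a ring. -/
structure IsWeight (wt : E → ℤ → ℝ) : Prop where
  nonneg : ∀ x i, 0 ≤ wt x i
  zero : ∀ i, wt 0 i = 0
  neg : ∀ x i, wt (-x) i = wt x i
  add : ∀ x y i, wt (x + y) i ≤ max (wt x i) (wt y i)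
  mul : ∀ x y i ε, 0 < ε → ε ≤ wt (x * y) i → ∃ i₁ i₂, i₁ + i₂ = i ∧ ε ≤ wt x i₁ * wt y i₂
  bdd : ∀ N : ℤ, ∃ C : ℝ, ∀ x i, N ≤ i → wt x i ≤ C

theorem IsWeight.exists_of_sum {wt : E → ℤ → ℝ} (h : IsWeight wt) {ι : Type*} (s : Finset ι)
    (f : ι → E) (i : ℤ) (ε : ℝ) (hε : 0 < ε) (hs : ε ≤ wt (∑ j ∈ s, f j) i) :
    ∃ j ∈ s, ε ≤ wt (f j) i := by
  classical
  induction s using Finset.induction_on with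
  | empty => simp only [Finset.sum_empty, h.zero] at hs; linarith
  | insert a s ha ih =>
    rw [Finset.sum_insert ha] at hs
    rcases le_max_iff.1 (hs.trans (h.add _ _ _)) with h1 | h1
    · exact ⟨a, Finset.mem_insert_self _ _, h1⟩
    · obtain ⟨j, hj, hj'⟩ := ih h1
      exact ⟨j, Finset.mem_insert_of_mem hj, hj'⟩

theorem IsConvergent.bounded {wt : E → ℤ → ℝ} (h : IsWeight wt)
    {F : MvPowerSeries (Fin m ⊕ Fin n) E} (hF : IsConvergent wt F) :
    ∃ C : ℝ, 0 < C ∧ ∀ i γ, wt (MvPowerSeries.coeff γ F) i ≤ C := by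
  obtain ⟨N, hN⟩ := (hF 1 one_pos).1
  obtain ⟨C, hC⟩ := h.bdd N
  refine ⟨max C 1, lt_max_of_lt_right one_pos, fun i γ => ?_⟩
  by_cases h1 : 1 ≤ wt (MvPowerSeries.coeff γ F) i
  · exact (hC _ _ (hN _ _ h1)).trans (le_max_left _ _)
  · exact (le_of_lt (not_le.1 h1)).trans (le_max_right _ _)

theorem IsConvergent.neg {wt : E → ℤ → ℝ} (h : IsWeight wt)
    {F : MvPowerSeries (Fin m ⊕ Fin n) E} (hF : IsConvergent wt F) : IsConvergent wt (-F) := by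
  intro ε hε
  simpa only [map_neg, h.neg] using hF ε hε

theorem IsConvergent.add {wt : E → ℤ → ℝ} (h : IsWeight wt)
    {F G : MvPowerSeries (Fin m ⊕ Fin n) E} (hF : IsConvergent wt F) (hG : IsConvergent wt G) :
    IsConvergent wt (F + G) := by
  intro ε hε
  obtain ⟨⟨N, hN⟩, hF2⟩ := hF ε hε
  obtain ⟨⟨M, hM⟩, hG2⟩ := hG ε hε
  have key : ∀ i γ, ε ≤ wt (MvPowerSeries.coeff γ (F + G)) i →
      ε ≤ wt (MvPowerSeries.coeff γ F) i ∨ ε ≤ wt (MvPowerSeries.coeff γ G) i := by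
    intro i γ hi
    rw [map_add] at hi
    exact le_max_iff.1 (hi.trans (h.add _ _ _))
  refine ⟨⟨min N M, fun i γ hi => ?_⟩, fun β => ?_⟩
  · rcases key i γ hi with h1 | h1
    · exact (min_le_left _ _).trans (hN _ _ h1)
    · exact (min_le_right _ _).trans (hM _ _ h1)
  · refine ((hF2 β).union (hG2 β)).subset ?_
    rintro p ⟨hp, hp'⟩
    rcases key _ _ hp' with h1 | h1
    · exact Or.inl ⟨hp, h1⟩
    · exact Or.inr ⟨hp, h1⟩

theorem IsConvergent.mul {wt : E → ℤ → ℝ} (h : IsWeight wt)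
    {F G : MvPowerSeries (Fin m ⊕ Fin n) E} (hF : IsConvergent wt F) (hG : IsConvergent wt G) :
    IsConvergent wt (F * G) := by
  classical
  intro ε hε
  obtain ⟨C, hC, hFC⟩ := hF.bounded h
  obtain ⟨D, hD, hGD⟩ := hG.bounded h
  have key : ∀ i γ, ε ≤ wt (MvPowerSeries.coeff γ (F * G)) i →
      ∃ i₁ i₂ γ₁ γ₂, i₁ + i₂ = i ∧ γ₁ + γ₂ = γ ∧
        ε / D ≤ wt (MvPowerSeries.coeff γ₁ F) i₁ ∧ ε / C ≤ wt (MvPowerSeries.coeff γ₂ G) i₂ := by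
    intro i γ hi
    rw [MvPowerSeries.coeff_mul] at hi
    obtain ⟨q, hq, hq'⟩ := h.exists_of_sum _ _ _ _ hε hi
    obtain ⟨i₁, i₂, hi12, hle⟩ := h.mul _ _ _ _ hε hq'
    refine ⟨i₁, i₂, q.1, q.2, hi12, by simpa using hq, ?_, ?_⟩
    · rw [div_le_iff₀ hD]
      exact hle.trans (mul_le_mul_of_nonneg_left (hGD _ _) (h.nonneg _ _))
    · rw [div_le_iff₀ hC, mul_comm]
      exact hle.trans (mul_le_mul_of_nonneg_right (hFC _ _) (h.nonneg _ _))
  obtain ⟨⟨N, hN⟩, hF2⟩ := hF (ε / D) (div_pos hε hD)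
  obtain ⟨⟨M, hM⟩, hG2⟩ := hG (ε / C) (div_pos hε hC)
  refine ⟨⟨N + M, fun i γ hi => ?_⟩, fun β => ?_⟩
  · obtain ⟨i₁, i₂, γ₁, γ₂, rfl, -, h1, h2⟩ := key i γ hi
    exact add_le_add (hN _ _ h1) (hM _ _ h2)
  · have hfin : (⋃ b ∈ Set.Iic β, ⋃ c ∈ Set.Iic β, Set.image2 (fun p q => p + q)
        {p : ℤ × (Fin m ⊕ Fin n →₀ ℕ) | (∀ l, p.2 (Sum.inr l) = b l) ∧
          ε / D ≤ wt (MvPowerSeries.coeff p.2 F) p.1}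
        {p : ℤ × (Fin m ⊕ Fin n →₀ ℕ) | (∀ l, p.2 (Sum.inr l) = c l) ∧
          ε / C ≤ wt (MvPowerSeries.coeff p.2 G) p.1}).Finite :=
      (Set.finite_Iic β).biUnion fun b _ => (Set.finite_Iic β).biUnion fun c _ =>
        (hF2 b).image2 _ (hG2 c)
    refine hfin.subset ?_
    rintro ⟨i, γ⟩ ⟨hp, hp'⟩
    obtain ⟨i₁, i₂, γ₁, γ₂, rfl, rfl, h1, h2⟩ := key i γ hp'
    simp only [Finsupp.add_apply] at hp
    simp only [Set.mem_iUnion]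
    refine ⟨fun l => γ₁ (Sum.inr l), fun l => ?_, fun l => γ₂ (Sum.inr l), fun l => ?_,
      (i₁, γ₁), ⟨fun _ => rfl, h1⟩, (i₂, γ₂), ⟨fun _ => rfl, h2⟩, rfl⟩
    · have := hp l; show γ₁ (Sum.inr l) ≤ β l; omega
    · have := hp l; show γ₂ (Sum.inr l) ≤ β l; omega

theorem IsConvergent.const {wt : E → ℤ → ℝ} (h : IsWeight wt) (c : E)
    (hc : ∀ ε : ℝ, 0 < ε → {i | ε ≤ wt c i}.Finite) :
    IsConvergent wt (MvPowerSeries.C c : MvPowerSeries (Fin m ⊕ Fin n) E) := by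
  classical
  intro ε hε
  have key : ∀ i γ, ε ≤ wt (MvPowerSeries.coeff γ
      (MvPowerSeries.C c : MvPowerSeries (Fin m ⊕ Fin n) E)) i → γ = 0 ∧ ε ≤ wt c i := by
    intro i γ hi
    rw [MvPowerSeries.coeff_C] at hi
    split_ifs at hi with h0
    · exact ⟨h0, hi⟩
    · rw [h.zero] at hi; linarith
  refine ⟨?_, fun β => ?_⟩
  · obtain ⟨N, hN⟩ := (hc ε hε).bddBelow
    exact ⟨N, fun i γ hi => hN (key i γ hi).2⟩
  · refine ((hc ε hε).image fun i => (i, (0 : Fin m ⊕ Fin n →₀ ℕ))).subset ?_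
    rintro ⟨i, γ⟩ ⟨-, hp⟩
    obtain ⟨rfl, h2⟩ := key i γ hp
    exact ⟨i, h2, rfl⟩

end Gauss

/-! ### The ring of series `∑_{i ∈ ℤ} a_i π^i` with `a_i ∈ 𝔬` and `a_i → 0` for `i → -∞` -/

section BiLaurent

variable (O : Type u) [CommRing O] [IsLocalRing O]

/-- The transition map `(𝔬/𝔪^{n+1})((π)) → (𝔬/𝔪^n)((π))`, applied coefficientwise. -/
def laurentTransition (n : ℕ) (x : LaurentSeries (O ⧸ maximalIdeal O ^ (n + 1))) :
    LaurentSeries (O ⧸ maximalIdeal O ^ n) :=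
  HahnSeries.map x (Ideal.Quotient.factorPow (maximalIdeal O) n.le_succ)

/-- The inverse limit of the rings `(𝔬/𝔪^n)((π))`. -/
def biLaurentRing : Subring (∀ n : ℕ, LaurentSeries (O ⧸ maximalIdeal O ^ n)) where
  carrier := {x | ∀ n, laurentTransition O n (x (n + 1)) = x n}
  mul_mem' := by
    intro x y hx hy n
    have h1 := hx n
    have h2 := hy n
    rw [Pi.mul_apply, Pi.mul_apply, ← h1, ← h2]
    exact HahnSeries.map_mul (Ideal.Quotient.factorPow (maximalIdeal O) n.le_succ).toNonUnitalRingHom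
  one_mem' := by
    intro n
    exact HahnSeries.map_one (Ideal.Quotient.factorPow (maximalIdeal O) n.le_succ).toMonoidWithZeroHom
  add_mem' := by
    intro x y hx hy n
    have h1 := hx n
    have h2 := hy n
    rw [Pi.add_apply, Pi.add_apply, ← h1, ← h2]
    ext i
    exact map_add (Ideal.Quotient.factorPow (maximalIdeal O) n.le_succ) _ _
  zero_mem' := by
    intro n
    ext i
    exact map_zero (Ideal.Quotient.factorPow (maximalIdeal O) n.le_succ)
  neg_mem' := by
    intro x hx n
    have h1 := hx n
    rw [Pi.neg_apply, Pi.neg_apply, ← h1]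
    ext i
    exact map_neg (Ideal.Quotient.factorPow (maximalIdeal O) n.le_succ) _

/-- The ring of series `∑_{i ∈ ℤ} a_i π^i` with `a_i → 0` for `i → -∞`, for complete `𝔬`:
see `BiLaurent.existsUnique`. -/
abbrev BiLaurent : Type u := biLaurentRing O

/-- The constant series. -/
def biLaurentConst : O →+* BiLaurent O :=
  RingHom.codRestrict (RingHom.pi fun n => (HahnSeries.C : _ →+* LaurentSeries _).comp
    (Ideal.Quotient.mk (maximalIdeal O ^ n))) (biLaurentRing O) (by
      intro a n
      exact HahnSeries.map_C (Ideal.Quotient.mk (maximalIdeal O ^ (n + 1)) a)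
        (Ideal.Quotient.factorPow (maximalIdeal O) n.le_succ))

instance : Algebra O (BiLaurent O) := (biLaurentConst O).toAlgebra

variable {O}

theorem BiLaurent.exists_coeff [IsAdicComplete (maximalIdeal O) O] (x : BiLaurent O) (i : ℤ) :
    ∃ a : O, ∀ n, Ideal.Quotient.mk (maximalIdeal O ^ n) a = (x.1 n).coeff i := by
  choose f hf using fun n => Ideal.Quotient.mk_surjective ((x.1 n).coeff i)
  have hstep : ∀ m k, Ideal.Quotient.mk (maximalIdeal O ^ m) (f (m + k)) =
      (x.1 m).coeff i := by
    intro m k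
    induction k with
    | zero => exact hf m
    | succ k ih =>
      rw [← ih, Ideal.Quotient.eq]
      have h1 : Ideal.Quotient.factorPow (maximalIdeal O) (m + k).le_succ
          (Ideal.Quotient.mk _ (f (m + k + 1))) = Ideal.Quotient.mk _ (f (m + k)) := by
        rw [hf, hf, ← x.2 (m + k)]
        rfl
      rw [Ideal.Quotient.factor_mk, Ideal.Quotient.eq] at h1
      exact Ideal.pow_le_pow_right (Nat.le_add_right m k) h1
  obtain ⟨L, hL⟩ := IsPrecomplete.prec' (I := maximalIdeal O) (M := O) f (by
    intro m n hmn
    obtain ⟨k, rfl⟩ := Nat.exists_eq_add_of_le hmn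
    rw [SModEq.sub_mem, smul_eq_mul, Ideal.mul_top, ← Ideal.Quotient.eq, hstep m k, hf])
  refine ⟨L, fun n => ?_⟩
  have := hL n
  rw [SModEq.sub_mem, smul_eq_mul, Ideal.mul_top, ← Ideal.Quotient.eq, hf] at this
  exact this.symm

/-- The coefficient `a_i ∈ 𝔬` of `∑ a_i π^i`. -/
def BiLaurent.coeff [IsAdicComplete (maximalIdeal O) O] (x : BiLaurent O) (i : ℤ) : O :=
  (BiLaurent.exists_coeff x i).choose

theorem BiLaurent.mk_coeff [IsAdicComplete (maximalIdeal O) O] (x : BiLaurent O) (i : ℤ) (n : ℕ) :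
    Ideal.Quotient.mk (maximalIdeal O ^ n) (x.coeff i) = (x.1 n).coeff i :=
  (BiLaurent.exists_coeff x i).choose_spec n

theorem eq_of_mk_eq [IsAdicComplete (maximalIdeal O) O] {a b : O}
    (h : ∀ n, Ideal.Quotient.mk (maximalIdeal O ^ n) a = Ideal.Quotient.mk _ b) : a = b := by
  rw [← sub_eq_zero]
  refine IsHausdorff.haus' (I := maximalIdeal O) _ fun n => ?_
  rw [SModEq.sub_mem, smul_eq_mul, Ideal.mul_top, sub_zero, ← Ideal.Quotient.eq]
  exact h n

/-- A family `(a_i)_{i ∈ ℤ}` is the family of coefficients of an element, necessarily unique, iff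
`a_i → 0` for `i → -∞`. -/
theorem BiLaurent.existsUnique [IsAdicComplete (maximalIdeal O) O] (a : ℤ → O) :
    (∃! x : BiLaurent O, ∀ i, x.coeff i = a i) ↔
      ∀ n : ℕ, ∃ N : ℤ, ∀ i < N, a i ∈ maximalIdeal O ^ n := by
  constructor
  · rintro ⟨x, hx, -⟩ n
    refine ⟨(x.1 n).order, fun i hi => ?_⟩
    rw [← Ideal.Quotient.eq_zero_iff_mem, ← hx i, BiLaurent.mk_coeff]
    exact HahnSeries.coeff_eq_zero_of_lt_order hi
  · intro ha
    let y : ∀ n : ℕ, LaurentSeries (O ⧸ maximalIdeal O ^ n) := fun n =>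
      HahnSeries.ofSuppBddBelow (fun i => Ideal.Quotient.mk _ (a i)) (by
        obtain ⟨N, hN⟩ := ha n
        refine ⟨N, fun i hi => ?_⟩
        by_contra h0
        exact hi (Ideal.Quotient.eq_zero_iff_mem.2 (hN i (not_le.1 h0))))
    refine ⟨⟨y, fun n => by ext i; rfl⟩, fun i => eq_of_mk_eq fun n => ?_, ?_⟩
    · rw [BiLaurent.mk_coeff]; rfl
    · intro z hz
      refine Subtype.ext (funext fun n => ?_)
      ext i
      rw [← BiLaurent.mk_coeff z i n, hz]
      rfl

theorem BiLaurent.coeff_zero [IsAdicComplete (maximalIdeal O) O] (i : ℤ) :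
    (0 : BiLaurent O).coeff i = 0 :=
  eq_of_mk_eq fun n => by rw [BiLaurent.mk_coeff, map_zero]; rfl

theorem BiLaurent.coeff_add [IsAdicComplete (maximalIdeal O) O] (x y : BiLaurent O) (i : ℤ) :
    (x + y).coeff i = x.coeff i + y.coeff i :=
  eq_of_mk_eq fun n => by rw [map_add]; simp only [BiLaurent.mk_coeff]; rfl

theorem BiLaurent.coeff_neg [IsAdicComplete (maximalIdeal O) O] (x : BiLaurent O) (i : ℤ) :
    (-x).coeff i = -x.coeff i :=
  eq_of_mk_eq fun n => by rw [map_neg]; simp only [BiLaurent.mk_coeff]; rfl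

theorem BiLaurent.coeff_algebraMap [IsAdicComplete (maximalIdeal O) O] (a : O) (i : ℤ) :
    (algebraMap O (BiLaurent O) a).coeff i = if i = 0 then a else 0 :=
  eq_of_mk_eq fun n => by
    rw [BiLaurent.mk_coeff]
    show (HahnSeries.C (Ideal.Quotient.mk (maximalIdeal O ^ n) a) : LaurentSeries _).coeff i = _
    rw [HahnSeries.C_apply, HahnSeries.coeff_single]
    split_ifs
    · rfl
    · rw [map_zero]

end BiLaurent

/-! ### The rings of overconvergent series -/

section DaggerRing

variable {O : Type u} [CommRing O] [IsDomain O] [IsDiscreteValuationRing O]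

/-- The absolute value of `𝔬` for which a generator of `𝔪` has absolute value `ρ`. -/
def absO (ρ : Set.Ioo (0 : ℝ) 1) (a : O) : ℝ :=
  open Classical in
  if a = 0 then 0 else (ρ : ℝ) ^ (IsDiscreteValuationRing.addVal O a).toNat

theorem absO_nonneg (ρ : Set.Ioo (0 : ℝ) 1) (a : O) : 0 ≤ absO ρ a := by
  unfold absO
  split_ifs
  · exact le_rfl
  · exact pow_nonneg ρ.2.1.le _

theorem absO_le_one (ρ : Set.Ioo (0 : ℝ) 1) (a : O) : absO ρ a ≤ 1 := by
  unfold absO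
  split_ifs
  · exact zero_le_one
  · exact pow_le_one₀ ρ.2.1.le ρ.2.2.le

theorem absO_zero (ρ : Set.Ioo (0 : ℝ) 1) : absO ρ (0 : O) = 0 := if_pos rfl

theorem absO_mul (ρ : Set.Ioo (0 : ℝ) 1) (a b : O) : absO ρ (a * b) = absO ρ a * absO ρ b := by
  unfold absO
  by_cases ha : a = 0
  · simp [ha]
  by_cases hb : b = 0
  · simp [hb]
  rw [if_neg ha, if_neg hb, if_neg (mul_ne_zero ha hb), IsDiscreteValuationRing.addVal_mul,
    ENat.toNat_add (mt IsDiscreteValuationRing.addVal_eq_top_iff.1 ha)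
      (mt IsDiscreteValuationRing.addVal_eq_top_iff.1 hb), pow_add]

theorem absO_neg (ρ : Set.Ioo (0 : ℝ) 1) (a : O) : absO ρ (-a) = absO ρ a := by
  unfold absO
  rw [AddValuation.map_neg]
  by_cases ha : a = 0
  · simp [ha]
  · rw [if_neg ha, if_neg (neg_ne_zero.2 ha)]

theorem mem_pow_iff (a : O) (n : ℕ) :
    a ∈ maximalIdeal O ^ n ↔ (n : ℕ∞) ≤ IsDiscreteValuationRing.addVal O a := by
  obtain ⟨ϖ, hϖ⟩ := IsDiscreteValuationRing.exists_irreducible O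
  rw [hϖ.maximalIdeal_eq, Ideal.span_singleton_pow, Ideal.mem_span_singleton,
    ← IsDiscreteValuationRing.addVal_le_iff_dvd, hϖ.addVal_pow]

/-- If `a` lies in every power of `𝔪` that contains `b`, then `|a| ≤ |b|`. -/
theorem absO_le_of_mem (ρ : Set.Ioo (0 : ℝ) 1) {a b : O}
    (h : ∀ n : ℕ, b ∈ maximalIdeal O ^ n → a ∈ maximalIdeal O ^ n) : absO ρ a ≤ absO ρ b := by
  by_cases ha : a = 0
  · rw [ha, absO_zero]; exact absO_nonneg ρ b
  have hat : IsDiscreteValuationRing.addVal O a ≠ ⊤ :=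
    mt IsDiscreteValuationRing.addVal_eq_top_iff.1 ha
  by_cases hb : b = 0
  · exfalso
    apply ha
    refine IsHausdorff.haus' (I := maximalIdeal O) _ fun n => ?_
    rw [SModEq.sub_mem, smul_eq_mul, Ideal.mul_top, sub_zero]
    exact h n (hb ▸ zero_mem _)
  have hbt : IsDiscreteValuationRing.addVal O b ≠ ⊤ :=
    mt IsDiscreteValuationRing.addVal_eq_top_iff.1 hb
  unfold absO
  rw [if_neg ha, if_neg hb]
  refine pow_le_pow_of_le_one ρ.2.1.le ρ.2.2.le ?_
  have h1 := (mem_pow_iff _ _).1 (h (IsDiscreteValuationRing.addVal O b).toNat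
    ((mem_pow_iff _ _).2 (by rw [ENat.natCast_toNat hbt])))
  rwa [← ENat.natCast_toNat hat, Nat.cast_le] at h1

theorem absO_add (ρ : Set.Ioo (0 : ℝ) 1) (a b : O) :
    absO ρ (a + b) ≤ max (absO ρ a) (absO ρ b) := by
  rcases le_total (absO ρ a) (absO ρ b) with hab | hab
  all_goals
    by_contra hlt
    rw [not_le, max_lt_iff] at hlt
    obtain ⟨h1, h2⟩ := hlt
    have h1' := mt (absO_le_of_mem ρ) (not_le.2 h1)
    have h2' := mt (absO_le_of_mem ρ) (not_le.2 h2)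
    push Not at h1' h2'
    obtain ⟨n, hn, hn'⟩ := h1'
    obtain ⟨k, hk, hk'⟩ := h2'
    rcases le_total n k with hnk | hnk
    · exact hn' (Ideal.add_mem _ hn (Ideal.pow_le_pow_right hnk hk))
    · exact hk' (Ideal.add_mem _ (Ideal.pow_le_pow_right hnk hn) hk)

/-- An element that does not vanish modulo `𝔪` has absolute value `1`. -/
theorem absO_eq_one (ρ : Set.Ioo (0 : ℝ) 1) {a : O} (h : residue O a ≠ 0) : absO ρ a = 1 := by
  refine le_antisymm (absO_le_one ρ a) ?_
  have h1 : absO ρ (1 : O) = 1 := by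
    rw [absO, if_neg one_ne_zero, IsDiscreteValuationRing.addVal_one]; simp
  rw [← h1]
  refine absO_le_of_mem ρ fun n hn => ?_
  cases n with
  | zero => simp
  | succ n =>
    exact absurd ((residue_eq_zero_iff a).2 (Ideal.pow_le_self (Nat.succ_ne_zero n) hn)) h

variable [IsAdicComplete (maximalIdeal O) O]

/-- The size `|a_i| ω^{r i}` of the `i`-th term of `∑ a_i π^i`. -/
def weight (ρ ω : Set.Ioo (0 : ℝ) 1) (r : ℝ) (x : BiLaurent O) (i : ℤ) : ℝ :=
  absO ρ (x.coeff i) * (ω : ℝ) ^ (r * (i : ℝ))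

theorem rpow_pos (ω : Set.Ioo (0 : ℝ) 1) (t : ℝ) : 0 < (ω : ℝ) ^ t :=
  Real.rpow_pos_of_pos ω.2.1 t

theorem rpow_le {ω : Set.Ioo (0 : ℝ) 1} {s t : ℝ} (h : s ≤ t) : (ω : ℝ) ^ t ≤ (ω : ℝ) ^ s :=
  Real.rpow_le_rpow_of_exponent_ge ω.2.1 ω.2.2.le h

/-- The exponents `i` with `ω^{r i} ≥ ε` are bounded above. -/
theorem exists_bound (ω : Set.Ioo (0 : ℝ) 1) {r ε : ℝ} (hr : 0 < r) (hε : 0 < ε) :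
    ∃ M : ℤ, ∀ i : ℤ, ε ≤ (ω : ℝ) ^ (r * (i : ℝ)) → i ≤ M := by
  refine ⟨⌈Real.logb ω ε / r⌉, fun i hi => ?_⟩
  have h1 : r * (i : ℝ) ≤ Real.logb ω ε := by
    rw [Real.le_logb_iff_rpow_le_of_base_lt_one ω.2.1 ω.2.2 hε]
    exact hi
  have h2 : (i : ℝ) ≤ Real.logb ω ε / r := by
    rw [le_div_iff₀ hr, mul_comm]; exact h1
  exact_mod_cast h2.trans (Int.le_ceil _)

theorem isWeight (ρ ω : Set.Ioo (0 : ℝ) 1) {r : ℝ} (hr : 0 < r) :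
    IsWeight (weight (O := O) ρ ω r) where
  nonneg x i := mul_nonneg (absO_nonneg _ _) (rpow_pos _ _).le
  zero i := by rw [weight, BiLaurent.coeff_zero, absO_zero, zero_mul]
  neg x i := by rw [weight, weight, BiLaurent.coeff_neg, absO_neg]
  add x y i := by
    unfold weight
    rw [← max_mul_of_nonneg _ _ (rpow_pos _ _).le, BiLaurent.coeff_add]
    exact mul_le_mul_of_nonneg_right (absO_add _ _ _) (rpow_pos _ _).le
  mul x y i ε hε h := by
    have key : ∃ i₁ i₂, i₁ + i₂ = i ∧
        absO ρ ((x * y).coeff i) ≤ absO ρ (x.coeff i₁ * y.coeff i₂) := by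
      by_contra hcon
      push Not at hcon
      by_cases hc : (x * y).coeff i = 0
      · have := hcon i 0 (add_zero i)
        rw [hc, absO_zero] at this
        exact absurd this (not_lt.2 (absO_nonneg _ _))
      have hct : IsDiscreteValuationRing.addVal O ((x * y).coeff i) ≠ ⊤ :=
    mt IsDiscreteValuationRing.addVal_eq_top_iff.1 hc
      set v := (IsDiscreteValuationRing.addVal O ((x * y).coeff i)).toNat with hv
      have hnot : (x * y).coeff i ∉ maximalIdeal O ^ (v + 1) := by
        rw [mem_pow_iff, ← ENat.natCast_toNat hct, ← hv, Nat.cast_le]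
        omega
      apply hnot
      rw [← Ideal.Quotient.eq_zero_iff_mem, BiLaurent.mk_coeff]
      show (x.1 (v + 1) * y.1 (v + 1)).coeff i = 0
      rw [HahnSeries.coeff_mul]
      refine Finset.sum_eq_zero fun q hq => ?_
      rw [← BiLaurent.mk_coeff, ← BiLaurent.mk_coeff, ← map_mul,
        Ideal.Quotient.eq_zero_iff_mem]
      by_contra hmem
      have hq' : q.1 + q.2 = i := (Finset.mem_antidiagonal.1 hq).2.2
      refine absurd (hcon q.1 q.2 hq') (not_lt.2 (absO_le_of_mem ρ fun n hn => ?_))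
      rw [mem_pow_iff, ← ENat.natCast_toNat hct, ← hv, Nat.cast_le]
      by_contra hlt
      exact hmem (Ideal.pow_le_pow_right (by omega) hn)
    obtain ⟨i₁, i₂, rfl, hle⟩ := key
    refine ⟨i₁, i₂, rfl, h.trans ?_⟩
    unfold weight
    rw [absO_mul] at hle
    calc _ ≤ absO ρ (x.coeff i₁) * absO ρ (y.coeff i₂) * (ω : ℝ) ^ (r * ((i₁ + i₂ : ℤ) : ℝ)) :=
          mul_le_mul_of_nonneg_right hle (rpow_pos _ _).le
      _ = _ := by
          rw [Int.cast_add, mul_add, Real.rpow_add ω.2.1]; ring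
  bdd N := by
    refine ⟨(ω : ℝ) ^ (r * (N : ℝ)), fun x i hi => ?_⟩
    calc weight ρ ω r x i ≤ 1 * (ω : ℝ) ^ (r * (i : ℝ)) :=
          mul_le_mul_of_nonneg_right (absO_le_one _ _) (rpow_pos _ _).le
      _ ≤ _ := by
          rw [one_mul]
          exact rpow_le (mul_le_mul_of_nonneg_left (by exact_mod_cast hi) hr.le)

theorem weight_const (ρ ω : Set.Ioo (0 : ℝ) 1) (r : ℝ) (a : O) (ε : ℝ) (hε : 0 < ε) :
    {i | ε ≤ weight ρ ω r (algebraMap O (BiLaurent O) a) i}.Finite := by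
  refine (Set.finite_singleton (0 : ℤ)).subset fun i hi => ?_
  by_contra h0
  have h0' : ¬ i = 0 := h0
  have h1 : ε ≤ weight ρ ω r (algebraMap O (BiLaurent O) a) i := hi
  rw [weight, BiLaurent.coeff_algebraMap, if_neg h0', absO_zero, zero_mul] at h1
  linarith

/-- Convergence for the `r`-Gauss norm implies convergence for the `s`-Gauss norm if `s ≤ r`. -/
theorem IsConvergent.mono (ρ ω : Set.Ioo (0 : ℝ) 1) {r s : ℝ} (hs : 0 < s) (hsr : s ≤ r)
    {m n : ℕ} {F : MvPowerSeries (Fin m ⊕ Fin n) (BiLaurent O)}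
    (hF : IsConvergent (weight ρ ω r) F) : IsConvergent (weight ρ ω s) F := by
  intro ε hε
  obtain ⟨M, hM⟩ := exists_bound ω hs hε
  have hδ : 0 < ε * (ω : ℝ) ^ ((r - s) * (M : ℝ)) := mul_pos hε (rpow_pos _ _)
  have key : ∀ i γ, ε ≤ weight ρ ω s (MvPowerSeries.coeff γ F) i →
      ε * (ω : ℝ) ^ ((r - s) * (M : ℝ)) ≤ weight ρ ω r (MvPowerSeries.coeff γ F) i := by
    intro i γ hi
    have hiM : i ≤ M := by
      refine hM i (hi.trans ?_)
      calc _ ≤ 1 * (ω : ℝ) ^ (s * (i : ℝ)) :=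
            mul_le_mul_of_nonneg_right (absO_le_one _ _) (rpow_pos _ _).le
        _ = _ := one_mul _
    have e : weight ρ ω r (MvPowerSeries.coeff γ F) i =
        weight ρ ω s (MvPowerSeries.coeff γ F) i * (ω : ℝ) ^ ((r - s) * (i : ℝ)) := by
      unfold weight
      rw [mul_assoc, ← Real.rpow_add ω.2.1]
      congr 2
      ring
    rw [e]
    refine mul_le_mul hi (rpow_le ?_) (rpow_pos _ _).le (hε.le.trans hi)
    exact mul_le_mul_of_nonneg_left (by exact_mod_cast hiM) (sub_nonneg.2 hsr)
  obtain ⟨⟨N, hN⟩, hfin⟩ := hF _ hδ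
  exact ⟨⟨N, fun i γ hi => hN i γ (key i γ hi)⟩,
    fun β => (hfin β).subset fun p hp => ⟨hp.1, key _ _ hp.2⟩⟩

variable (O) in
/-- The ring `𝐀⟨T₁, …, T_m⟩⟨⟨U₁, …, U_n⟩⟩^{†,r}`: the completion of
`𝔬[π, T₁, …, T_m]⟦U₁, …, U_n⟧[π⁻¹]` for the `r`-Gauss norm, as a ring of series. -/
def daggerRadius (ρ ω : Set.Ioo (0 : ℝ) 1) (m n : ℕ) (r : Set.Ioi (0 : ℝ)) :
    Subalgebra O (MvPowerSeries (Fin m ⊕ Fin n) (BiLaurent O)) where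
  carrier := {F | IsConvergent (weight ρ ω r) F}
  mul_mem' hF hG := IsConvergent.mul (isWeight ρ ω r.2) hF hG
  add_mem' hF hG := IsConvergent.add (isWeight ρ ω r.2) hF hG
  algebraMap_mem' a := by
    rw [MvPowerSeries.algebraMap_apply]
    exact IsConvergent.const (isWeight ρ ω r.2) _ (weight_const ρ ω r a)

variable (O) in
/-- The ring `𝐀⟨T₁, …, T_m⟩⟨⟨U₁, …, U_n⟩⟩^†`, the union of the `daggerRadius` over all `r > 0`. -/
def dagger (ρ ω : Set.Ioo (0 : ℝ) 1) (m n : ℕ) :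
    Subalgebra O (MvPowerSeries (Fin m ⊕ Fin n) (BiLaurent O)) where
  carrier := {F | ∃ r : Set.Ioi (0 : ℝ), F ∈ daggerRadius O ρ ω m n r}
  mul_mem' := by
    rintro F G ⟨r, hF⟩ ⟨s, hG⟩
    exact ⟨min r s, (daggerRadius O ρ ω m n (min r s)).mul_mem
      (IsConvergent.mono ρ ω (min r s).2 (min_le_left r s) hF)
      (IsConvergent.mono ρ ω (min r s).2 (min_le_right r s) hG)⟩
  add_mem' := by
    rintro F G ⟨r, hF⟩ ⟨s, hG⟩
    exact ⟨min r s, (daggerRadius O ρ ω m n (min r s)).add_mem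
      (IsConvergent.mono ρ ω (min r s).2 (min_le_left r s) hF)
      (IsConvergent.mono ρ ω (min r s).2 (min_le_right r s) hG)⟩
  algebraMap_mem' a := ⟨⟨1, Set.mem_Ioi.2 one_pos⟩, (daggerRadius O ρ ω m n _).algebraMap_mem a⟩

end DaggerRing

/-! ### Mixed affinoid algebras -/

section MixedAffinoid

variable (k : Type u) [Field k]

/-- The size `ω^i` of a nonzero term `a_i π^i` of a Laurent series over `k`. -/
def resWeight {k : Type u} [Field k] (ω : Set.Ioo (0 : ℝ) 1) (x : LaurentSeries k) (i : ℤ) : ℝ :=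
  open Classical in
  if x.coeff i = 0 then 0 else (ω : ℝ) ^ (i : ℝ)

variable {k} in
theorem isWeight_res (ω : Set.Ioo (0 : ℝ) 1) : IsWeight (resWeight (k := k) ω) where
  nonneg x i := by
    unfold resWeight
    split_ifs
    · exact le_rfl
    · exact (rpow_pos _ _).le
  zero i := if_pos rfl
  neg x i := by
    unfold resWeight
    rw [HahnSeries.coeff_neg]
    by_cases h : x.coeff i = 0
    · simp [h]
    · rw [if_neg h, if_neg (neg_ne_zero.2 h)]
  add x y i := by
    unfold resWeight
    by_cases hx : x.coeff i = 0
    · by_cases hy : y.coeff i = 0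
      · simp [hx, hy]
      · simp [hx, hy]
    · rw [if_neg hx]
      refine le_max_of_le_left ?_
      split_ifs
      · exact (rpow_pos _ _).le
      · exact le_rfl
  mul x y i ε hε h := by
    have hne : (x * y).coeff i ≠ 0 := by
      intro h0
      rw [resWeight, if_pos h0] at h
      linarith
    rw [resWeight, if_neg hne] at h
    rw [HahnSeries.coeff_mul] at hne
    obtain ⟨q, hq, hq'⟩ := Finset.exists_ne_zero_of_sum_ne_zero hne
    have hqi : q.1 + q.2 = i := (Finset.mem_antidiagonal.1 hq).2.2
    refine ⟨q.1, q.2, hqi, ?_⟩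
    rw [resWeight, resWeight, if_neg (left_ne_zero_of_mul hq'),
      if_neg (right_ne_zero_of_mul hq'), ← Real.rpow_add ω.2.1, ← Int.cast_add, hqi]
    exact h
  bdd N := by
    refine ⟨(ω : ℝ) ^ (N : ℝ), fun x i hi => ?_⟩
    unfold resWeight
    split_ifs
    · exact (rpow_pos _ _).le
    · exact rpow_le (by exact_mod_cast hi)

/-- The ring `k⟦π⟧⟨T₁, …, T_m⟩⟦U₁, …, U_n⟧[π⁻¹]`, as an algebra over `k((π))`: see
`mem_resRing_iff`. -/
def resRing (ω : Set.Ioo (0 : ℝ) 1) (m n : ℕ) :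
    Subalgebra (LaurentSeries k) (MvPowerSeries (Fin m ⊕ Fin n) (LaurentSeries k)) where
  carrier := {F | IsConvergent (resWeight ω) F}
  mul_mem' hF hG := IsConvergent.mul (isWeight_res ω) hF hG
  add_mem' hF hG := IsConvergent.add (isWeight_res ω) hF hG
  algebraMap_mem' c := by
    refine IsConvergent.const (isWeight_res ω) c fun ε hε => ?_
    obtain ⟨M, hM⟩ := exists_bound ω one_pos hε
    refine (Set.finite_Icc c.order M).subset fun i hi => ?_
    have h1 : ε ≤ resWeight ω c i := hi
    have hne : c.coeff i ≠ 0 := by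
      intro h0
      rw [resWeight, if_pos h0] at h1
      linarith
    rw [resWeight, if_neg hne] at h1
    exact ⟨HahnSeries.order_le_of_coeff_ne_zero hne, hM i (by rwa [one_mul])⟩

/-- Membership in `k⟦π⟧⟨T⟩⟦U⟧[π⁻¹]`, explicitly: the exponents of `π` are bounded below, and the
coefficient at each `U^β` is `π`-adically convergent in `T`. -/
theorem mem_resRing_iff (ω : Set.Ioo (0 : ℝ) 1) (m n : ℕ)
    (F : MvPowerSeries (Fin m ⊕ Fin n) (LaurentSeries k)) :
    F ∈ resRing k ω m n ↔
      (∃ N : ℤ, ∀ i γ, (MvPowerSeries.coeff γ F).coeff i ≠ 0 → N ≤ i) ∧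
      ∀ (M : ℤ) (β : Fin n → ℕ), {p : ℤ × (Fin m ⊕ Fin n →₀ ℕ) |
        (∀ l, p.2 (Sum.inr l) = β l) ∧ p.1 ≤ M ∧
          (MvPowerSeries.coeff p.2 F).coeff p.1 ≠ 0}.Finite := by
  have hw : ∀ (ε : ℝ), 0 < ε → ∀ (x : LaurentSeries k) i,
      ε ≤ resWeight ω x i ↔ x.coeff i ≠ 0 ∧ ε ≤ (ω : ℝ) ^ (i : ℝ) := by
    intro ε hε x i
    unfold resWeight
    split_ifs with h
    · simp [h, hε]
    · simp [h]
  constructor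
  · intro hF
    refine ⟨?_, fun M β => ?_⟩
    · obtain ⟨N, hN⟩ := (hF 1 one_pos).1
      refine ⟨min N 0, fun i γ hi => ?_⟩
      rcases le_total i 0 with h0 | h0
      · refine (min_le_left _ _).trans (hN i γ ((hw 1 one_pos _ _).2 ⟨hi, ?_⟩))
        exact Real.one_le_rpow_of_pos_of_le_one_of_nonpos ω.2.1 ω.2.2.le (by exact_mod_cast h0)
      · exact (min_le_right _ _).trans h0
    · refine ((hF _ (rpow_pos ω M)).2 β).subset ?_
      rintro p ⟨h1, h2, h3⟩
      exact ⟨h1, (hw _ (rpow_pos ω M) _ _).2 ⟨h3, rpow_le (by exact_mod_cast h2)⟩⟩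
  · rintro ⟨⟨N, hN⟩, hfin⟩ ε hε
    refine ⟨⟨N, fun i γ hi => hN i γ ((hw ε hε _ _).1 hi).1⟩, fun β => ?_⟩
    obtain ⟨M, hM⟩ := exists_bound ω one_pos hε
    refine (hfin M β).subset ?_
    rintro p ⟨h1, h2⟩
    obtain ⟨h3, h4⟩ := (hw ε hε _ _).1 h2
    exact ⟨h1, hM _ (by rwa [one_mul]), h3⟩

variable {k}

/-- The quotient norm on `A` induced by a surjection `φ : k⟦π⟧⟨T⟩⟦U⟧[π⁻¹] → A` from the `π`-adic
norm normalized by `|π| = ω`. -/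
def resQuotientNorm {ω : Set.Ioo (0 : ℝ) 1} {m n : ℕ} {A : Type v} [CommRing A]
    [Algebra (LaurentSeries k) A] (φ : resRing k ω m n →ₐ[LaurentSeries k] A) (a : A) : ℝ :=
  sInf {c : ℝ | ∃ b : resRing k ω m n, φ b = a ∧ gaussNorm (resWeight ω) b.1 = c}

variable (k) in
/-- Mixed affinoid algebras over `k((π))`: quotients of some `k⟦π⟧⟨T₁, …, T_m⟩⟦U₁, …, U_n⟧[π⁻¹]`.
The norm of `A`, which is determined up to equivalence, is the quotient norm
`resQuotientNorm`. -/
def IsMixedAffinoid (ω : Set.Ioo (0 : ℝ) 1) (A : Type v) [CommRing A]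
    [Algebra (LaurentSeries k) A] : Prop :=
  ∃ (m n : ℕ) (φ : resRing k ω m n →ₐ[LaurentSeries k] A), Function.Surjective φ

variable (k) in
/-- The norm condition on a ring homomorphism `ḡ : A₁ → A₂` of mixed affinoid algebras: for some
presentation of `A₂`, the quotient norm of `A₂` is multiplicative on the image of `k((π))`. -/
def NormCondition (ω : Set.Ioo (0 : ℝ) 1) {A₁ : Type v} {A₂ : Type w} [CommRing A₁] [CommRing A₂]
    [Algebra (LaurentSeries k) A₁] [Algebra (LaurentSeries k) A₂] (gbar : A₁ →+* A₂) : Prop :=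
  ∃ (m n : ℕ) (φ : resRing k ω m n →ₐ[LaurentSeries k] A₂), Function.Surjective φ ∧
    ∀ x y : LaurentSeries k,
      resQuotientNorm φ (gbar (algebraMap (LaurentSeries k) A₁ x) *
          gbar (algebraMap (LaurentSeries k) A₁ y)) =
        resQuotientNorm φ (gbar (algebraMap (LaurentSeries k) A₁ x)) *
          resQuotientNorm φ (gbar (algebraMap (LaurentSeries k) A₁ y))

end MixedAffinoid

/-! ### Dagger lifts and the weak topology -/

section DaggerLift

variable {O : Type u} [CommRing O] [IsDomain O] [IsDiscreteValuationRing O]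
  [IsAdicComplete (maximalIdeal O) O]

variable (O) in
/-- The isomorphism from `𝔬/𝔪^1` to the residue field. -/
def factorOne : O ⧸ maximalIdeal O ^ 1 →+* ResidueField O :=
  Ideal.Quotient.factor (Ideal.pow_le_self one_ne_zero)

variable (O) in
/-- Reduction modulo `𝔪` of series in `π`. -/
def biLaurentReduction : BiLaurent O →+* LaurentSeries (ResidueField O) where
  toFun x := HahnSeries.map (x.1 1) (factorOne O)
  map_one' := HahnSeries.map_one (factorOne O).toMonoidWithZeroHom
  map_mul' _ _ := HahnSeries.map_mul (factorOne O).toNonUnitalRingHom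
  map_zero' := by
    ext i
    exact map_zero (factorOne O)
  map_add' x y := by
    ext i
    exact map_add (factorOne O) _ _

theorem biLaurentReduction_coeff (x : BiLaurent O) (i : ℤ) :
    (biLaurentReduction O x).coeff i = residue O (x.coeff i) := by
  show factorOne O ((x.1 1).coeff i) = _
  rw [← BiLaurent.mk_coeff]
  rfl

variable (O) in
/-- Reduction modulo `𝔪`, from `𝐀⟨T⟩⟨⟨U⟩⟩^†` to `k⟦π⟧⟨T⟩⟦U⟧[π⁻¹]`. -/
def daggerReduction (ρ ω : Set.Ioo (0 : ℝ) 1) (m n : ℕ) :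
    dagger O ρ ω m n →+* resRing (ResidueField O) ω m n :=
  ((MvPowerSeries.map (biLaurentReduction O)).comp
    (dagger O ρ ω m n).val.toRingHom).codRestrict (resRing (ResidueField O) ω m n) (by
      rintro ⟨F, hF'⟩
      obtain ⟨r, hF⟩ : ∃ r, F ∈ daggerRadius O ρ ω m n r := hF'
      show MvPowerSeries.map (biLaurentReduction O) F ∈ resRing (ResidueField O) ω m n
      rw [mem_resRing_iff]
      have hne : ∀ i γ, (MvPowerSeries.coeff γ (MvPowerSeries.map (biLaurentReduction O) F)).coeff i
          ≠ 0 → weight ρ ω r (MvPowerSeries.coeff γ F) i = (ω : ℝ) ^ ((r : ℝ) * (i : ℝ)) := by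
        intro i γ h
        rw [MvPowerSeries.coeff_map, biLaurentReduction_coeff] at h
        rw [weight, absO_eq_one ρ h, one_mul]
      refine ⟨?_, fun M β => ?_⟩
      · obtain ⟨N, hN⟩ := (hF 1 one_pos).1
        refine ⟨min N 0, fun i γ hi => ?_⟩
        rcases le_total i 0 with h0 | h0
        · refine (min_le_left _ _).trans (hN i γ ?_)
          rw [hne i γ hi]
          exact Real.one_le_rpow_of_pos_of_le_one_of_nonpos ω.2.1 ω.2.2.le
            (mul_nonpos_of_nonneg_of_nonpos (le_of_lt r.2) (by exact_mod_cast h0))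
        · exact (min_le_right _ _).trans h0
      · refine ((hF _ (rpow_pos ω (r * M))).2 β).subset ?_
        rintro p ⟨h1, h2, h3⟩
        refine ⟨h1, ?_⟩
        rw [hne _ _ h3]
        exact rpow_le (mul_le_mul_of_nonneg_left (by exact_mod_cast h2) (le_of_lt r.2)))

variable (O) in
/-- Let `q : S → A` be a ring homomorphism onto a mixed affinoid algebra.  A presentation of `S`
is a surjection `f : 𝐀⟨T₁, …, T_m⟩⟨⟨U₁, …, U_n⟩⟩^† → S` of `𝔬`-algebras, together with its reduction
`fbar : k⟦π⟧⟨T₁, …, T_m⟩⟦U₁, …, U_n⟧[π⁻¹] → A`, a homomorphism of `k((π))`-algebras. -/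
structure Presentation (ρ ω : Set.Ioo (0 : ℝ) 1) {S : Type v} {A : Type w} [CommRing S]
    [Algebra O S] [CommRing A] [Algebra (LaurentSeries (ResidueField O)) A] (q : S →+* A) where
  m : ℕ
  n : ℕ
  f : dagger O ρ ω m n →ₐ[O] S
  surjective : Function.Surjective f
  fbar : resRing (ResidueField O) ω m n →ₐ[LaurentSeries (ResidueField O)] A
  reduction : ∀ x, fbar (daggerReduction O ρ ω m n x) = q (f x)

/-- The ideal `𝔪 S`. -/
abbrev extMax (O : Type u) [CommRing O] [IsLocalRing O] (S : Type v) [CommRing S] [Algebra O S] :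
    Ideal S :=
  (maximalIdeal O).map (algebraMap O S)

variable (O) in
/-- The flat `𝔬`-algebra `S` is a dagger lift of `A`, where the isomorphism `S/𝔪S ≅ A` is given as a
surjection `q : S → A` with kernel `𝔪S`. -/
structure IsDaggerLift (ρ ω : Set.Ioo (0 : ℝ) 1) {S : Type v} {A : Type w} [CommRing S]
    [Algebra O S] [CommRing A] [Algebra (LaurentSeries (ResidueField O)) A] (q : S →+* A) :
    Prop where
  flat : Module.Flat O S
  surjective : Function.Surjective q
  ker_eq : RingHom.ker q = extMax O S
  exists_presentation : Nonempty (Presentation O ρ ω q)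

section WeakTopology

variable {ρ ω : Set.Ioo (0 : ℝ) 1} {S : Type v} {A : Type w} [CommRing S]
  [Algebra O S] [CommRing A] [Algebra (LaurentSeries (ResidueField O)) A] {q : S →+* A}

/-- The subring `S_r = f(𝐀⟨T⟩⟨⟨U⟩⟩^{†,r})` of `S`. -/
def Presentation.radiusRing (P : Presentation O ρ ω q) (r : Set.Ioi (0 : ℝ)) : Subalgebra O S :=
  ((daggerRadius O ρ ω P.m P.n r).comap (dagger O ρ ω P.m P.n).val).map P.f

/-- The quotient norm `|·|_r` on `S_r`. -/
def Presentation.norm (P : Presentation O ρ ω q) (r : Set.Ioi (0 : ℝ)) (x : P.radiusRing r) : ℝ :=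
  sInf {c : ℝ | ∃ F : dagger O ρ ω P.m P.n, F.1 ∈ daggerRadius O ρ ω P.m P.n r ∧
    P.f F = x ∧ gaussNorm (weight ρ ω r) F.1 = c}

/-- The inverse limit topology on `S` of the quotient topologies on the `S/𝔪^n S` which are induced
by `|·|_r` via `S_r → S/𝔪^n S`. -/
abbrev Presentation.weakTopology (P : Presentation O ρ ω q) (r : Set.Ioi (0 : ℝ)) :
    TopologicalSpace S :=
  ⨅ n : ℕ, TopologicalSpace.induced (Ideal.Quotient.mk (extMax O S ^ n))
    (TopologicalSpace.coinduced (fun x : P.radiusRing r => Ideal.Quotient.mk (extMax O S ^ n) x.1)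
      (topologyOfNorm (P.norm r)))

end WeakTopology

variable (O) in
/-- Continuity of `g : S₁ → S₂` for the weak topologies, which are the topologies
`Presentation.weakTopology` for an arbitrary presentation and all sufficiently small `r`. -/
def WeaklyContinuous (ρ ω : Set.Ioo (0 : ℝ) 1)
    {S₁ : Type*} {S₂ : Type*} {A₁ : Type*} {A₂ : Type*} [CommRing S₁] [CommRing S₂]
    [Algebra O S₁] [Algebra O S₂] [CommRing A₁] [CommRing A₂]
    [Algebra (LaurentSeries (ResidueField O)) A₁] [Algebra (LaurentSeries (ResidueField O)) A₂]
    (q₁ : S₁ →+* A₁) (q₂ : S₂ →+* A₂) (g : S₁ →+* S₂) : Prop :=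
  ∃ (P₁ : Presentation O ρ ω q₁) (P₂ : Presentation O ρ ω q₂) (r₀ : Set.Ioi (0 : ℝ)),
    ∀ r₁ ≤ r₀, ∀ r₂ ≤ r₀, @Continuous _ _ (P₁.weakTopology r₁) (P₂.weakTopology r₂) g

end DaggerLift

end Dagger

end

noncomputable section

namespace Dagger

universe u v w u' v'

/-! ### Rings of series with linear growth -/

section Series

variable {S : Type u} [CommRing S]

/-! Fix a uniformizer `t` of `𝔬` and write `e = π⁻¹`. Apart from a finiteness condition in `T`,
overconvergence is linear growth: for some `K`, the coefficients at exponents of `π` below `-Kq` lie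
in `𝔪^q` (`mem_dagger_iff`). Hence, with the noetherian ring `V = 𝔬[T]⟦π⟧⟦U⟧`, the ring `𝐀^†` is the
union over `K` of `e^K R_K`, where `R_K` is the ring of all series `∑ (t e^K)^j v_j` with `v_j ∈ V`.
`GrowthRing` isolates this structure. It passes to quotients without `t`-torsion (`GrowthRing.map`),
hence to dagger lifts, and survives the replacement of `t` by a unit multiple
(`change_uniformizer`). Since `g(t)` is a unit multiple of `t` (`exists_map_uniformizer`), both
lifts are growth rings, for `t` and for `g(t)`.

A growth ring is not `t`-adically complete, so each successive approximation modulo `t` has to keep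
its remainders in one fixed `R_K`; then the corrections again form a convergent series. The uniform
`K` comes from the noetherianity of `V` (`exists_uniform`) within one ring. This shows that a growth
ring is noetherian, with `t` in its Jacobson radical. For `g`, uniformity comes from Baire category:
`g` is bounded on `R_0` (`exists_bounded_map`), and a finite family that generates modulo `t`
satisfies an open mapping property (`exists_residueRing_le_spanMod`).

Injectivity follows by repeated division by `t`. Surjectivity and finiteness both say that a finite
family generating modulo `t` generates (`exists_sum_eq_of_mod`). Flatness follows from the
equational criterion, using Artin–Rees over the source and Nakayama over the target
(`flat_of_flat_mod`); for faithful flatness one adds that every maximal ideal of the source contains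
`t`. The statement on isomorphisms combines injectivity and surjectivity. -/

/-- `s` is the sum `∑ τ^j x_j`, up to elements divisible by all powers of `τ`. -/
def IsSeriesSum (τ : S) (x : ℕ → S) (s : S) : Prop :=
  ∀ n, τ ^ n ∣ s - ∑ j ∈ Finset.range n, τ ^ j * x j

theorem IsSeriesSum.const_mul {τ : S} {x : ℕ → S} {a : S} (ha : IsSeriesSum τ x a) (c : S) :
    IsSeriesSum τ (fun j => c * x j) (c * a) := fun n => by
  have := (ha n).mul_left c
  convert this using 1
  rw [mul_sub, Finset.mul_sum]
  congr 1
  exact Finset.sum_congr rfl fun j _ => by ring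

/-- The `n`-th quotient of `IsSeriesSum` is the remainder `y n` itself. All expansions below arise
in this way from an iterated division step. -/
theorem IsSeriesSum.of_step {τ : S} {x y : ℕ → S} (h : ∀ n, y n = x n + τ * y (n + 1)) :
    IsSeriesSum τ x (y 0) := fun n => by
  refine ⟨y n, ?_⟩
  induction n with
  | zero => simp
  | succ n ih =>
    rw [Finset.sum_range_succ, ← sub_sub, ih, h n]; ring

/-- Only this direction needs `τ` to be regular: the factor `τ` has to be cancelled from the
divisibility at level `n + 1`. -/
theorem IsSeriesSum.tail {τ : S} (hτ : ∀ x, τ * x = 0 → x = 0) {x : ℕ → S} {s : S}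
    (hs : IsSeriesSum τ x s) :
    ∃ y, s = x 0 + τ * y ∧ IsSeriesSum τ (fun j => x (j + 1)) y := by
  obtain ⟨y, hy⟩ := hs 1
  simp only [pow_one, Finset.sum_range_one, pow_zero, one_mul] at hy
  refine ⟨y, by rw [← hy]; ring, fun n => ?_⟩
  obtain ⟨z, hz⟩ := hs (n + 1)
  refine ⟨z, sub_eq_zero.1 (hτ _ ?_)⟩
  rw [Finset.sum_range_succ'] at hz
  have : τ * ∑ j ∈ Finset.range n, τ ^ j * x (j + 1) =
      ∑ j ∈ Finset.range n, τ ^ (j + 1) * x (j + 1) := by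
    rw [Finset.mul_sum]; exact Finset.sum_congr rfl fun j _ => by ring
  rw [mul_sub, mul_sub, this, ← hy, ← mul_assoc, ← pow_succ', ← hz]
  ring

/-- The series `∑ (t e^K)^j v_j` with coefficients in `V`. -/
def seriesRing (V : Subring S) (t e : S) (K : ℕ) : Subring S :=
  Subring.closure {s | ∃ v : ℕ → S, (∀ j, v j ∈ V) ∧ IsSeriesSum (t * e ^ K) v s}

/-- A `t`-adically separated ring `S` whose elements are the series `∑ t^j e^{K(j+1)} v_j` with
`v_j` in a noetherian, `π`-adically complete subring `V`, where `e` is the inverse of `π ∈ V`. -/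
structure GrowthRing (V : Subring S) (t π e : S) : Prop where
  noeth : IsNoetherianRing V
  pi_mem : π ∈ V
  pi_mul : π * e = 1
  regular : ∀ x, t * x = 0 → x = 0
  separated : ∀ x, (∀ n, t ^ n ∣ x) → x = 0
  exists_sum : ∀ (K : ℕ) (v : ℕ → S), (∀ j, v j ∈ V) → ∃ s, IsSeriesSum (t * e ^ K) v s
  exists_expansion : ∀ s, ∃ (K : ℕ) (v : ℕ → S), (∀ j, v j ∈ V) ∧
    IsSeriesSum (t * e ^ K) v (π ^ K * s)
  complete_pi : ∀ v : ℕ → S, (∀ j, v j ∈ V) → ∃ s ∈ V, ∀ n, ∃ r ∈ V,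
    s - ∑ j ∈ Finset.range n, π ^ j * v j = π ^ n * r
  isUnit_pi : ∀ v ∈ V, ∃ v' ∈ V, (1 + π * v) * v' = 1

namespace GrowthRing

variable {V : Subring S} {t π e : S} (h : GrowthRing V t π e) {K : ℕ}

include h

theorem pi_pow_mul (K : ℕ) : π ^ K * e ^ K = 1 := by rw [← mul_pow, h.pi_mul, one_pow]

theorem dvd_iff (K n : ℕ) (x : S) : (t * e ^ K) ^ n ∣ x ↔ t ^ n ∣ x := by
  have := h.pi_pow_mul (K * n)
  constructor
  · rintro ⟨y, rfl⟩
    exact ⟨e ^ (K * n) * y, by ring⟩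
  · rintro ⟨y, rfl⟩
    refine ⟨π ^ (K * n) * y, ?_⟩
    calc t ^ n * y = t ^ n * (π ^ (K * n) * e ^ (K * n)) * y := by rw [this, mul_one]
      _ = _ := by ring

theorem step_regular (K : ℕ) (x : S) (hx : t * e ^ K * x = 0) : x = 0 := by
  have h1 : e ^ K * x = 0 := h.regular _ (by rw [← hx]; ring)
  calc x = (π ^ K * e ^ K) * x := by rw [h.pi_pow_mul, one_mul]
    _ = 0 := by rw [mul_assoc, h1, mul_zero]

theorem sum_unique {x : ℕ → S} {a b : S} (ha : IsSeriesSum (t * e ^ K) x a)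
    (hb : IsSeriesSum (t * e ^ K) x b) : a = b := by
  refine sub_eq_zero.1 (h.separated _ fun n => (h.dvd_iff K n _).1 ?_)
  simpa using dvd_sub (ha n) (hb n)

omit h in
-- A set contained in `V + t e^K M` yields expansions by iterating the division: the digits are the
-- parts in `V` of the successive remainders.
theorem subset_of_step {V : Subring S} {t e : S} {K : ℕ} (M : Set S)
    (hM : ∀ x ∈ M, ∃ v ∈ V, ∃ y ∈ M, x = v + t * e ^ K * y) (x : S) (hx : x ∈ M) :
    ∃ v : ℕ → S, (∀ j, v j ∈ V) ∧ IsSeriesSum (t * e ^ K) v x := by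
  choose! f hf f' hf' hff using hM
  have hmem : ∀ n, f'^[n] x ∈ M := fun n => by
    induction n with
    | zero => exact hx
    | succ n ih => rw [Function.iterate_succ_apply']; exact hf' _ ih
  refine ⟨fun n => f (f'^[n] x), fun n => hf _ (hmem n), ?_⟩
  refine IsSeriesSum.of_step (y := fun n => f'^[n] x) fun n => ?_
  show f'^[n] x = f (f'^[n] x) + t * e ^ K * f'^[n + 1] x
  rw [Function.iterate_succ_apply']; exact hff _ (hmem n)

/-- The series are closed under multiplication because a single digit can be split off a product:
with `τ = t e^K`, the product `(a + τb)(c + τd)` is `ac` plus `τ` times an element of the generated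
ring. So every element of the closure admits the step of `subset_of_step`. -/
theorem mem_seriesRing_iff {s : S} : s ∈ seriesRing V t e K ↔
    ∃ v : ℕ → S, (∀ j, v j ∈ V) ∧ IsSeriesSum (t * e ^ K) v s := by
  refine ⟨fun hs => ?_, fun hs => Subring.subset_closure hs⟩
  have hV : V ≤ seriesRing V t e K := fun x hx => Subring.subset_closure <|
    subset_of_step (V : Set S) (fun x hx => ⟨x, hx, 0, zero_mem _, by simp⟩) x hx
  have hτ : t * e ^ K ∈ seriesRing V t e K := Subring.subset_closure <|
    subset_of_step ({t * e ^ K, 1, 0} : Set S) (by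
      rintro x (rfl | rfl | rfl)
      · exact ⟨0, zero_mem _, 1, by simp, by simp⟩
      · exact ⟨1, one_mem _, 0, by simp, by simp⟩
      · exact ⟨0, zero_mem _, 0, by simp, by simp⟩) _ (by simp)
  refine subset_of_step (seriesRing V t e K : Set S) (fun x hx => ?_) s hs
  induction hx using Subring.closure_induction with
  | mem x hx =>
    obtain ⟨v, hv, hx⟩ := hx
    obtain ⟨y, rfl, hy⟩ := hx.tail (h.step_regular K)
    exact ⟨v 0, hv 0, y, Subring.subset_closure ⟨_, fun j => hv (j + 1), hy⟩, rfl⟩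
  | zero => exact ⟨0, zero_mem _, 0, zero_mem _, by simp⟩
  | one => exact ⟨1, one_mem _, 0, zero_mem _, by simp⟩
  | add x y _ _ hx hy =>
    obtain ⟨a, ha, b, hb, rfl⟩ := hx
    obtain ⟨c, hc, d, hd, rfl⟩ := hy
    exact ⟨a + c, add_mem ha hc, b + d, add_mem hb hd, by ring⟩
  | neg x _ hx =>
    obtain ⟨a, ha, b, hb, rfl⟩ := hx
    exact ⟨-a, neg_mem ha, -b, neg_mem hb, by ring⟩
  | mul x y _ _ hx hy =>
    obtain ⟨a, ha, b, hb, rfl⟩ := hx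
    obtain ⟨c, hc, d, hd, rfl⟩ := hy
    exact ⟨a * c, mul_mem ha hc, a * d + b * c + t * e ^ K * (b * d),
      add_mem (add_mem (mul_mem (hV ha) hd) (mul_mem hb (hV hc)))
        (mul_mem hτ (mul_mem hb hd)), by ring⟩

theorem mem_seriesRing_of_step (M : Set S)
    (hM : ∀ x ∈ M, ∃ v ∈ V, ∃ y ∈ M, x = v + t * e ^ K * y) {x : S} (hx : x ∈ M) :
    x ∈ seriesRing V t e K :=
  h.mem_seriesRing_iff.2 (subset_of_step M hM x hx)

theorem le_seriesRing : V ≤ seriesRing V t e K := fun _ hx =>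
  h.mem_seriesRing_of_step (V : Set S) (fun x hx => ⟨x, hx, 0, zero_mem _, by simp⟩) hx

theorem step_mem : t * e ^ K ∈ seriesRing V t e K :=
  h.mem_seriesRing_of_step ({t * e ^ K, 1, 0} : Set S) (by
      rintro x (rfl | rfl | rfl)
      · exact ⟨0, zero_mem _, 1, by simp, by simp⟩
      · exact ⟨1, one_mem _, 0, by simp, by simp⟩
      · exact ⟨0, zero_mem _, 0, by simp, by simp⟩) (by simp)

theorem exists_step {x : S} (hx : x ∈ seriesRing V t e K) :
    ∃ v ∈ V, ∃ y ∈ seriesRing V t e K, x = v + t * e ^ K * y := by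
  obtain ⟨v, hv, hx⟩ := h.mem_seriesRing_iff.1 hx
  obtain ⟨y, rfl, hy⟩ := hx.tail (h.step_regular K)
  exact ⟨v 0, hv 0, y, h.mem_seriesRing_iff.2 ⟨_, fun j => hv (j + 1), hy⟩, rfl⟩

theorem pi_pow_mem (n : ℕ) : π ^ n ∈ seriesRing V t e K :=
  h.le_seriesRing (pow_mem h.pi_mem n)

/-- `t e^K = t e^{K'} π^{K'-K}`, and the power of `π` is absorbed in the remainder. -/
theorem seriesRing_mono {K K' : ℕ} (hK : K ≤ K') : seriesRing V t e K ≤ seriesRing V t e K' := by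
  intro x hx
  refine h.mem_seriesRing_of_step (seriesRing V t e K : Set S) (fun x hx => ?_) hx
  obtain ⟨v, hv, y, hy, rfl⟩ := h.exists_step hx
  refine ⟨v, hv, π ^ (K' - K) * y, mul_mem (h.pi_pow_mem _) hy, ?_⟩
  obtain ⟨k, rfl⟩ := Nat.exists_eq_add_of_le hK
  have := h.pi_pow_mul k
  rw [Nat.add_sub_cancel_left, pow_add]
  linear_combination (-(t * e ^ K * y)) * this

/-- Completeness of `R_K` reduces to sums with digits in `V` by carrying: the digit of the current
coefficient is kept and its tail is added to the next coefficient. -/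
theorem exists_sum_of_mem (d : ℕ → S) (hd : ∀ j, d j ∈ seriesRing V t e K) :
    ∃ s ∈ seriesRing V t e K, IsSeriesSum (t * e ^ K) d s := by
  have hstep : ∀ x ∈ seriesRing V t e K, ∃ v ∈ V, ∃ y ∈ seriesRing V t e K,
    x = v + t * e ^ K * y := fun x hx => h.exists_step hx
  choose! f hf f' hf' hff using hstep
  let c : ℕ → S := fun n => Nat.rec (d 0) (fun n c => d (n + 1) + f' c) n
  have hc1 : ∀ n, c (n + 1) = d (n + 1) + f' (c n) := fun n => rfl
  have hc : ∀ n, c n ∈ seriesRing V t e K := fun n => by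
    induction n with
    | zero => exact hd 0
    | succ n ih => rw [hc1]; exact add_mem (hd _) (hf' _ ih)
  obtain ⟨s, hs⟩ := h.exists_sum K (fun n => f (c n)) (fun n => hf _ (hc n))
  refine ⟨s, h.mem_seriesRing_iff.2 ⟨_, fun n => hf _ (hc n), hs⟩, fun n => ?_⟩
  have key : ∀ n, ∑ j ∈ Finset.range (n + 1), (t * e ^ K) ^ j * d j =
      ∑ j ∈ Finset.range (n + 1), (t * e ^ K) ^ j * f (c j) + (t * e ^ K) ^ (n + 1) * f' (c n) := by
    intro n
    induction n with
    | zero =>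
      have := hff _ (hd 0)
      simp only [zero_add, Finset.sum_range_one, pow_zero, one_mul, pow_one]
      exact this
    | succ n ih =>
      rw [Finset.sum_range_succ, ih, Finset.sum_range_succ _ (n + 1)]
      have := hff _ (hc (n + 1))
      have h2 := hc1 n
      linear_combination (t * e ^ K) ^ (n + 1) * this - (t * e ^ K) ^ (n + 1) * h2
  cases n with
  | zero => simp
  | succ n =>
    rw [key, ← sub_sub]
    exact dvd_sub (hs _) (dvd_mul_right _ _)

theorem mem_of_isSeriesSum {d : ℕ → S} (hd : ∀ j, d j ∈ seriesRing V t e K) {s : S}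
    (hs : IsSeriesSum (t * e ^ K) d s) : s ∈ seriesRing V t e K := by
  obtain ⟨s', hs', hs''⟩ := h.exists_sum_of_mem d hd
  rwa [h.sum_unique hs hs'']

/-- Stronger than divisibility in `S`: the quotient stays in `R_K`, which makes the filtration by
the `(t e^K)^n R_K` complete. -/
theorem exists_remainder {d : ℕ → S} (hd : ∀ j, d j ∈ seriesRing V t e K) {s : S}
    (hs : IsSeriesSum (t * e ^ K) d s) (n : ℕ) :
    ∃ r ∈ seriesRing V t e K,
      s - ∑ j ∈ Finset.range n, (t * e ^ K) ^ j * d j = (t * e ^ K) ^ n * r := by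
  induction n generalizing d s with
  | zero => exact ⟨s, h.mem_of_isSeriesSum hd hs, by simp⟩
  | succ n ih =>
    obtain ⟨y, rfl, hy⟩ := hs.tail (h.step_regular K)
    obtain ⟨r, hr, hr'⟩ := ih (fun j => hd (j + 1)) hy
    refine ⟨r, hr, ?_⟩
    rw [Finset.sum_range_succ', Finset.sum_congr rfl fun j _ =>
      show (t * e ^ K) ^ (j + 1) * d (j + 1) = t * e ^ K * ((t * e ^ K) ^ j * d (j + 1)) by ring,
      ← Finset.mul_sum]
    linear_combination (t * e ^ K) * hr'

/-! Bounded elements. -/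

theorem bounded_mono {K K' : ℕ} (hK : K ≤ K') {s : S} (hs : π ^ K * s ∈ seriesRing V t e K) :
    π ^ K' * s ∈ seriesRing V t e K' := by
  obtain ⟨k, rfl⟩ := Nat.exists_eq_add_of_le hK
  rw [pow_add, mul_comm (π ^ K), mul_assoc]
  exact mul_mem (h.pi_pow_mem k) (h.seriesRing_mono hK hs)

theorem exists_bounded (s : S) : ∃ K, π ^ K * s ∈ seriesRing V t e K := by
  obtain ⟨K, v, hv, hs⟩ := h.exists_expansion s
  exact ⟨K, h.mem_seriesRing_iff.2 ⟨v, hv, hs⟩⟩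

theorem exists_bounded_family {ι : Type*} [Fintype ι] (s : ι → S) :
    ∃ K, ∀ i, π ^ K * s i ∈ seriesRing V t e K := by
  choose K hK using fun i => h.exists_bounded (s i)
  exact ⟨Finset.univ.sup K, fun i => h.bounded_mono (Finset.le_sup (Finset.mem_univ i)) (hK i)⟩

theorem bounded_mul {K K' : ℕ} {s s' : S} (hs : π ^ K * s ∈ seriesRing V t e K)
    (hs' : π ^ K' * s' ∈ seriesRing V t e K') :
    π ^ (K + K') * (s * s') ∈ seriesRing V t e (K + K') := by
  rw [pow_add, mul_mul_mul_comm]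
  exact mul_mem (h.seriesRing_mono (Nat.le_add_right _ _) hs)
    (h.seriesRing_mono (Nat.le_add_left _ _) hs')

/-- Elements of `S` are congruent to elements of `V[π⁻¹]` modulo `t`. -/
theorem exists_reduction (s : S) : ∃ (K : ℕ), ∃ v ∈ V, t ∣ s - e ^ K * v := by
  obtain ⟨K, hK⟩ := h.exists_bounded s
  obtain ⟨v, hv, y, hy, hs⟩ := h.exists_step hK
  refine ⟨K, v, hv, e ^ (2 * K) * y, ?_⟩
  have := h.pi_pow_mul K
  linear_combination e ^ K * hs - s * this

end GrowthRing
end Series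

section Series
variable {S : Type u} [CommRing S]
namespace GrowthRing
variable {V : Subring S} {t π e : S} (h : GrowthRing V t π e) {K : ℕ}
include h

/-! Finite generation. -/

/-- An ideal `L` of `V` all of whose elements have the form `a + t z` with `a` in an ideal `I` of
`S` is finitely generated; this bounds `a` and `z`. -/
theorem exists_uniform (I : Ideal S) :
    ∃ (s K : ℕ) (f : Fin s → S), (∀ i, f i ∈ I) ∧ ∀ l ∈ V, (∃ a ∈ I, t ∣ l - a) →
      ∃ c : Fin s → S, (∀ i, c i ∈ V) ∧ ∃ z, π ^ K * z ∈ seriesRing V t e K ∧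
        l = ∑ i, c i * f i + t * z := by
  have := h.noeth
  let L : Ideal V := (I ⊔ Ideal.span {t}).comap V.subtype
  obtain ⟨s, l, hl⟩ := Submodule.fg_iff_exists_fin_generating_family.1
    (IsNoetherian.noetherian L)
  have hmem : ∀ i, ∃ f ∈ I, ∃ z, (l i : S) = f + t * z := fun i => by
    have : l i ∈ L := hl ▸ Submodule.subset_span ⟨i, rfl⟩
    obtain ⟨f, hf, y, hy, hfy⟩ := Submodule.mem_sup.1 (Ideal.mem_comap.1 this)
    obtain ⟨z, rfl⟩ := Ideal.mem_span_singleton'.1 hy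
    exact ⟨f, hf, z, by rw [mul_comm t]; exact hfy.symm⟩
  choose f hf z hz using hmem
  -- Finitely many generators of the ideal of `V` have a common bound, which then serves for all its
  -- elements.
  obtain ⟨K, hK⟩ := h.exists_bounded_family z
  refine ⟨s, K, f, hf, fun x hx ⟨a, ha, b, hb⟩ => ?_⟩
  have hxL : (⟨x, hx⟩ : V) ∈ L := by
    refine Submodule.mem_sup.2 ⟨a, ha, t * b, Ideal.mem_span_singleton.2 ⟨b, rfl⟩, ?_⟩
    show a + t * b = x
    rw [← hb]; ring
  rw [← hl] at hxL
  obtain ⟨c, hc⟩ := (Submodule.mem_span_range_iff_exists_fun V).1 hxL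
  refine ⟨fun i => c i, fun i => (c i).2, ∑ i, (c i : S) * z i, ?_, ?_⟩
  · rw [Finset.mul_sum]
    refine sum_mem fun i _ => ?_
    rw [mul_left_comm]
    exact mul_mem (h.le_seriesRing (c i).2) (hK i)
  · have hx' : x = ∑ i, (c i : S) * (l i : S) := by
      have := congrArg (Subtype.val : V → S) hc
      simpa using this.symm
    rw [hx', Finset.mul_sum, ← Finset.sum_add_distrib]
    exact Finset.sum_congr rfl fun i _ => by rw [hz]; ring

/-- Divide an element of `J` repeatedly by generators taken from `I`. Saturation keeps the
remainders in `J`, and the uniform bound keeps them in one `R_K`, so the coefficients sum to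
elements of `S`. The conclusion forces `J = I`: taking `I = J` gives finite generation, and taking
for `J` the `t`-adic closure of `I` shows that `I` is closed. -/
theorem exists_generators_of_saturated (I J : Ideal S) (hIJ : I ≤ J)
    (hsat : ∀ x, t * x ∈ J → x ∈ J) (hJ : ∀ x ∈ J, ∃ a ∈ I, t ∣ x - a) :
    ∃ (s : ℕ) (f : Fin s → S), (∀ i, f i ∈ I) ∧ J = Ideal.span (Set.range f) := by
  obtain ⟨s, K₀, f, hf, hL⟩ := h.exists_uniform I
  refine ⟨s, f, hf, le_antisymm (fun x hx => ?_)
    (Ideal.span_le.2 (Set.range_subset_iff.2 fun i => hIJ (hf i)))⟩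
  obtain ⟨K₁, hK₁⟩ := h.exists_bounded x
  obtain ⟨K, hK, hK'⟩ : ∃ K, K₀ ≤ K ∧ K₁ ≤ K := ⟨max K₀ K₁, le_max_left _ _, le_max_right _ _⟩
  have hstep : ∀ y, y ∈ seriesRing V t e K ∧ y ∈ J → ∃ c : Fin s → S, (∀ i, c i ∈ V) ∧
      ∃ y', (y' ∈ seriesRing V t e K ∧ y' ∈ J) ∧
        y = ∑ i, c i * f i + t * e ^ K * y' := by
    rintro y ⟨hy, hyJ⟩
    obtain ⟨l, hl, d, hd, rfl⟩ := h.exists_step hy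
    obtain ⟨a, ha, b, hb⟩ := hJ _ hyJ
    obtain ⟨c, hc, z, hz, rfl⟩ := hL l hl
      ⟨a, ha, b - e ^ K * d, by linear_combination hb⟩
    -- The remainder `t z + t e^K d` equals `t e^K (π^K z + d)`, and `K ≥ K₀` ensures that `π^K z`
    -- lies in `R_K`.
    refine ⟨c, hc, π ^ K * z + d, ⟨add_mem (h.bounded_mono hK hz) hd, hsat _ ?_⟩, ?_⟩
    · have h1 : t * e ^ K * (π ^ K * z + d) ∈ J := by
        have h2 : ∑ i, c i * f i ∈ J := sum_mem fun i _ => J.mul_mem_left _ (hIJ (hf i))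
        have h3 := J.sub_mem hyJ h2
        convert h3 using 1
        linear_combination t * z * h.pi_pow_mul K
      have h4 := J.mul_mem_left (π ^ K) h1
      convert h4 using 1
      linear_combination (-t * (π ^ K * z + d)) * h.pi_pow_mul K
    · linear_combination (-t * z) * h.pi_pow_mul K
  choose! c hc f' hf' hcf using hstep
  have hx0 : π ^ K * x ∈ seriesRing V t e K ∧ π ^ K * x ∈ J :=
    ⟨h.bounded_mono hK' hK₁, J.mul_mem_left _ hx⟩
  let y : ℕ → S := fun n => f'^[n] (π ^ K * x)
  have hy : ∀ n, y n ∈ seriesRing V t e K ∧ y n ∈ J := fun n => by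
    induction n with
    | zero => exact hx0
    | succ n ih => simp only [y, Function.iterate_succ_apply']; exact hf' _ ih
  have hyy : IsSeriesSum (t * e ^ K) (fun n => ∑ i, c (y n) i * f i) (π ^ K * x) :=
    IsSeriesSum.of_step (y := y) fun n => by
      have := hcf _ (hy n)
      simp only [y, Function.iterate_succ_apply'] at this ⊢
      exact this
  choose σ hσ using fun i => h.exists_sum K (fun n => c (y n) i) (fun n => hc _ (hy n) i)
  have hsum : IsSeriesSum (t * e ^ K) (fun n => ∑ i, c (y n) i * f i) (∑ i, σ i * f i) := by
    intro n
    have : ∑ i, σ i * f i - ∑ j ∈ Finset.range n, (t * e ^ K) ^ j * ∑ i, c (y j) i * f i =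
        ∑ i, (σ i - ∑ j ∈ Finset.range n, (t * e ^ K) ^ j * c (y j) i) * f i := by
      simp only [Finset.mul_sum, sub_mul, Finset.sum_sub_distrib, Finset.sum_mul, mul_assoc]
      rw [Finset.sum_comm]
    rw [this]
    exact Finset.dvd_sum fun i _ => (hσ i n).mul_right _
  have hxs : x = e ^ K * ∑ i, σ i * f i := by
    rw [← h.sum_unique hyy hsum]
    linear_combination (-x) * h.pi_pow_mul K
  rw [hxs]
  exact Ideal.mul_mem_left _ _ (sum_mem fun i _ =>
    Ideal.mul_mem_left _ _ (Ideal.subset_span ⟨i, rfl⟩))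

theorem fg_of_saturated (J : Ideal S) (hsat : ∀ x, t * x ∈ J → x ∈ J) : J.FG := by
  obtain ⟨s, f, -, hJ⟩ := h.exists_generators_of_saturated J J le_rfl hsat
    fun x hx => ⟨x, hx, by simp⟩
  exact hJ ▸ Submodule.fg_span (Set.finite_range f)

/-- By Cohen's theorem it suffices to treat primes. A prime without `t` is saturated; a prime
containing `t` is generated by `t` and its trace on `V`, because modulo `t` the ring is a quotient
of `V[π⁻¹]`. -/
theorem isNoetherianRing : IsNoetherianRing S := by
  refine IsNoetherianRing.of_prime fun P hP => ?_
  by_cases ht : t ∈ P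
  · have := h.noeth
    obtain ⟨G, hG⟩ := IsNoetherian.noetherian (P.comap V.subtype)
    have hle : Ideal.span (V.subtype '' (G : Set V)) ≤ P := by
      rw [Ideal.span_le, Set.image_subset_iff]
      exact fun x hx => (hG ▸ Submodule.subset_span hx : x ∈ P.comap V.subtype)
    have : P = Ideal.span (V.subtype '' (G : Set V)) ⊔ Ideal.span {t} := by
      refine le_antisymm (fun x hx => ?_) (sup_le hle (by simpa [Ideal.span_le] using ht))
      obtain ⟨K, v, hv, y, hy⟩ := h.exists_reduction x
      have hvP : (⟨v, hv⟩ : V) ∈ P.comap V.subtype := by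
        show v ∈ P
        have h1 : π ^ K * x - π ^ K * t * y ∈ P :=
          P.sub_mem (P.mul_mem_left _ hx) (P.mul_mem_right _ (P.mul_mem_left _ ht))
        convert h1 using 1
        linear_combination v * h.pi_pow_mul K * (-1) - π ^ K * hy
      rw [← hG] at hvP
      have hv2 : v ∈ Ideal.span (V.subtype '' (G : Set V)) := by
        rw [← Ideal.map_span]
        exact Ideal.mem_map_of_mem V.subtype hvP
      rw [sub_eq_iff_eq_add'.1 hy]
      exact Submodule.add_mem_sup (Ideal.mul_mem_left _ _ hv2)
        (Ideal.mul_mem_right _ _ (Ideal.mem_span_singleton_self t))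
    rw [this]
    exact Submodule.FG.sup (Submodule.fg_span (G.finite_toSet.image _))
      (Submodule.fg_span_singleton t)
  · exact h.fg_of_saturated P fun x hx => (hP.mem_or_mem hx).resolve_left ht

/-! ### The Jacobson radical, and division by `t` -/

theorem isUnit_one_add (z : S) : IsUnit (1 + t * z) := by
  obtain ⟨K, hK⟩ := h.exists_bounded z
  -- The geometric series for `1 + t z`, with `t z = t e^K · π^K z` and the powers of `π^K z` as
  -- coefficients in `R_K`.
  obtain ⟨s, -, hs⟩ := h.exists_sum_of_mem (K := K) (fun n => (-(π ^ K * z)) ^ n)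
    fun n => pow_mem (neg_mem hK) n
  refine IsUnit.of_mul_eq_one s (sub_eq_zero.1 (h.separated _ fun n => ?_))
  rw [← h.dvd_iff K]
  obtain ⟨y, hy⟩ := hs n
  have htz : t * z = -(t * e ^ K * (-(π ^ K * z))) := by
    linear_combination (-t * z) * h.pi_pow_mul K
  have hgeom := mul_neg_geom_sum (t * e ^ K * (-(π ^ K * z))) n
  simp only [mul_pow _ (-(π ^ K * z))] at hgeom
  rw [sub_eq_iff_eq_add.1 hy]
  refine ⟨(1 + t * z) * y - (-(π ^ K * z)) ^ n, ?_⟩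
  rw [htz]
  linear_combination hgeom

theorem mem_jacobson : t ∈ Ideal.jacobson (⊥ : Ideal S) := by
  rw [Ideal.mem_jacobson_bot]
  intro y
  rw [add_comm]; exact h.isUnit_one_add y

/-- Division by `t` preserves boundedness. -/
theorem exists_bounded_of_mul : ∃ K₀, ∀ K, K₀ ≤ K → ∀ s, t * s ∈ seriesRing V t e K →
    π ^ K * s ∈ seriesRing V t e K := by
  -- With the zero ideal this says that elements of `V` divisible by `t` have uniformly bounded
  -- quotients.
  obtain ⟨n, K₀, f, hf, hL⟩ := h.exists_uniform ⊥
  refine ⟨K₀, fun K hK s hs => ?_⟩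
  obtain ⟨v, hv, d, hd, hvd⟩ := h.exists_step hs
  obtain ⟨c, hc, z, hz, hcz⟩ := hL v hv ⟨0, by simp, s - e ^ K * d, by linear_combination -hvd⟩
  have hf0 : ∑ i, c i * f i = 0 := Finset.sum_eq_zero fun i _ => by
    rw [Ideal.mem_bot.1 (hf i), mul_zero]
  have : s = z + e ^ K * d := sub_eq_zero.1 (h.regular _ (by
    linear_combination hvd + hcz + hf0))
  have h2 : π ^ K * s = π ^ K * z + d := by
    rw [this]; linear_combination d * h.pi_pow_mul K
  rw [h2]
  exact add_mem (h.bounded_mono hK hz) hd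

theorem exists_bounded_of_pow_mul (N K : ℕ) : ∃ K', ∀ s, t ^ N * s ∈ seriesRing V t e K →
    π ^ K' * s ∈ seriesRing V t e K' := by
  obtain ⟨K₀, hK₀⟩ := h.exists_bounded_of_mul
  induction N generalizing K with
  | zero => exact ⟨K, fun s hs => mul_mem (h.pi_pow_mem K) (by simpa using hs)⟩
  | succ N ih =>
    obtain ⟨K', hK'⟩ := ih (max K₀ K)
    refine ⟨K' + max K₀ K, fun s hs => ?_⟩
    have h1 := hK₀ (max K₀ K) (le_max_left _ _) (t ^ N * s)
      (h.seriesRing_mono (le_max_right _ _) (by rw [← mul_assoc, ← pow_succ']; exact hs))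
    have h2 := hK' (π ^ (max K₀ K) * s) (by rw [mul_left_comm]; exact h1)
    rw [pow_add, mul_assoc]
    exact h.seriesRing_mono (Nat.le_add_right _ _) h2

end GrowthRing

theorem IsSeriesSum.map {T : Type v} [CommRing T] (f : S →+* T) {τ : S} {x : ℕ → S} {s : S}
    (hs : IsSeriesSum τ x s) : IsSeriesSum (f τ) (fun j => f (x j)) (f s) := fun n => by
  simpa using map_dvd f (hs n)

/-! ### Quotients and change of the uniformizer -/

namespace GrowthRing
variable {V : Subring S} {t π e : S} 

/-- Only separatedness is not formal. The closure `J` of the kernel is saturated because `f t` is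
regular, so `exists_generators_of_saturated` produces generators of `J` inside the kernel. -/
theorem map (h : GrowthRing V t π e) {T : Type v} [CommRing T] (f : S →+* T)
    (hf : Function.Surjective f) (hreg : ∀ x, f t * x = 0 → x = 0) :
    GrowthRing (V.map f) (f t) (f π) (f e) where
  noeth := by
    have := h.noeth
    refine isNoetherianRing_of_surjective V (V.map f)
      ((f.comp V.subtype).codRestrict (V.map f) fun x => ⟨x, x.2, rfl⟩) ?_
    rintro ⟨_, x, hx, rfl⟩
    exact ⟨⟨x, hx⟩, rfl⟩
  pi_mem := ⟨π, h.pi_mem, rfl⟩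
  pi_mul := by rw [← map_mul, h.pi_mul, map_one]
  regular := hreg
  separated x hx := by
    obtain ⟨x, rfl⟩ := hf x
    let J : Ideal S := ⨅ n, (Ideal.span {f t ^ n}).comap f
    have hJ : ∀ y, y ∈ J ↔ ∀ n, f t ^ n ∣ f y := fun y => by
      simp only [J, Ideal.mem_iInf, Ideal.mem_comap, Ideal.mem_span_singleton]
    obtain ⟨s, g, hg, hJg⟩ := h.exists_generators_of_saturated (RingHom.ker f) J
      (fun y hy => (hJ y).2 fun n => by rw [(RingHom.mem_ker).1 hy]; exact dvd_zero _)
      (fun y hy => (hJ y).2 fun n => by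
        obtain ⟨z, hz⟩ := (hJ _).1 hy (n + 1)
        refine ⟨z, sub_eq_zero.1 (hreg _ ?_)⟩
        rw [map_mul] at hz
        linear_combination hz)
      (fun y hy => by
        obtain ⟨z, hz⟩ := (hJ _).1 hy 1
        obtain ⟨z, rfl⟩ := hf z
        refine ⟨y - t * z, ?_, z, by ring⟩
        rw [RingHom.mem_ker, map_sub, map_mul, hz]; ring)
    have hxJ : x ∈ J := (hJ x).2 hx
    have : J ≤ RingHom.ker f := by
      rw [hJg, Ideal.span_le]; rintro _ ⟨i, rfl⟩; exact hg i
    exact this hxJ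
  exists_sum K v hv := by
    choose! w hw hwv using hv
    obtain ⟨s, hs⟩ := h.exists_sum K w hw
    exact ⟨f s, by simpa [hwv] using hs.map f⟩
  exists_expansion s := by
    obtain ⟨s, rfl⟩ := hf s
    obtain ⟨K, v, hv, hs⟩ := h.exists_expansion s
    exact ⟨K, fun j => f (v j), fun j => ⟨_, hv j, rfl⟩, by simpa using hs.map f⟩
  complete_pi v hv := by
    choose! w hw hwv using hv
    obtain ⟨s, hs, hr⟩ := h.complete_pi w hw
    refine ⟨f s, ⟨s, hs, rfl⟩, fun n => ?_⟩
    obtain ⟨r, hr, hrr⟩ := hr n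
    exact ⟨f r, ⟨r, hr, rfl⟩, by simpa [hwv] using congrArg f hrr⟩
  isUnit_pi := by
    rintro _ ⟨v, hv, rfl⟩
    obtain ⟨v', hv', hvv⟩ := h.isUnit_pi v hv
    exact ⟨f v', ⟨v', hv', rfl⟩, by simpa using congrArg f hvv⟩

/-- The units `u` and `u'` are bounded, so the powers of `u` and `u'` cost only a linear amount of
`e`, which is paid for by enlarging `K`. -/
theorem change_uniformizer (h : GrowthRing V t π e) (u u' : S) (hu : u * u' = 1) :
    GrowthRing V (t * u) π e where
  noeth := h.noeth
  pi_mem := h.pi_mem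
  pi_mul := h.pi_mul
  complete_pi := h.complete_pi
  isUnit_pi := h.isUnit_pi
  regular x hx := h.regular x (by linear_combination u' * hx - t * x * hu)
  separated x hx := h.separated x fun n => (dvd_trans (by rw [mul_pow]; exact dvd_mul_right _ _)
    (hx n))
  exists_sum K v hv := by
    obtain ⟨K₀, hK₀⟩ := h.exists_bounded u
    obtain ⟨s, -, hs⟩ := h.exists_sum_of_mem (K := K + K₀) (fun j => (π ^ K₀ * u) ^ j * v j)
      fun j => mul_mem (pow_mem (h.seriesRing_mono (Nat.le_add_left _ _) hK₀) j)
        (h.le_seriesRing (hv j))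
    refine ⟨s, fun n => ?_⟩
    have key : t * u * e ^ K = t * e ^ (K + K₀) * (π ^ K₀ * u) := by
      rw [pow_add]; linear_combination (-t * u * e ^ K) * h.pi_pow_mul K₀
    have hpow : (t * u * e ^ K) ^ n = (t * e ^ (K + K₀)) ^ n * (π ^ K₀ * u) ^ n := by
      rw [key, mul_pow]
    have h1 : (t * u * e ^ K) ^ n ∣ (t * e ^ (K + K₀)) ^ n := by
      refine ⟨(e ^ K₀ * u') ^ n, ?_⟩
      rw [← mul_pow, pow_add]
      congr 1
      linear_combination (-t * e ^ K * e ^ K₀) * hu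
    refine h1.trans ?_
    convert hs n using 3 with j
    rw [key]; ring
  exists_expansion s := by
    obtain ⟨K, hK⟩ := h.exists_bounded s
    obtain ⟨K₀, hK₀⟩ := h.exists_bounded u'
    have hK' := h.bounded_mono (Nat.le_add_right K K₀) hK
    -- Here `t e^{K+K₀} y = (t u) e^{K+2K₀} (π^{K₀} u' y)`; hence the second summand `K₀`.
    obtain ⟨v, hv, hs⟩ := subset_of_step (V := V) (t := t * u) (e := e) (K := K + K₀ + K₀)
      (seriesRing V t e (K + K₀) : Set S) (fun x hx => by
        obtain ⟨v, hv, y, hy, rfl⟩ := h.exists_step hx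
        refine ⟨v, hv, π ^ K₀ * u' * y,
          mul_mem (h.seriesRing_mono (Nat.le_add_left _ _) hK₀) hy, ?_⟩
        rw [pow_add _ (K + K₀)]
        linear_combination (-t * e ^ (K + K₀) * y) * hu -
          (t * e ^ (K + K₀) * y * u * u') * h.pi_pow_mul K₀)
      (π ^ (K + K₀ + K₀) * s)
      (by rw [pow_add, mul_comm (π ^ (K + K₀)), mul_assoc]; exact mul_mem (h.pi_pow_mem _) hK')
    exact ⟨K + K₀ + K₀, v, hv, hs⟩

end GrowthRing
end Series

/-! ### A category argument -/

/-- Baire's theorem for a group that is complete for a filtration by subgroups: if countably many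
subgroups cover `F 0`, the closure of one of them contains some `F N`. Otherwise one builds a Cauchy
sequence whose limit lies in no `E k`. -/
theorem exists_le_sup_of_cover {G : Type u} [AddCommGroup G] (F E : ℕ → AddSubgroup G)
    (hF : Antitone F)
    (hcomplete : ∀ y : ℕ → G, (∀ k, y (k + 1) - y k ∈ F k) → ∃ z, ∀ k, z - y k ∈ F k)
    (hcover : ∀ x ∈ F 0, ∃ K, x ∈ E K) : ∃ K N, ∀ M, F N ≤ E K ⊔ F M := by
  classical
  by_contra hcon
  push Not at hcon
  have hcon' : ∀ K N, ∃ M, ∃ x ∈ F N, x ∉ E K ⊔ F M := fun K N => by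
    obtain ⟨M, hM⟩ := hcon K N
    exact ⟨M, SetLike.not_le_iff_exists.1 hM⟩
  choose M x hx hxM using hcon'
  -- The state is a level and an approximation. If the approximation lies in `E k` modulo the next
  -- level, it is moved by an element of the current level that does not; in either case the new
  -- approximation avoids `E k`, and later changes are too small to undo this.
  let next : ℕ → ℕ × G → ℕ × G := fun k s =>
    (max (M k s.1) (s.1 + 1),
      if s.2 ∈ E k ⊔ F (max (M k s.1) (s.1 + 1)) then s.2 + x k s.1 else s.2)
  let st : ℕ → ℕ × G := fun k => Nat.rec (0, 0) next k
  have hst : ∀ k, st (k + 1) = next k (st k) := fun k => rfl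
  have hlt : ∀ k, (st k).1 < (st (k + 1)).1 := fun k => by
    rw [hst]; exact lt_of_lt_of_le (Nat.lt_succ_self _) (le_max_right _ _)
  have hmono : StrictMono fun k => (st k).1 := strictMono_nat_of_lt_succ hlt
  have hdiff : ∀ k, (st (k + 1)).2 - (st k).2 ∈ F (st k).1 := fun k => by
    rw [hst]
    simp only [next]
    split_ifs
    · simpa using hx _ _
    · simp
  have hnot : ∀ k, (st (k + 1)).2 ∉ E k ⊔ F (st (k + 1)).1 := fun k => by
    rw [hst]
    simp only [next]
    split_ifs with hin
    · intro hin2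
      have := sub_mem hin2 hin
      rw [add_sub_cancel_left] at this
      exact hxM k (st k).1 (sup_le_sup_left (hF (le_max_left _ _)) _ this)
    · exact hin
  have htail : ∀ k l, (st (k + l)).2 - (st k).2 ∈ F (st k).1 := fun k l => by
    induction l with
    | zero => simp
    | succ l ih =>
      have := add_mem (hF (hmono.monotone (Nat.le_add_right k l)) (hdiff (k + l))) ih
      rwa [sub_add_sub_cancel] at this
  obtain ⟨z, hz⟩ := hcomplete (fun k => (st k).2) fun k => hF (hmono.le_apply) (hdiff k)
  have hz' : ∀ k, z - (st k).2 ∈ F (st k).1 := fun k => by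
    obtain ⟨l, hl⟩ := Nat.exists_eq_add_of_le (hmono.le_apply (x := k))
    have h1 := hz (st k).1
    have h2 := htail k l
    rw [← hl] at h2
    have := add_mem h1 h2
    rwa [sub_add_sub_cancel] at this
  obtain ⟨k, hk⟩ := hcover z (by simpa [st] using hz' 0)
  refine hnot k ?_
  have h3 : (st (k + 1)).2 = z - (z - (st (k + 1)).2) := by abel
  rw [h3]
  exact sub_mem (AddSubgroup.mem_sup_left hk) (AddSubgroup.mem_sup_right (hz' (k + 1)))

/-! ### Homomorphisms between rings of series with linear growth -/

section Hom

variable {S : Type u} [CommRing S] {V : Subring S} {t π e : S}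

namespace GrowthRing

variable (h : GrowthRing V t π e) {K : ℕ}

theorem pow_mul_pi_pow (h : GrowthRing V t π e) (K : ℕ) : e ^ K * π ^ K = 1 := by
  rw [mul_comm, h.pi_pow_mul]

/-- Any homomorphism is bounded on the closure of `V` for the `t`-adic topology. -/
theorem exists_bounded_map (h : GrowthRing V t π e) {S' : Type v} [CommRing S']
    {V' : Subring S'} {π' e' : S'} (g : S →+* S') (h' : GrowthRing V' (g t) π' e') :
    ∃ C, ∀ x ∈ seriesRing V t e 0, π' ^ C * g x ∈ seriesRing V' (g t) e' C := by
  let F : ℕ → AddSubgroup S := fun n =>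
    (seriesRing V t e 0).toAddSubgroup.map (AddMonoidHom.mulLeft ((t * e ^ 0) ^ n))
  let E : ℕ → AddSubgroup S := fun K =>
    (seriesRing V' (g t) e' K).toAddSubgroup.comap
      ((AddMonoidHom.mulLeft (π' ^ K)).comp g.toAddMonoidHom)
  have hF : ∀ n x, x ∈ F n ↔ ∃ w ∈ seriesRing V t e 0, (t * e ^ 0) ^ n * w = x :=
    fun n x => Iff.rfl
  have hE : ∀ K x, x ∈ E K ↔ π' ^ K * g x ∈ seriesRing V' (g t) e' K := fun n x => Iff.rfl
  -- The filtration is by `t^n R_0`, and `E K` consists of the elements whose image has bound `K`;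
  -- these cover because every single image is bounded.
  obtain ⟨K, N, hKN⟩ := exists_le_sup_of_cover F E
    (fun m n hmn x hx => by
      obtain ⟨w, hw, rfl⟩ := (hF _ _).1 hx
      obtain ⟨k, rfl⟩ := Nat.exists_eq_add_of_le hmn
      exact (hF _ _).2 ⟨(t * e ^ 0) ^ k * w, mul_mem (pow_mem h.step_mem k) hw, by ring⟩)
    (fun y hy => by
      choose w hw hwy using fun k => (hF _ _).1 (hy k)
      obtain ⟨s, -, hs⟩ := h.exists_sum_of_mem w hw
      refine ⟨y 0 + s, fun k => (hF _ _).2 ?_⟩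
      obtain ⟨r, hr, hrr⟩ := h.exists_remainder hw hs k
      refine ⟨r, hr, ?_⟩
      rw [← hrr, Finset.sum_congr rfl fun j _ => hwy j, Finset.sum_range_sub]
      ring)
    (fun x _ => by
      obtain ⟨K, hK⟩ := h'.exists_bounded (g x)
      exact ⟨K, hK⟩)
  -- Taking `M = N + 1` gives a division step on `t^N R_0`. Iterated, it writes `t^N x` as a
  -- `t`-adic series whose coefficients all have the same bound; finally `t^N` is divided out in the
  -- target.
  have hstep : ∀ x ∈ seriesRing V t e 0, ∃ a ∈ E K, ∃ y ∈ seriesRing V t e 0,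
      (t * e ^ 0) ^ N * x = a + t * e ^ 0 * ((t * e ^ 0) ^ N * y) := fun x hx => by
    have hx' := hKN (N + 1) ((hF N _).2 ⟨x, hx, rfl⟩)
    obtain ⟨a, ha, b, hb, hab⟩ := AddSubgroup.mem_sup.1 hx'
    obtain ⟨y, hy, rfl⟩ := (hF _ _).1 hb
    exact ⟨a, ha, y, hy, by rw [← hab]; ring⟩
  choose! a ha f hf haf using hstep
  obtain ⟨K', hK'⟩ := h'.exists_bounded_of_pow_mul N K
  refine ⟨K + K', fun x hx => ?_⟩
  have hy : ∀ n, f^[n] x ∈ seriesRing V t e 0 := fun n => by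
    induction n with
    | zero => exact hx
    | succ n ih => rw [Function.iterate_succ_apply']; exact hf _ ih
  have h1 : IsSeriesSum (t * e ^ 0) (fun n => a (f^[n] x)) ((t * e ^ 0) ^ N * x) :=
    IsSeriesSum.of_step (y := fun n => (t * e ^ 0) ^ N * f^[n] x) fun n => by
      have := haf _ (hy n)
      simp only [Function.iterate_succ_apply'] at this ⊢
      exact this
  have h2 := (h1.map g).const_mul (π' ^ K)
  rw [pow_zero, mul_one] at h2
  have h3 : π' ^ K * g (t ^ N * x) ∈ seriesRing V' (g t) e' K := by
    -- A power series in `g t` is a series in `g t · e'^K` with the factors `π'^{Kj}` moved into the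
    -- coefficients.
    refine h'.mem_of_isSeriesSum (d := fun j => π' ^ (K * j) * (π' ^ K * g (a (f^[j] x))))
      (fun j => mul_mem (h'.pi_pow_mem _) ((hE _ _).1 (ha _ (hy j)))) fun n => ?_
    rw [h'.dvd_iff]
    convert h2 n using 3 with j
    linear_combination (g t ^ j * (π' ^ K * g (a (f^[j] x)))) * h'.pi_pow_mul (K * j)
  have h4 := hK' (π' ^ K * g x) (by
    rw [map_mul, map_pow] at h3
    rwa [mul_left_comm])
  rw [pow_add, mul_comm (π' ^ K), mul_assoc]
  exact h'.seriesRing_mono (Nat.le_add_left _ _) h4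

/-! ### Reduction modulo `t` -/

/-- The elements that are congruent modulo `t` to an element of `V`. -/
def residueRing (V : Subring S) (t : S) : Subring S :=
  (V.map (Ideal.Quotient.mk (Ideal.span {t}))).comap (Ideal.Quotient.mk (Ideal.span {t}))

theorem mem_residueRing {x : S} : x ∈ residueRing V t ↔ ∃ v ∈ V, t ∣ x - v := by
  constructor
  · rintro ⟨v, hv, hvx⟩
    refine ⟨v, hv, Ideal.mem_span_singleton.1 (Ideal.Quotient.eq.1 hvx.symm)⟩
  · rintro ⟨v, hv, hvx⟩
    exact ⟨v, hv, (Ideal.Quotient.eq.2 (Ideal.mem_span_singleton.2 hvx)).symm⟩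

theorem le_residueRing : V ≤ residueRing V t := fun x hx => mem_residueRing.2 ⟨x, hx, by simp⟩

theorem mem_residueRing_of_dvd {x : S} (hx : t ∣ x) : x ∈ residueRing V t :=
  mem_residueRing.2 ⟨0, zero_mem _, by simpa⟩

theorem seriesRing_le_residueRing (h : GrowthRing V t π e) :
    seriesRing V t e K ≤ residueRing V t := fun x hx => by
  obtain ⟨v, hv, y, -, rfl⟩ := h.exists_step hx
  exact mem_residueRing.2 ⟨v, hv, e ^ K * y, by ring⟩

theorem pi_mem_residueRing (h : GrowthRing V t π e) : π ∈ residueRing V t :=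
  le_residueRing h.pi_mem

/-- `S/tS` is `π`-adically separated. -/
theorem dvd_of_forall_mem (h : GrowthRing V t π e) {z : S}
    (hz : ∀ q, e ^ q * z ∈ residueRing V t) : t ∣ z := by
  have := h.noeth
  let L : Ideal V := (Ideal.span {t}).comap V.subtype
  let I : Ideal V := Ideal.span {⟨π, h.pi_mem⟩}
  have hI : I ≤ Ideal.jacobson ⊥ := by
    rw [Ideal.span_singleton_le_iff_mem, Ideal.mem_jacobson_bot]
    rintro ⟨y, hy⟩
    obtain ⟨y', hy', hyy⟩ := h.isUnit_pi y hy
    refine IsUnit.of_mul_eq_one ⟨y', hy'⟩ (Subtype.ext ?_)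
    show (π * y + 1) * y' = 1
    linear_combination hyy
  obtain ⟨v, hv, hzv⟩ := mem_residueRing.1 (hz 0)
  rw [pow_zero, one_mul] at hzv
  have hvL : (Submodule.Quotient.mk ⟨v, hv⟩ : V ⧸ L) ∈ (⨅ i : ℕ, I ^ i • (⊤ : Submodule V (V ⧸ L))) := by
    rw [Submodule.mem_iInf]
    intro q
    obtain ⟨v', hv', hzv'⟩ := mem_residueRing.1 (hz q)
    have hmk : (Submodule.Quotient.mk ⟨v, hv⟩ : V ⧸ L) =
        (⟨π, h.pi_mem⟩ : V) ^ q • Submodule.Quotient.mk ⟨v', hv'⟩ := by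
      rw [← Submodule.Quotient.mk_smul, Submodule.Quotient.eq]
      show v - π ^ q * v' ∈ Ideal.span {t}
      rw [Ideal.mem_span_singleton]
      have h1 := dvd_sub (hzv'.mul_left (π ^ q)) hzv
      convert h1 using 1
      linear_combination (-z) * h.pi_pow_mul q
    rw [hmk]
    exact Submodule.smul_mem_smul (Ideal.pow_mem_pow (Ideal.mem_span_singleton_self _) q)
      Submodule.mem_top
  -- Krull's intersection theorem for the finite `V`-module `V/(V ∩ tS)`; the element `π` lies in
  -- the Jacobson radical of `V` by `isUnit_pi`.
  rw [Ideal.iInf_pow_smul_eq_bot_of_le_jacobson I hI, Submodule.mem_bot,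
    Submodule.Quotient.mk_eq_zero] at hvL
  have h2 : t ∣ v := Ideal.mem_span_singleton.1 hvL
  simpa using dvd_add hzv h2

end GrowthRing

/-! ### Families that generate modulo `t` -/

section Generators

variable {S' : Type v} [CommRing S'] {V' : Subring S'} {π' e' : S'} 
  {ι : Type w} [Fintype ι]

/-- The elements congruent modulo `g t` to an element of `∑ g(V) b_i`. -/
def spanMod (V : Subring S) (t : S) (g : S →+* S') (b : ι → S') : AddSubgroup S' where
  carrier := {s | ∃ ξ : ι → S, (∀ i, ξ i ∈ V) ∧ g t ∣ s - ∑ i, g (ξ i) * b i}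
  zero_mem' := ⟨0, fun _ => zero_mem _, by simp⟩
  add_mem' := by
    rintro x y ⟨ξ, hξ, hx⟩ ⟨η, hη, hy⟩
    refine ⟨ξ + η, fun i => add_mem (hξ i) (hη i), ?_⟩
    convert dvd_add hx hy using 1
    simp only [Pi.add_apply, map_add, add_mul, Finset.sum_add_distrib]; ring
  neg_mem' := by
    rintro x ⟨ξ, hξ, hx⟩
    refine ⟨-ξ, fun i => neg_mem (hξ i), ?_⟩
    rw [← dvd_neg]
    convert hx using 1
    simp only [Pi.neg_apply, map_neg, neg_mul, Finset.sum_neg_distrib]; ring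

theorem mem_spanMod_of_dvd {g : S →+* S'} {b : ι → S'} {s : S'} (hs : g t ∣ s) :
    s ∈ spanMod V t g b := ⟨0, fun _ => zero_mem _, by simpa using hs⟩

theorem mul_mem_spanMod {g : S →+* S'} {b : ι → S'} {s : S'} (hs : s ∈ spanMod V t g b) {v : S}
    (hv : v ∈ V) : g v * s ∈ spanMod V t g b := by
  obtain ⟨ξ, hξ, hx⟩ := hs
  refine ⟨fun i => v * ξ i, fun i => mul_mem hv (hξ i), ?_⟩
  convert hx.mul_left (g v) using 1
  rw [mul_sub, Finset.mul_sum]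
  congr 1
  exact Finset.sum_congr rfl fun i _ => by rw [map_mul]; ring

namespace GrowthRing

variable (h : GrowthRing V t π e) (g : S →+* S') (h' : GrowthRing V' (g t) π' e') (b : ι → S')

include h

theorem map_pow_mul (n : ℕ) : g π ^ n * g e ^ n = 1 := by
  rw [← map_pow, ← map_pow, ← map_mul, h.pi_pow_mul, map_one]

theorem pow_mul_mem_spanMod {n n' : ℕ} (hn : n ≤ n') {s : S'}
    (hs : g π ^ n * s ∈ spanMod V t g b) : g π ^ n' * s ∈ spanMod V t g b := by
  obtain ⟨k, rfl⟩ := Nat.exists_eq_add_of_le hn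
  rw [add_comm, pow_add, mul_assoc, ← map_pow g π k]
  exact mul_mem_spanMod hs (pow_mem h.pi_mem k)

/-- Modulo `t` the coefficients lie in `V[π⁻¹]`, so finitely many of them have a common denominator
`π^c`. -/
theorem exists_pow_mul_mem_spanMod (hb : ∀ s, ∃ x : ι → S, g t ∣ s - ∑ i, g (x i) * b i)
    (s : S') : ∃ c, g π ^ c * s ∈ spanMod V t g b := by
  obtain ⟨x, hx⟩ := hb s
  choose c v hv hxv using fun i => h.exists_reduction (x i)
  have hterm : ∀ i, g π ^ (Finset.univ.sup c) * (g (x i) * b i) ∈ spanMod V t g b := fun i => by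
    refine h.pow_mul_mem_spanMod g b (Finset.le_sup (Finset.mem_univ i)) ?_
    classical
    refine ⟨Pi.single i (v i), fun j => ?_, ?_⟩
    · by_cases hj : j = i
      · subst hj; simpa using hv j
      · simp [hj, zero_mem]
    · rw [Finset.sum_eq_single i (fun j _ hj => by simp [hj]) (by simp), Pi.single_eq_same]
      have h1 := ((map_dvd g (hxv i)).mul_right (b i)).mul_left (g π ^ c i)
      convert h1 using 1
      rw [map_sub, map_mul, map_pow]
      linear_combination (g (v i) * b i) * h.map_pow_mul g (c i)
  refine ⟨Finset.univ.sup c, ?_⟩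
  have hsum : g π ^ (Finset.univ.sup c) * ∑ i, g (x i) * b i ∈ spanMod V t g b := by
    rw [Finset.mul_sum]; exact sum_mem fun i _ => hterm i
  have := add_mem hsum (mem_spanMod_of_dvd (V := V) (b := b) (hx.mul_left (g π ^ Finset.univ.sup c)))
  convert this using 1
  ring

/-- Multiplication by an element `e'` on `∑ g(V) b_i` has the denominator `g π^a`. -/
theorem exists_pow_mul_denominator (e' : S') (hb : ∀ s, ∃ x : ι → S, g t ∣ s - ∑ i, g (x i) * b i) :
    ∃ a, ∀ n, ∀ x ∈ spanMod V t g b, g π ^ (a * n) * e' ^ n * x ∈ spanMod V t g b := by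
  choose c hc using fun i => h.exists_pow_mul_mem_spanMod g b hb (e' * b i)
  refine ⟨Finset.univ.sup c, fun n => ?_⟩
  induction n with
  | zero => simp
  | succ n ih =>
    intro x hx
    have h1 := ih x hx
    obtain ⟨ξ, hξ, hx⟩ := h1
    have h2 : ∑ i, g (ξ i) * (g π ^ (Finset.univ.sup c) * (e' * b i)) ∈ spanMod V t g b :=
      sum_mem fun i _ => mul_mem_spanMod
        (h.pow_mul_mem_spanMod g b (Finset.le_sup (Finset.mem_univ i)) (hc i)) (hξ i)
    have := add_mem h2 (mem_spanMod_of_dvd (V := V) (b := b)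
      (hx.mul_left (g π ^ (Finset.univ.sup c) * e')))
    convert this using 1
    rw [mul_sub, Finset.mul_sum, Finset.sum_congr rfl fun i _ =>
      show g (ξ i) * (g π ^ (Finset.univ.sup c) * (e' * b i)) =
        g π ^ (Finset.univ.sup c) * e' * (g (ξ i) * b i) by ring]
    ring

include h'

/-- Continuity of `g` modulo `t`: `g` is bounded on `V` by `exists_bounded_map`, and the finitely
many `b_i` are bounded. -/
theorem exists_bound_spanMod :
    ∃ q, ∀ x ∈ spanMod V t g b, π' ^ q * x ∈ residueRing V' (g t) := by
  obtain ⟨C, hC⟩ := h.exists_bounded_map g h'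
  obtain ⟨K, hK⟩ := h'.exists_bounded_family b
  refine ⟨C + K, ?_⟩
  rintro x ⟨ξ, hξ, hx⟩
  have h1 : π' ^ (C + K) * ∑ i, g (ξ i) * b i ∈ residueRing V' (g t) := by
    rw [Finset.mul_sum]
    exact sum_mem fun i _ => h'.seriesRing_le_residueRing
      (h'.bounded_mul (hC _ (h.le_seriesRing (hξ i))) (hK i))
  have := add_mem h1 (mem_residueRing_of_dvd (V := V') (hx.mul_left (π' ^ (C + K))))
  convert this using 1
  ring

/-- The image of `π` is topologically nilpotent modulo `t`. -/
theorem exists_pow_mem_residueRing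
    (hb : ∀ s, ∃ x : ι → S, g t ∣ s - ∑ i, g (x i) * b i) (q' : ℕ) :
    ∃ n, g π ^ n * e' ^ q' ∈ residueRing V' (g t) := by
  obtain ⟨a, ha⟩ := h.exists_pow_mul_denominator g b e' hb
  obtain ⟨q, hq⟩ := h.exists_bound_spanMod g h' b
  obtain ⟨c, hc⟩ := h.exists_pow_mul_mem_spanMod g b hb 1
  -- After multiplication by `g π^c` the element `1` lies in the span; dividing by `π'^(q+q')` there
  -- costs `g π^(a(q+q'))`, and `q` of these factors are spent on returning to `residueRing`.
  refine ⟨a * (q + q') + c, ?_⟩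
  have h1 := hq _ (ha (q + q') _ hc)
  convert h1 using 1
  rw [pow_add, pow_add e']
  linear_combination (-(g π ^ (a * (q + q')) * g π ^ c * e' ^ q')) * h'.pi_pow_mul q

/-- The open mapping property of a family that generates modulo `t`. -/
theorem exists_residueRing_le_spanMod
    (hb : ∀ s, ∃ x : ι → S, g t ∣ s - ∑ i, g (x i) * b i) :
    ∃ c, ∀ y ∈ residueRing V' (g t), g π ^ c * y ∈ spanMod V t g b := by
  obtain ⟨a, ha⟩ := h.exists_pow_mul_denominator g b e' hb
  obtain ⟨q, hq⟩ := h.exists_bound_spanMod g h' b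
  let F : ℕ → AddSubgroup S' := fun n =>
    (residueRing V' (g t)).toAddSubgroup.comap (AddMonoidHom.mulLeft (e' ^ n))
  let E : ℕ → AddSubgroup S' := fun c =>
    (spanMod V t g b).comap (AddMonoidHom.mulLeft (g π ^ c))
  have hF : ∀ n x, x ∈ F n ↔ e' ^ n * x ∈ residueRing V' (g t) := fun n x => Iff.rfl
  have hE : ∀ c x, x ∈ E c ↔ g π ^ c * x ∈ spanMod V t g b := fun n x => Iff.rfl
  have hpiY : ∀ n, π' ^ n ∈ residueRing V' (g t) := fun n => pow_mem h'.pi_mem_residueRing n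
  -- The category argument behind Banach's open mapping theorem: `F n` is `π'^n` times
  -- `residueRing`, complete by `complete_pi`, and `E c` consists of the elements that `g π^c` moves
  -- into the span.
  obtain ⟨c, N, hcN⟩ := exists_le_sup_of_cover F E
    (fun m n hmn x hx => by
      obtain ⟨k, rfl⟩ := Nat.exists_eq_add_of_le hmn
      have := mul_mem (hpiY k) ((hF _ _).1 hx)
      rw [hF]
      convert this using 1
      rw [pow_add]
      linear_combination (-(e' ^ m * x)) * h'.pi_pow_mul k)
    (fun y hy => by
      choose v hv hvy using fun k => mem_residueRing.1 ((hF _ _).1 (hy k))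
      obtain ⟨s, hs, hr⟩ := h'.complete_pi v hv
      have hsum : ∀ k, g t ∣ y k - y 0 - ∑ j ∈ Finset.range k, π' ^ j * v j := fun k => by
        induction k with
        | zero => simp
        | succ k ih =>
          rw [Finset.sum_range_succ]
          convert dvd_add ih ((hvy k).mul_left (π' ^ k)) using 1
          linear_combination (-(y (k + 1) - y k)) * h'.pi_pow_mul k
      refine ⟨y 0 + s, fun k => (hF _ _).2 (mem_residueRing.2 ?_)⟩
      obtain ⟨r, hr, hrs⟩ := hr k
      refine ⟨r, hr, ?_⟩
      rw [← dvd_neg]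
      convert (hsum k).mul_left (e' ^ k) using 1
      linear_combination (-e' ^ k) * hrs - r * h'.pi_pow_mul k)
    (fun x _ => h.exists_pow_mul_mem_spanMod g b hb x)
  obtain ⟨a₂, ha₂⟩ := h'.exists_bounded (g e)
  have ha₂' := h'.seriesRing_le_residueRing ha₂
  have hge : g π * g e = 1 := by simpa using h.map_pow_mul g 1
  -- The level `N + a₂` is chosen so that the error can be divided by `g π` and still lie in `F N`.
  -- The step can therefore be iterated with powers of `g π`, that is, with coefficients that
  -- converge `π`-adically in `V`.
  have hstep : ∀ y ∈ residueRing V' (g t), ∃ ξ : ι → S, (∀ i, ξ i ∈ V) ∧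
      ∃ y' ∈ residueRing V' (g t), g t ∣ π' ^ N * g π ^ c * y -
        (∑ i, g (ξ i) * b i + g π * (π' ^ N * g π ^ c * y')) := fun y hy => by
    have hy' : π' ^ N * y ∈ F N := by
      rw [hF, ← mul_assoc, h'.pow_mul_pi_pow, one_mul]; exact hy
    obtain ⟨x, hx, z, hz, hxz⟩ := AddSubgroup.mem_sup.1 (hcN (N + a₂) hy')
    obtain ⟨ξ, hξ, hxξ⟩ := (hE _ _).1 hx
    refine ⟨ξ, hξ, e' ^ N * g e * z, ?_, ?_⟩
    · have := mul_mem ha₂' ((hF _ _).1 hz)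
      convert this using 1
      rw [pow_add]
      linear_combination (-(e' ^ N * g e * z)) * h'.pi_pow_mul a₂
    · convert hxξ using 1
      linear_combination (-g π ^ c) * hxz - (g π ^ c * z) * h'.pi_pow_mul N -
        (π' ^ N * e' ^ N * g π ^ c * z) * hge
  choose! ξ hξ f hf hξf using hstep
  refine ⟨a * N + c, fun y hy => ?_⟩
  have hyn : ∀ n, f^[n] y ∈ residueRing V' (g t) := fun n => by
    induction n with
    | zero => exact hy
    | succ n ih => rw [Function.iterate_succ_apply']; exact hf _ ih
  have hpart : ∀ n, g t ∣ π' ^ N * g π ^ c * y - (∑ i, g (∑ j ∈ Finset.range n,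
      π ^ j * ξ (f^[j] y) i) * b i + g π ^ n * (π' ^ N * g π ^ c * f^[n] y)) := fun n => by
    induction n with
    | zero => simp
    | succ n ih =>
      convert dvd_add ih ((hξf _ (hyn n)).mul_left (g π ^ n)) using 1
      simp only [Finset.sum_range_succ, map_add, add_mul, Finset.sum_add_distrib,
        Function.iterate_succ_apply', mul_sub, mul_add, Finset.mul_sum, map_mul, map_pow, mul_assoc,
        pow_succ]
      ring
  choose σ hσ hrem using fun i => h.complete_pi (fun j => ξ (f^[j] y) i) (fun j => hξ _ (hyn j) i)
  obtain ⟨q₁, hq₁⟩ := h'.exists_bounded (g π ^ c)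
  have hq₁' := h'.seriesRing_le_residueRing hq₁
  -- The `n`-th error is `g π^n` times an element with a bound independent of `n`. Since `g π` is
  -- topologically nilpotent modulo `t`, the total error lies in every `π'^{q'}` times
  -- `residueRing`, hence vanishes modulo `t`.
  have hdvd : g t ∣ π' ^ N * g π ^ c * y - ∑ i, g (σ i) * b i := by
    refine h'.dvd_of_forall_mem fun q' => ?_
    obtain ⟨n, hn⟩ := h.exists_pow_mem_residueRing g h' b hb (q' + (q + q₁))
    choose r hr hσr using fun i => hrem i n
    have hX : ∑ i, g (r i) * b i ∈ spanMod V t g b := ⟨r, hr, by simp⟩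
    have h1 : π' ^ (q + q₁) * (π' ^ N * g π ^ c * f^[n] y - ∑ i, g (r i) * b i) ∈
        residueRing V' (g t) := by
      have h2 := mul_mem (mul_mem (hpiY (q + N)) hq₁') (hyn n)
      have h3 := mul_mem (hpiY q₁) (hq _ hX)
      convert sub_mem h2 h3 using 1
      rw [pow_add, pow_add]; ring
    have h4 := mul_mem hn h1
    have h5 := mem_residueRing_of_dvd (V := V') ((hpart n).mul_left (e' ^ q'))
    convert add_mem h4 h5 using 1
    have h6 : ∑ i, g (σ i) * b i = ∑ i, g (∑ j ∈ Finset.range n, π ^ j * ξ (f^[j] y) i) * b i +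
        g π ^ n * ∑ i, g (r i) * b i := by
      rw [Finset.mul_sum, ← Finset.sum_add_distrib]
      refine Finset.sum_congr rfl fun i _ => ?_
      rw [sub_eq_iff_eq_add.1 (hσr i), map_add, map_mul, map_pow]; ring
    rw [h6, pow_add]
    linear_combination (-(g π ^ n * e' ^ q' * (π' ^ N * g π ^ c * f^[n] y -
      ∑ i, g (r i) * b i))) * h'.pi_pow_mul (q + q₁)
  have hX : π' ^ N * g π ^ c * y ∈ spanMod V t g b := ⟨σ, hσ, hdvd⟩
  -- The unwanted factor `π'^N` is removed at the cost of `g π^(aN)`.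
  have := ha N _ hX
  convert this using 1
  rw [pow_add]
  linear_combination (-(g π ^ (a * N) * g π ^ c * y)) * h'.pi_pow_mul N

/-- A finite family that generates modulo `t` generates. -/
theorem exists_sum_eq_of_mod
    (hb : ∀ s, ∃ x : ι → S, g t ∣ s - ∑ i, g (x i) * b i) (s : S') :
    ∃ x : ι → S, s = ∑ i, g (x i) * b i := by
  obtain ⟨c, hc⟩ := h.exists_residueRing_le_spanMod g h' b hb
  obtain ⟨C, hC⟩ := h.exists_bounded_map g h'
  obtain ⟨K₁, hK₁⟩ := h'.exists_bounded_family fun i => g e ^ c * b i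
  obtain ⟨K₀, hK₀⟩ := h'.exists_bounded_of_mul
  -- Division of elements of `V'` by the family, with the bound `B` for the quotient by `t` uniform
  -- in `l`: the coefficients lie in `V`, where `g` is uniformly bounded, and division by `t`
  -- preserves bounds.
  obtain ⟨B, hB⟩ : ∃ B, ∀ l ∈ V', ∃ ξ : ι → S, (∀ i, ξ i ∈ V) ∧ ∃ z,
      π' ^ B * z ∈ seriesRing V' (g t) e' B ∧ l = g e ^ c * ∑ i, g (ξ i) * b i + g t * z := by
    refine ⟨max K₀ (C + K₁) + (C + K₁), fun l hl => ?_⟩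
    obtain ⟨ξ, hξ, z, hz⟩ := hc l (le_residueRing hl)
    have hlz : l = g e ^ c * ∑ i, g (ξ i) * b i + g t * (g e ^ c * z) := by
      linear_combination (g e ^ c) * hz - l * h.map_pow_mul g c
    refine ⟨ξ, hξ, g e ^ c * z, ?_, hlz⟩
    have h1 : π' ^ (C + K₁) * (g t * (g e ^ c * z)) ∈ seriesRing V' (g t) e' (C + K₁) := by
      rw [← sub_eq_iff_eq_add'.2 hlz, mul_sub, Finset.mul_sum, Finset.mul_sum]
      refine sub_mem (mul_mem (h'.pi_pow_mem _) (h'.le_seriesRing hl)) (sum_mem fun i _ => ?_)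
      rw [mul_left_comm (g e ^ c)]
      exact h'.bounded_mul (hC _ (h.le_seriesRing (hξ i))) (hK₁ i)
    have h2 := hK₀ _ (le_max_left K₀ (C + K₁)) (π' ^ (C + K₁) * (g e ^ c * z))
      (by rw [mul_left_comm]; exact h'.seriesRing_mono (le_max_right _ _) h1)
    rw [pow_add, mul_assoc]
    exact h'.seriesRing_mono (Nat.le_add_right _ _) h2
  -- The exponent `m` compares growth: `g π^m e'` is in some `R'_k`, so denominators `e'^K` in the
  -- target can be traded for `g e^(mK)`. Coefficients of growth `mK` in the source then suffice.
  obtain ⟨m, hm⟩ := h.exists_pow_mem_residueRing g h' b hb 1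
  obtain ⟨v, hv, z, hz⟩ := mem_residueRing.1 hm
  obtain ⟨k, hk⟩ := h'.exists_bounded z
  have hζ : g π ^ m * e' ∈ seriesRing V' (g t) e' k := by
    have := add_mem (h'.le_seriesRing hv) (mul_mem h'.step_mem hk)
    convert this using 1
    linear_combination hz - g t * z * h'.pi_pow_mul k
  obtain ⟨K₂, hK₂⟩ := h'.exists_bounded s
  obtain ⟨K, hKB, hKk, hKs⟩ : ∃ K, B ≤ K ∧ k ≤ K ∧ K₂ ≤ K :=
    ⟨max B (max k K₂), le_max_left _ _, (le_max_left _ _).trans (le_max_right _ _),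
      (le_max_right _ _).trans (le_max_right _ _)⟩
  have hζK : (g π ^ m * e') ^ K ∈ seriesRing V' (g t) e' K :=
    pow_mem (h'.seriesRing_mono hKk hζ) K
  -- The division step with parameter `g(t e^(mK))` in place of `g t · e'^K`, so that the
  -- coefficients found by iteration can be summed in `S`.
  have hstep : ∀ d ∈ seriesRing V' (g t) e' K, ∃ ξ : ι → S, (∀ i, ξ i ∈ V) ∧
      ∃ d' ∈ seriesRing V' (g t) e' K,
        d = g e ^ c * ∑ i, g (ξ i) * b i + g (t * e ^ (m * K)) * d' := fun d hd => by
    obtain ⟨l, hl, d₁, hd₁, rfl⟩ := h'.exists_step hd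
    obtain ⟨ξ, hξ, z, hz, rfl⟩ := hB l hl
    refine ⟨ξ, hξ, (g π ^ m * e') ^ K * (π' ^ K * z + d₁),
      mul_mem hζK (add_mem (h'.bounded_mono hKB hz) hd₁), ?_⟩
    have h1 := h.map_pow_mul g (m * K)
    have h2 := h'.pi_pow_mul K
    rw [map_mul, map_pow, mul_pow, ← pow_mul]
    linear_combination (-(g t * e' ^ K * (π' ^ K * z + d₁))) * h1 - g t * z * h2
  choose! ξ hξ f hf hξf using hstep
  have hd₀ : g π ^ (m * K) * s ∈ seriesRing V' (g t) e' K := by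
    have := mul_mem hζK (h'.bounded_mono hKs hK₂)
    convert this using 1
    rw [mul_pow, ← pow_mul]
    linear_combination (-(g π ^ (m * K) * s)) * h'.pi_pow_mul K
  set d₀ := g π ^ (m * K) * s with hd₀_def
  have hdn : ∀ n, f^[n] d₀ ∈ seriesRing V' (g t) e' K := fun n => by
    induction n with
    | zero => exact hd₀
    | succ n ih => rw [Function.iterate_succ_apply']; exact hf _ ih
  have h1 : IsSeriesSum (g (t * e ^ (m * K)))
      (fun n => g e ^ c * ∑ i, g (ξ (f^[n] d₀) i) * b i) d₀ :=
    IsSeriesSum.of_step (y := fun n => f^[n] d₀) fun n => by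
      have := hξf _ (hdn n)
      simp only [Function.iterate_succ_apply'] at this ⊢
      exact this
  choose x hx using fun i => h.exists_sum (m * K) (fun n => ξ (f^[n] d₀) i)
    (fun n => hξ _ (hdn n) i)
  have h2 : IsSeriesSum (g (t * e ^ (m * K)))
      (fun n => g e ^ c * ∑ i, g (ξ (f^[n] d₀) i) * b i) (g e ^ c * ∑ i, g (x i) * b i) := by
    refine IsSeriesSum.const_mul (fun n => ?_) _
    have : ∑ i, g (x i) * b i - ∑ j ∈ Finset.range n, g (t * e ^ (m * K)) ^ j *
        ∑ i, g (ξ (f^[j] d₀) i) * b i =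
        ∑ i, (g (x i) - ∑ j ∈ Finset.range n, g (t * e ^ (m * K)) ^ j *
          g (ξ (f^[j] d₀) i)) * b i := by
      simp only [Finset.mul_sum, sub_mul, Finset.sum_sub_distrib, Finset.sum_mul, mul_assoc]
      rw [Finset.sum_comm]
    rw [this]
    exact Finset.dvd_sum fun i _ => ((hx i).map g n).mul_right _
  have h3 : d₀ = g e ^ c * ∑ i, g (x i) * b i := by
    refine sub_eq_zero.1 (h'.separated _ fun n => ?_)
    have h4 : g t ^ n ∣ g (t * e ^ (m * K)) ^ n := by
      rw [map_mul, mul_pow]; exact dvd_mul_right _ _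
    refine h4.trans ?_
    simpa using dvd_sub (h1 n) (h2 n)
  refine ⟨fun i => e ^ (m * K + c) * x i, ?_⟩
  have h5 : ∑ i, g (e ^ (m * K + c) * x i) * b i = g e ^ (m * K) * d₀ := by
    rw [h3, Finset.mul_sum, Finset.mul_sum]
    exact Finset.sum_congr rfl fun i _ => by rw [map_mul, map_pow, pow_add]; ring
  rw [h5, hd₀_def]
  linear_combination (-s) * h.map_pow_mul g (m * K)

end GrowthRing
end Generators
end Hom

/-! ### Flatness modulo a regular element -/

section Flat

variable {R : Type u} {M : Type v} [CommRing R] [CommRing M] [Algebra R M]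

/-- Relations modulo `t^k` are trivial if relations modulo `t` are. -/
theorem exists_relation_mod_pow {t : R} (hreg : ∀ x : M, algebraMap R M t * x = 0 → x = 0)
    (hflat : ∀ {ι : Type} [Fintype ι] (a : ι → R) (y : ι → M),
      algebraMap R M t ∣ ∑ i, algebraMap R M (a i) * y i →
      ∃ (κ : Type) (_ : Fintype κ) (c : ι → κ → R) (z : κ → M),
        (∀ i, algebraMap R M t ∣ y i - ∑ j, algebraMap R M (c i j) * z j) ∧
        ∀ j, t ∣ ∑ i, a i * c i j)
    (k : ℕ) {ι : Type} [Fintype ι] (a : ι → R) (y : ι → M)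
    (hy : algebraMap R M t ^ k ∣ ∑ i, algebraMap R M (a i) * y i) :
    ∃ (κ : Type) (_ : Fintype κ) (c : ι → κ → R) (z : κ → M),
      (∀ i, algebraMap R M t ^ k ∣ y i - ∑ j, algebraMap R M (c i j) * z j) ∧
      ∀ j, t ^ k ∣ ∑ i, a i * c i j := by
  induction k generalizing ι with
  | zero => exact ⟨Empty, inferInstance, fun _ => Empty.elim, Empty.elim, by simp, by simp⟩
  | succ k ih =>
    obtain ⟨κ, _, c, z, hyz, hac⟩ := hflat a y ((dvd_pow_self _ k.succ_ne_zero).trans hy)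
    choose w hw using hyz
    choose d hd using hac
    -- With `y = c z + t w` and `a c = t d`, the relation equals `t (∑ d z + ∑ a w)`. Cancelling `t`
    -- leaves a relation modulo `t^k` between the `z` and the `w` together.
    have hdvd : algebraMap R M t ^ k ∣
        ∑ s : κ ⊕ ι, algebraMap R M (Sum.elim d a s) * Sum.elim z w s := by
      obtain ⟨q, hq⟩ := hy
      refine ⟨q, sub_eq_zero.1 (hreg _ ?_)⟩
      have h1 : ∑ i, algebraMap R M (a i) * ∑ j, algebraMap R M (c i j) * z j =
          ∑ j, algebraMap R M t * (algebraMap R M (d j) * z j) := by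
        simp only [Finset.mul_sum]
        rw [Finset.sum_comm]
        refine Finset.sum_congr rfl fun j _ => ?_
        rw [← mul_assoc, ← map_mul, ← hd, map_sum, Finset.sum_mul]
        exact Finset.sum_congr rfl fun i _ => by rw [map_mul, mul_assoc]
      have h2 : ∑ i, algebraMap R M (a i) * y i =
          ∑ i, algebraMap R M (a i) * ∑ j, algebraMap R M (c i j) * z j +
          algebraMap R M t * ∑ i, algebraMap R M (a i) * w i := by
        rw [Finset.mul_sum, ← Finset.sum_add_distrib]
        exact Finset.sum_congr rfl fun i _ => by rw [sub_eq_iff_eq_add.1 (hw i)]; ring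
      simp only [Fintype.sum_sum_type, Sum.elim_inl, Sum.elim_inr]
      rw [h1, ← Finset.mul_sum] at h2
      linear_combination hq - h2
    obtain ⟨κ', _, e, z', hz', hde⟩ := ih (Sum.elim d a) (Sum.elim z w) hdvd
    choose w' hw' using hz'
    -- Substituting the solutions for `z` and `w` gives the first block of columns. The error `t^k
    -- w'` in `z` is not multiplied by `t`, so it needs the additional columns `t^k c`, which are
    -- relations modulo `t^(k+1)` because `a c` is divisible by `t`.
    refine ⟨κ' ⊕ κ, inferInstance,
      fun i => Sum.elim (fun l => ∑ j, c i j * e (Sum.inl j) l + t * e (Sum.inr i) l)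
        (fun j => t ^ k * c i j), Sum.elim z' (fun j => w' (Sum.inl j)), fun i => ?_, ?_⟩
    · refine ⟨w' (Sum.inr i), ?_⟩
      have hz : ∀ j, z j = ∑ l, algebraMap R M (e (Sum.inl j) l) * z' l +
          algebraMap R M t ^ k * w' (Sum.inl j) := fun j =>
        (sub_eq_iff_eq_add'.1 (hw' (Sum.inl j)))
      have hw2 : w i = ∑ l, algebraMap R M (e (Sum.inr i) l) * z' l +
          algebraMap R M t ^ k * w' (Sum.inr i) := sub_eq_iff_eq_add'.1 (hw' (Sum.inr i))
      have hs : ∑ j, algebraMap R M (c i j) * z j =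
          ∑ l, algebraMap R M (∑ j, c i j * e (Sum.inl j) l) * z' l +
          algebraMap R M t ^ k * ∑ j, algebraMap R M (c i j) * w' (Sum.inl j) := by
        calc _ = ∑ j, (∑ l, algebraMap R M (c i j) * algebraMap R M (e (Sum.inl j) l) * z' l +
              algebraMap R M t ^ k * (algebraMap R M (c i j) * w' (Sum.inl j))) := by
              refine Finset.sum_congr rfl fun j _ => ?_
              rw [hz j, mul_add, Finset.mul_sum]
              simp only [mul_assoc]
              ring
          _ = _ := by
              rw [Finset.sum_add_distrib, Finset.sum_comm, Finset.mul_sum]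
              simp only [map_sum, map_mul, Finset.sum_mul]
      have hs2 : ∑ l, algebraMap R M (∑ j, c i j * e (Sum.inl j) l + t * e (Sum.inr i) l) * z' l =
          ∑ l, algebraMap R M (∑ j, c i j * e (Sum.inl j) l) * z' l +
          algebraMap R M t * ∑ l, algebraMap R M (e (Sum.inr i) l) * z' l := by
        rw [Finset.mul_sum, ← Finset.sum_add_distrib]
        exact Finset.sum_congr rfl fun l _ => by rw [map_add, map_mul]; ring
      have hs3 : ∑ j, algebraMap R M (t ^ k * c i j) * w' (Sum.inl j) =
          algebraMap R M t ^ k * ∑ j, algebraMap R M (c i j) * w' (Sum.inl j) := by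
        rw [Finset.mul_sum]
        exact Finset.sum_congr rfl fun l _ => by rw [map_mul, map_pow]; ring
      simp only [Fintype.sum_sum_type, Sum.elim_inl, Sum.elim_inr]
      rw [hs2, hs3, sub_eq_iff_eq_add.1 (hw i), hw2, hs]
      ring
    · rintro (l | j)
      · obtain ⟨q, hq⟩ := hde l
        refine ⟨q, ?_⟩
        simp only [Fintype.sum_sum_type, Sum.elim_inl, Sum.elim_inr] at hq ⊢
        rw [pow_succ', mul_assoc, ← hq]
        simp only [mul_add, Finset.sum_add_distrib, Finset.mul_sum]
        rw [Finset.sum_comm]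
        congr 1
        · refine Finset.sum_congr rfl fun j _ => ?_
          rw [← mul_assoc, ← hd, Finset.sum_mul]
          exact Finset.sum_congr rfl fun i _ => by ring
        · exact Finset.sum_congr rfl fun i _ => by ring
      · refine ⟨d j, ?_⟩
        simp only [Sum.elim_inr]
        rw [pow_succ, mul_assoc, ← hd, Finset.mul_sum]
        exact Finset.sum_congr rfl fun i _ => by ring

/-- Flatness can be checked modulo a regular element in the Jacobson radical. -/
theorem flat_of_flat_mod [IsNoetherianRing R] [IsNoetherianRing M] {t : R}
    (hreg : ∀ x : M, algebraMap R M t * x = 0 → x = 0)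
    (hjac : algebraMap R M t ∈ Ideal.jacobson (⊥ : Ideal M))
    (hflat : ∀ {ι : Type} [Fintype ι] (a : ι → R) (y : ι → M),
      algebraMap R M t ∣ ∑ i, algebraMap R M (a i) * y i →
      ∃ (κ : Type) (_ : Fintype κ) (c : ι → κ → R) (z : κ → M),
        (∀ i, algebraMap R M t ∣ y i - ∑ j, algebraMap R M (c i j) * z j) ∧
        ∀ j, t ∣ ∑ i, a i * c i j) : Module.Flat R M := by
  refine Module.Flat.of_forall_isTrivialRelation fun {n a x} hx => ?_
  let φ : (Fin n → M) →ₗ[M] M := Fintype.linearCombination M fun i => algebraMap R M (a i)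
  have hφ : ∀ y, φ y = ∑ i, algebraMap R M (a i) * y i := fun y => by
    simp [φ, Fintype.linearCombination_apply, mul_comm]
  let C : Set (Fin n → M) := {y | ∃ c : Fin n → R, ∑ i, a i * c i = 0 ∧
    y = fun i => algebraMap R M (c i)}
  -- Artin–Rees: `t^(k+1) R ∩ (a)` is contained in `t (a)`. Thus a relation modulo `t^(k+1)` becomes
  -- an exact relation after subtraction of a multiple of `t`.
  obtain ⟨k, hk⟩ := Ideal.exists_pow_inf_eq_pow_smul (Ideal.span {t})
    (Ideal.span (Set.range a) : Submodule R R)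
  have hAR : ∀ d, t ^ (k + 1) * d ∈ Ideal.span (Set.range a) →
      ∃ f : Fin n → R, t ^ (k + 1) * d = t * ∑ i, a i * f i := fun d hd => by
    have h1 := hk (k + 1) k.le_succ
    have h2 : t ^ (k + 1) * d ∈ Ideal.span {t} ^ (k + 1) • (⊤ : Submodule R R) ⊓
        (Ideal.span (Set.range a) : Submodule R R) :=
      ⟨Submodule.smul_mem_smul (Ideal.pow_mem_pow (Ideal.mem_span_singleton_self t) _)
        Submodule.mem_top, hd⟩
    rw [h1, Nat.add_sub_cancel_left, pow_one] at h2
    obtain ⟨z, hz, hzt⟩ := Ideal.mem_span_singleton_mul.1 h2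
    obtain ⟨f, hf⟩ := (Ideal.mem_span_range_iff_exists_fun).1 hz.2
    exact ⟨f, by rw [← hzt, ← hf]; simp only [mul_comm (f _)]⟩
  -- Nakayama over `M`: every element of the kernel is a combination of relations from `R` plus `t`
  -- times an element that, by regularity of `t`, is again in the kernel.
  have hle : LinearMap.ker φ ≤ Submodule.span M C := by
    refine Submodule.le_of_le_smul_of_le_jacobson_bot (IsNoetherian.noetherian _)
      (I := Ideal.span {algebraMap R M t}) (by rwa [Ideal.span_singleton_le_iff_mem])
      fun y hy => ?_
    rw [LinearMap.mem_ker, hφ] at hy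
    obtain ⟨κ, _, c, z, hyz, hac⟩ := exists_relation_mod_pow hreg hflat (k + 1) a y
      (by rw [hy]; exact dvd_zero _)
    have hc : ∀ j, ∃ f : Fin n → R, ∑ i, a i * c i j = t * ∑ i, a i * f i := fun j => by
      obtain ⟨d, hd⟩ := hac j
      rw [hd]
      refine hAR d (hd ▸ sum_mem fun i _ => Ideal.mul_mem_right _ _ (Ideal.subset_span ⟨i, rfl⟩))
    choose f hf using hc
    choose w hw using hyz
    let c' : κ → Fin n → M := fun j i => algebraMap R M (c i j - t * f j i)
    have hc' : ∀ j, c' j ∈ C := fun j => ⟨fun i => c i j - t * f j i, by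
      simp only [mul_sub, Finset.sum_sub_distrib]
      rw [hf, Finset.mul_sum, sub_eq_zero]
      exact Finset.sum_congr rfl fun i _ => by ring, rfl⟩
    let y' : Fin n → M := fun i => ∑ j, algebraMap R M (f j i) * z j + algebraMap R M t ^ k * w i
    have hyy : y = ∑ j, z j • c' j + algebraMap R M t • y' := by
      ext i
      simp only [Pi.add_apply, Finset.sum_apply, Pi.smul_apply, smul_eq_mul, c', y', map_sub,
        map_mul, mul_sub, Finset.sum_sub_distrib, mul_add, Finset.mul_sum]
      rw [sub_eq_iff_eq_add.1 (hw i), Finset.sum_congr rfl fun j _ => mul_comm (z j) _,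
        Finset.sum_congr rfl fun j _ => show z j * (algebraMap R M t * algebraMap R M (f j i)) =
          algebraMap R M t * (algebraMap R M (f j i) * z j) by ring]
      ring
    have hspan : ∑ j, z j • c' j ∈ Submodule.span M C :=
      sum_mem fun j _ => Submodule.smul_mem _ _ (Submodule.subset_span (hc' j))
    have hCk : Submodule.span M C ≤ LinearMap.ker φ := Submodule.span_le.2 (by
      rintro _ ⟨c, hc, rfl⟩
      show φ _ = 0
      rw [hφ]
      simp only [← map_mul, ← map_sum, hc, map_zero])
    have hy'k : y' ∈ LinearMap.ker φ := by
      rw [LinearMap.mem_ker]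
      refine hreg _ ?_
      rw [← smul_eq_mul, ← map_smul, ← sub_eq_iff_eq_add'.2 hyy, map_sub,
        LinearMap.mem_ker.1 (hCk hspan), hφ, hy, sub_zero]
    rw [hyy]
    exact Submodule.add_mem_sup hspan
      (Submodule.smul_mem_smul (Ideal.mem_span_singleton_self _) hy'k)
  have hxk : x ∈ LinearMap.ker φ := by
    rw [LinearMap.mem_ker, hφ]
    simpa [Algebra.smul_def] using hx
  obtain ⟨l, y, c, hxc⟩ := Submodule.mem_span_set'.1 (hle hxk)
  choose c' hc' hcc using fun j => (c j).2
  refine ⟨l, fun i j => c' j i, y, fun i => ?_, fun j => hc' j⟩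
  rw [← hxc]
  simp only [Finset.sum_apply, hcc, Algebra.smul_def]
  exact Finset.sum_congr rfl fun j _ => mul_comm _ _

end Flat

open IsLocalRing

/-! ### The ring of overconvergent series has linear growth -/

section Terms

variable {O : Type u} [CommRing O]

section

variable [IsLocalRing O]

variable (O) in
/-- The monomial `π^j`. -/
def biMonomial (j : ℤ) : BiLaurent O :=
  ⟨fun _ => HahnSeries.single j 1, fun n => by
    ext i
    show Ideal.Quotient.factorPow (maximalIdeal O) n.le_succ ((HahnSeries.single j 1).coeff i) =
      (HahnSeries.single j 1).coeff i
    rw [HahnSeries.coeff_single, HahnSeries.coeff_single]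
    split_ifs
    · exact map_one _
    · exact map_zero _⟩

theorem biMonomial_mul (i j : ℤ) : biMonomial O i * biMonomial O j = biMonomial O (i + j) :=
  Subtype.ext (funext fun n => by
    show (HahnSeries.single i 1 * HahnSeries.single j 1 :
      LaurentSeries (O ⧸ maximalIdeal O ^ n)) = HahnSeries.single (i + j) 1
    rw [HahnSeries.single_mul_single, mul_one])

theorem biMonomial_pow (i : ℤ) (k : ℕ) : biMonomial O i ^ k = biMonomial O (k * i) := by
  induction k with
  | zero => rw [pow_zero, Nat.cast_zero, zero_mul]; rfl
  | succ k ih => rw [pow_succ, ih, biMonomial_mul]; congr 1; push_cast; ring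

end

variable [IsDomain O] [IsDiscreteValuationRing O]

theorem le_absO (ρ : Set.Ioo (0 : ℝ) 1) {a : O} {q : ℕ} (h : a ∉ maximalIdeal O ^ q) :
    (ρ : ℝ) ^ q ≤ absO ρ a := by
  have ha : a ≠ 0 := fun h0 => h (h0 ▸ zero_mem _)
  rw [absO, if_neg ha]
  refine pow_le_pow_of_le_one ρ.2.1.le ρ.2.2.le ?_
  rw [mem_pow_iff, not_le] at h
  exact ENat.toNat_le_of_le_natCast h.le

theorem absO_le (ρ : Set.Ioo (0 : ℝ) 1) {a : O} {q : ℕ} (h : a ∈ maximalIdeal O ^ q) :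
    absO ρ a ≤ (ρ : ℝ) ^ q := by
  unfold absO
  split_ifs with ha
  · exact pow_nonneg ρ.2.1.le _
  · refine pow_le_pow_of_le_one ρ.2.1.le ρ.2.2.le ?_
    rw [mem_pow_iff, ← ENat.natCast_toNat (mt IsDiscreteValuationRing.addVal_eq_top_iff.1 ha),
      Nat.cast_le] at h
    exact h

variable [IsAdicComplete (maximalIdeal O) O]

theorem BiLaurent.ext_coeff {x y : BiLaurent O} (h : ∀ i, x.coeff i = y.coeff i) : x = y := by
  refine Subtype.ext (funext fun n => ?_)
  ext i
  rw [← BiLaurent.mk_coeff, ← BiLaurent.mk_coeff, h]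

theorem BiLaurent.coeff_algebraMap_mul (a : O) (x : BiLaurent O) (i : ℤ) :
    (algebraMap O (BiLaurent O) a * x).coeff i = a * x.coeff i :=
  eq_of_mk_eq fun n => by
    rw [BiLaurent.mk_coeff, map_mul, BiLaurent.mk_coeff]
    show (HahnSeries.C (Ideal.Quotient.mk (maximalIdeal O ^ n) a) * x.1 n).coeff i = _
    rw [HahnSeries.C_mul_eq_smul, HahnSeries.coeff_smul, smul_eq_mul]

theorem BiLaurent.coeff_biMonomial_mul (j : ℤ) (x : BiLaurent O) (i : ℤ) :
    (biMonomial O j * x).coeff i = x.coeff (i - j) :=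
  eq_of_mk_eq fun n => by
    rw [BiLaurent.mk_coeff, BiLaurent.mk_coeff]
    show (HahnSeries.single j 1 * x.1 n).coeff i = _
    have := HahnSeries.coeff_single_mul_add (r := (1 : O ⧸ maximalIdeal O ^ n)) (x := x.1 n)
      (a := i - j) (b := j)
    rw [sub_add_cancel, one_mul] at this
    exact this

theorem BiLaurent.coeff_biMonomial (j : ℤ) (i : ℤ) :
    (biMonomial O j).coeff i = if i = j then 1 else 0 := by
  rw [← mul_one (biMonomial O j), BiLaurent.coeff_biMonomial_mul, ← map_one (algebraMap O _),
    BiLaurent.coeff_algebraMap]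
  simp only [sub_eq_zero]

variable {m n : ℕ}

/-- The coefficient of `π^i` times the monomial with exponent `γ`. -/
def term (F : MvPowerSeries (Fin m ⊕ Fin n) (BiLaurent O)) (i : ℤ) (γ : Fin m ⊕ Fin n →₀ ℕ) : O :=
  (MvPowerSeries.coeff γ F).coeff i

theorem term_ext {F G : MvPowerSeries (Fin m ⊕ Fin n) (BiLaurent O)}
    (h : ∀ i γ, term F i γ = term G i γ) : F = G := by
  ext1 γ
  exact BiLaurent.ext_coeff fun i => h i γ

theorem term_zero (i : ℤ) (γ) :
    term (0 : MvPowerSeries (Fin m ⊕ Fin n) (BiLaurent O)) i γ = 0 := by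
  rw [term, map_zero, BiLaurent.coeff_zero]

theorem term_add (F G : MvPowerSeries (Fin m ⊕ Fin n) (BiLaurent O)) (i : ℤ) (γ) :
    term (F + G) i γ = term F i γ + term G i γ := by
  rw [term, map_add, BiLaurent.coeff_add]; rfl

theorem term_monomial_mul (j : ℤ) (F : MvPowerSeries (Fin m ⊕ Fin n) (BiLaurent O)) (i : ℤ) (γ) :
    term (MvPowerSeries.C (biMonomial O j) * F) i γ = term F (i - j) γ := by
  rw [term, MvPowerSeries.coeff_C_mul, BiLaurent.coeff_biMonomial_mul]; rfl

theorem term_algebraMap_mul (a : O) (F : MvPowerSeries (Fin m ⊕ Fin n) (BiLaurent O)) (i : ℤ) (γ) :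
    term (algebraMap O _ a * F) i γ = a * term F i γ := by
  rw [term, MvPowerSeries.algebraMap_apply, MvPowerSeries.coeff_C_mul,
    BiLaurent.coeff_algebraMap_mul]; rfl

/-- The coefficients of exponent below `-Kq` lie in `𝔪^q`. -/
def HasGrowth (K : ℕ) (a : ℤ → (Fin m ⊕ Fin n →₀ ℕ) → O) : Prop :=
  ∀ (q : ℕ) (i : ℤ) (γ), i < -(K * q : ℤ) → a i γ ∈ maximalIdeal O ^ q

/-- Modulo each power of `𝔪`, the coefficients of each `U^β π^i` are polynomials in `T`. -/
def IsPolyMod (a : ℤ → (Fin m ⊕ Fin n →₀ ℕ) → O) : Prop :=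
  ∀ (N : ℕ) (M : ℤ) (β : Fin n → ℕ), {p : ℤ × (Fin m ⊕ Fin n →₀ ℕ) |
    (∀ l, p.2 (Sum.inr l) = β l) ∧ p.1 ≤ M ∧ a p.1 p.2 ∉ maximalIdeal O ^ N}.Finite

/-- This eliminates the radius: a bound for the `r`-Gauss norm and linear growth with slope `K`
determine each other up to a change of `r` or `K`. -/
theorem mem_dagger_iff (ρ ω : Set.Ioo (0 : ℝ) 1)
    (F : MvPowerSeries (Fin m ⊕ Fin n) (BiLaurent O)) :
    F ∈ dagger O ρ ω m n ↔ (∃ K, HasGrowth K (term F)) ∧ IsPolyMod (term F) := by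
  have hω := ω.2.1
  have hρ := ρ.2.1
  constructor
  · rintro ⟨r, hr⟩
    have hF : IsConvergent (weight ρ ω r) F := hr
    have hr0 : (0 : ℝ) < r := r.2
    constructor
    · obtain ⟨C, hC, hFC⟩ := hF.bounded (isWeight ρ ω r.2)
      -- A coefficient outside `𝔪^q` at an exponent below `-Kq` has a term of size at least `(ρ
      -- ω^(-rK))^q`, which exceeds the bound `C` once `ω^(-rK) > max(C,1)/ρ` and `q ≥ 1`.
      obtain ⟨K, hK⟩ := pow_unbounded_of_one_lt ((max C 1) / (ρ : ℝ))
        ((one_lt_inv₀ (rpow_pos ω r)).2 (Real.rpow_lt_one hω.le ω.2.2 hr0))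
      refine ⟨K, fun q i γ hi => ?_⟩
      by_contra hmem
      have hq : q ≠ 0 := by rintro rfl; simp at hmem
      have h1 : (ρ : ℝ) ^ q * (ω : ℝ) ^ ((r : ℝ) * (i : ℝ)) ≤ C :=
        (mul_le_mul_of_nonneg_right (le_absO ρ hmem) (rpow_pos ω _).le).trans (hFC i γ)
      have h2 : ((ω : ℝ) ^ (r : ℝ))⁻¹ ^ (K * q) ≤ (ω : ℝ) ^ ((r : ℝ) * (i : ℝ)) := by
        rw [← Real.rpow_neg hω.le, ← Real.rpow_natCast, ← Real.rpow_mul hω.le]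
        refine rpow_le ?_
        have : (i : ℝ) ≤ -(K * q : ℝ) := by exact_mod_cast hi.le
        push_cast
        nlinarith
      have h3 : (max C 1 / (ρ : ℝ)) ^ q < ((ω : ℝ) ^ (r : ℝ))⁻¹ ^ (K * q) := by
        rw [pow_mul]
        exact pow_lt_pow_left₀ hK (by positivity) hq
      have h4 : (ρ : ℝ) ^ q * (max C 1 / (ρ : ℝ)) ^ q = (max C 1) ^ q := by
        rw [← mul_pow, mul_div_cancel₀ _ hρ.ne']
      have h5 : (max C 1) ^ q < C := by
        rw [← h4]
        exact (mul_lt_mul_of_pos_left (h3.trans_le h2) (pow_pos hρ q)).trans_le h1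
      have h6 : max C 1 ≤ (max C 1) ^ q := le_self_pow₀ (le_max_right _ _) hq
      exact absurd (h6.trans_lt h5) (not_lt.2 (le_max_left _ _))
    · intro N M β
      refine ((hF ((ρ : ℝ) ^ N * (ω : ℝ) ^ ((r : ℝ) * (M : ℝ)))
        (mul_pos (pow_pos hρ N) (rpow_pos ω _))).2 β).subset ?_
      rintro p ⟨h1, h2, h3⟩
      refine ⟨h1, mul_le_mul (le_absO ρ h3) (rpow_le ?_) (rpow_pos ω _).le (absO_nonneg _ _)⟩
      exact mul_le_mul_of_nonneg_left (by exact_mod_cast h2) hr0.le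
  · rintro ⟨⟨K₀, hK₀⟩, hfin⟩
    obtain ⟨K, hK1, hK⟩ : ∃ K : ℕ, 0 < K ∧ HasGrowth K (term F) :=
      ⟨K₀ + 1, Nat.succ_pos _, fun q i γ hi => hK₀ q i γ (hi.trans_le (by push_cast; nlinarith))⟩
    set σ : ℝ := Real.sqrt ρ with hσ
    have hσ0 : 0 < σ := Real.sqrt_pos.2 hρ
    have hσσ : σ * σ = ρ := Real.mul_self_sqrt hρ.le
    have hσ1 : σ < 1 := by
      by_contra hcon
      have := ρ.2.2
      nlinarith [not_lt.1 hcon]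
    -- With `ω^(rK) = √ρ`, the terms whose exponent lies between `-K(q+1)` and `-Kq` have size at
    -- most `ρ^q σ^(-(q+1)) = σ^(q-1)`: half of the decay of the coefficients is left over, which
    -- gives convergence.
    obtain ⟨r, hr0, hr⟩ : ∃ r : ℝ, 0 < r ∧ (ω : ℝ) ^ (r * K) = σ := by
      have hK0 : (K : ℝ) ≠ 0 := by exact_mod_cast hK1.ne'
      refine ⟨Real.logb ω σ / K, div_pos (Real.logb_pos_of_base_lt_one hω ω.2.2 hσ0 hσ1)
        (by exact_mod_cast hK1), ?_⟩
      rw [div_mul_cancel₀ _ hK0, Real.rpow_logb hω ω.2.2.ne hσ0]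
    refine ⟨⟨r, hr0⟩, ?_⟩
    show IsConvergent (weight ρ ω r) F
    intro ε hε
    have hN : ∃ N : ℤ, ∀ i γ, ε ≤ weight ρ ω r (MvPowerSeries.coeff γ F) i → N ≤ i := by
      obtain ⟨Q, hQ⟩ := exists_pow_lt_of_lt_one (mul_pos hε hσ0) hσ1
      refine ⟨-(K * Q : ℤ) - K, fun i γ hi => ?_⟩
      by_contra hlt
      obtain ⟨q, hq1, hq2⟩ : ∃ q : ℕ, i < -(K * q : ℤ) ∧ -(K * (q + 1) : ℤ) ≤ i := by
        refine ⟨((-i - 1) / K).toNat, ?_, ?_⟩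
        all_goals
          have hKz : (0 : ℤ) < K := by exact_mod_cast hK1
          have hi0 : 0 ≤ -i - 1 := by
            have : (0 : ℤ) ≤ K * Q := by positivity
            omega
          rw [Int.toNat_of_nonneg (Int.ediv_nonneg hi0 hKz.le)]
          have h1 := Int.mul_ediv_add_emod (-i - 1) K
          have h2 := Int.emod_nonneg (-i - 1) hKz.ne'
          have h3 := Int.emod_lt_of_pos (-i - 1) hKz
          linarith
      have hqQ : Q ≤ q := by
        by_contra hcon
        have h1 : ((q + 1 : ℕ) : ℤ) ≤ Q := by exact_mod_cast Nat.succ_le_of_lt (not_le.1 hcon)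
        have h2 : (K : ℤ) * ((q + 1 : ℕ) : ℤ) ≤ K * Q :=
          mul_le_mul_of_nonneg_left h1 (Int.natCast_nonneg K)
        push_cast at h2
        have h3 : (0 : ℤ) ≤ K := Int.natCast_nonneg K
        linarith [not_le.1 hlt]
      have h1 : weight ρ ω r (MvPowerSeries.coeff γ F) i ≤
          (ρ : ℝ) ^ q * (ω : ℝ) ^ (r * (i : ℝ)) :=
        mul_le_mul_of_nonneg_right (absO_le ρ (hK q i γ hq1)) (rpow_pos ω _).le
      have h2 : (ω : ℝ) ^ (r * (i : ℝ)) * σ ^ (q + 1) ≤ 1 := by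
        rw [← hr, ← Real.rpow_natCast, ← Real.rpow_mul hω.le, ← Real.rpow_add hω]
        refine Real.rpow_le_one hω.le ω.2.2.le ?_
        have : (-(K * (q + 1)) : ℝ) ≤ i := by exact_mod_cast hq2
        push_cast
        nlinarith
      have h3 : (ρ : ℝ) ^ q * (ω : ℝ) ^ (r * (i : ℝ)) * σ ≤ σ ^ q := by
        calc (ρ : ℝ) ^ q * (ω : ℝ) ^ (r * (i : ℝ)) * σ =
              σ ^ q * ((ω : ℝ) ^ (r * (i : ℝ)) * σ ^ (q + 1)) := by
              rw [← hσσ, mul_pow]; ring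
          _ ≤ σ ^ q * 1 := mul_le_mul_of_nonneg_left h2 (pow_pos hσ0 q).le
          _ = σ ^ q := mul_one _
      have h4 : σ ^ q ≤ σ ^ Q := pow_le_pow_of_le_one hσ0.le hσ1.le hqQ
      have h5 : ε * σ ≤ (ρ : ℝ) ^ q * (ω : ℝ) ^ (r * (i : ℝ)) * σ :=
        mul_le_mul_of_nonneg_right (hi.trans h1) hσ0.le
      linarith
    refine ⟨hN, fun β => ?_⟩
    obtain ⟨N, hN⟩ := hN
    obtain ⟨M, hM⟩ := exists_bound ω hr0 hε
    obtain ⟨Q, hQ⟩ := exists_pow_lt_of_lt_one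
      (div_pos hε (rpow_pos ω (r * (N : ℝ)))) ρ.2.2
    refine (hfin Q M β).subset ?_
    rintro p ⟨h1, h2⟩
    refine ⟨h1, hM _ (h2.trans ?_), fun hmem => ?_⟩
    · calc _ ≤ 1 * (ω : ℝ) ^ (r * (p.1 : ℝ)) :=
            mul_le_mul_of_nonneg_right (absO_le_one _ _) (rpow_pos _ _).le
        _ = _ := one_mul _
    · have h3 : ε ≤ (ρ : ℝ) ^ Q * (ω : ℝ) ^ (r * (N : ℝ)) := by
        refine h2.trans (mul_le_mul (absO_le ρ hmem) (rpow_le ?_) (rpow_pos _ _).le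
          (pow_pos hρ Q).le)
        exact mul_le_mul_of_nonneg_left (by exact_mod_cast hN _ _ h2) hr0.le
      rw [lt_div_iff₀ (rpow_pos ω _)] at hQ
      linarith

theorem exists_dagger_term (ρ ω : Set.Ioo (0 : ℝ) 1) (a : ℤ → (Fin m ⊕ Fin n →₀ ℕ) → O) {K : ℕ}
    (hK : HasGrowth K a) (ha : IsPolyMod a) : ∃ F : dagger O ρ ω m n, term F.1 = a := by
  have hex : ∀ γ, ∃ x : BiLaurent O, ∀ i, x.coeff i = a i γ := fun γ =>
    ((BiLaurent.existsUnique fun i => a i γ).2 fun q =>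
      ⟨-(K * q : ℤ), fun i hi => hK q i γ hi⟩).exists
  choose x hx using hex
  let F : MvPowerSeries (Fin m ⊕ Fin n) (BiLaurent O) := fun γ => x γ
  have hF : term F = a := by
    ext i γ
    exact hx γ i
  exact ⟨⟨F, (mem_dagger_iff ρ ω F).2 ⟨⟨K, hF.symm ▸ hK⟩, hF.symm ▸ ha⟩⟩, hF⟩

end Terms

/-! ### The subring of integral series -/

section IntegralSeries

/-- Sums over an antidiagonal of exponents in two sets of variables. -/
theorem sum_antidiagonal_sum {α β M : Type*} [DecidableEq α] [DecidableEq β] [AddCommMonoid M]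
    (γ : α ⊕ β →₀ ℕ) (f : (α ⊕ β →₀ ℕ) × (α ⊕ β →₀ ℕ) → M) :
    ∑ p ∈ Finset.HasAntidiagonal.antidiagonal γ, f p =
      ∑ b ∈ Finset.HasAntidiagonal.antidiagonal (Finsupp.sumFinsuppAddEquivProdFinsupp γ).2,
        ∑ a ∈ Finset.HasAntidiagonal.antidiagonal (Finsupp.sumFinsuppAddEquivProdFinsupp γ).1,
          f (Finsupp.sumFinsuppAddEquivProdFinsupp.symm (a.1, b.1),
            Finsupp.sumFinsuppAddEquivProdFinsupp.symm (a.2, b.2)) := by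
  classical
  set E : (α ⊕ β →₀ ℕ) ≃+ (α →₀ ℕ) × (β →₀ ℕ) := Finsupp.sumFinsuppAddEquivProdFinsupp
  rw [← Finset.sum_product']
  refine Finset.sum_nbij'
    (fun p => (((E p.1).2, (E p.2).2), ((E p.1).1, (E p.2).1)))
    (fun q => (E.symm (q.2.1, q.1.1), E.symm (q.2.2, q.1.2))) ?_ ?_ ?_ ?_ ?_
  · rintro p hp
    rw [Finset.HasAntidiagonal.mem_antidiagonal] at hp
    simp [← hp, Finset.mem_product, Finset.HasAntidiagonal.mem_antidiagonal]
  · rintro q hq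
    rw [Finset.mem_product, Finset.HasAntidiagonal.mem_antidiagonal,
      Finset.HasAntidiagonal.mem_antidiagonal] at hq
    rw [Finset.HasAntidiagonal.mem_antidiagonal, ← map_add, Prod.mk_add_mk, hq.1, hq.2, Prod.mk.eta,
      AddEquiv.symm_apply_apply]
  · rintro p -
    simp
  · rintro q -
    simp
  · rintro p -
    simp

variable {R : Type u} [CommRing R] {m n : ℕ}

/-- The coefficients of `uncurrySeries`. -/
def uncurryFun (G : MvPowerSeries (Fin n) (PowerSeries (MvPolynomial (Fin m) R))) :
    MvPowerSeries (Fin m ⊕ Fin n) (PowerSeries R) := fun γ => PowerSeries.mk fun i =>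
  MvPolynomial.coeff (Finsupp.sumFinsuppAddEquivProdFinsupp γ).1
    (PowerSeries.coeff i (MvPowerSeries.coeff (Finsupp.sumFinsuppAddEquivProdFinsupp γ).2 G))

theorem coeff_uncurryFun (G : MvPowerSeries (Fin n) (PowerSeries (MvPolynomial (Fin m) R)))
    (γ : Fin m ⊕ Fin n →₀ ℕ) (i : ℕ) :
    PowerSeries.coeff i (MvPowerSeries.coeff γ (uncurryFun G)) =
      MvPolynomial.coeff (Finsupp.sumFinsuppAddEquivProdFinsupp γ).1 (PowerSeries.coeff i
        (MvPowerSeries.coeff (Finsupp.sumFinsuppAddEquivProdFinsupp γ).2 G)) := by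
  have : MvPowerSeries.coeff γ (uncurryFun G) = uncurryFun G γ := rfl
  rw [this, uncurryFun, PowerSeries.coeff_mk]

/-- The inclusion of `R[T]⟦π⟧⟦U⟧` into the ring of formal power series in `T` and `U`
over `R⟦π⟧`. -/
def uncurrySeries : MvPowerSeries (Fin n) (PowerSeries (MvPolynomial (Fin m) R)) →+*
    MvPowerSeries (Fin m ⊕ Fin n) (PowerSeries R) where
  toFun := uncurryFun
  map_zero' := by
    ext γ i
    simp [coeff_uncurryFun]
  map_add' G H := by
    ext γ i
    simp [coeff_uncurryFun]
  map_one' := by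
    classical
    ext γ i
    rw [coeff_uncurryFun, MvPowerSeries.coeff_one, MvPowerSeries.coeff_one]
    have : γ = 0 ↔ (Finsupp.sumFinsuppAddEquivProdFinsupp γ).1 = 0 ∧
        (Finsupp.sumFinsuppAddEquivProdFinsupp γ).2 = 0 := by
      rw [← map_eq_zero_iff _ (Finsupp.sumFinsuppAddEquivProdFinsupp (M := ℕ)
        (α := Fin m) (β := Fin n)).injective, Prod.ext_iff]
      rfl
    by_cases h2 : (Finsupp.sumFinsuppAddEquivProdFinsupp γ).2 = 0
    · by_cases h1 : (Finsupp.sumFinsuppAddEquivProdFinsupp γ).1 = 0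
      · rw [if_pos h2, if_pos (this.2 ⟨h1, h2⟩), PowerSeries.coeff_one, PowerSeries.coeff_one]
        rw [h1]
        split_ifs <;> simp
      · rw [if_pos h2, if_neg fun h => h1 (this.1 h).1, PowerSeries.coeff_one]
        split_ifs
        · rw [MvPolynomial.coeff_one, if_neg (Ne.symm h1), map_zero]
        · simp
    · rw [if_neg h2, if_neg fun h => h2 (this.1 h).2]; simp
  map_mul' G H := by
    classical
    ext γ i
    rw [coeff_uncurryFun, MvPowerSeries.coeff_mul, MvPowerSeries.coeff_mul,
      sum_antidiagonal_sum, map_sum, map_sum, MvPolynomial.coeff_sum]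
    refine Finset.sum_congr rfl fun b _ => ?_
    rw [map_sum, PowerSeries.coeff_mul, MvPolynomial.coeff_sum]
    simp only [MvPolynomial.coeff_mul, PowerSeries.coeff_mul]
    rw [Finset.sum_comm]
    refine Finset.sum_congr rfl fun a _ => Finset.sum_congr rfl fun j _ => ?_
    rw [coeff_uncurryFun, coeff_uncurryFun, AddEquiv.apply_symm_apply, AddEquiv.apply_symm_apply]

theorem coeff_uncurrySeries (G : MvPowerSeries (Fin n) (PowerSeries (MvPolynomial (Fin m) R)))
    (γ : Fin m ⊕ Fin n →₀ ℕ) (i : ℕ) :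
    PowerSeries.coeff i (MvPowerSeries.coeff γ (uncurrySeries G)) =
      MvPolynomial.coeff (Finsupp.sumFinsuppAddEquivProdFinsupp γ).1 (PowerSeries.coeff i
        (MvPowerSeries.coeff (Finsupp.sumFinsuppAddEquivProdFinsupp γ).2 G)) :=
  coeff_uncurryFun G γ i

theorem exists_uncurrySeries (a : ℕ → (Fin m ⊕ Fin n →₀ ℕ) → R)
    (ha : ∀ (i : ℕ) (β : Fin n →₀ ℕ), {γ : Fin m ⊕ Fin n →₀ ℕ |
      (∀ l, γ (Sum.inr l) = β l) ∧ a i γ ≠ 0}.Finite) :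
    ∃ G : MvPowerSeries (Fin n) (PowerSeries (MvPolynomial (Fin m) R)), ∀ i γ,
      PowerSeries.coeff i (MvPowerSeries.coeff γ (uncurrySeries G)) = a i γ := by
  set E : (Fin m ⊕ Fin n →₀ ℕ) ≃+ (Fin m →₀ ℕ) × (Fin n →₀ ℕ) :=
    Finsupp.sumFinsuppAddEquivProdFinsupp with hE
  have hfin : ∀ i β, (Function.support fun α => a i (E.symm (α, β))).Finite := fun i β => by
    refine Set.Finite.of_injOn (f := fun α => E.symm (α, β)) (fun α hα => ?_)
      (fun α _ α' _ h => (Prod.ext_iff.1 (E.symm.injective h)).1) (ha i β)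
    exact ⟨fun l => by simp [hE], hα⟩
  let G : MvPowerSeries (Fin n) (PowerSeries (MvPolynomial (Fin m) R)) :=
    fun β => PowerSeries.mk fun i =>
      AddMonoidAlgebra.ofCoeff (Finsupp.ofSupportFinite _ (hfin i β))
  refine ⟨G, fun i γ => ?_⟩
  have hG : MvPowerSeries.coeff (E γ).2 G = G (E γ).2 := rfl
  rw [coeff_uncurrySeries, ← hE, hG]
  simp only [G, PowerSeries.coeff_mk]
  show a i (E.symm ((E γ).1, (E γ).2)) = _
  rw [Prod.mk.eta, AddEquiv.symm_apply_apply]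

end IntegralSeries

/-! ### The ring `𝔬[T]⟦π⟧⟦U⟧` inside the overconvergent series -/

section IntegralDagger

variable {O : Type u} [CommRing O] {m n : ℕ}

section

variable [IsLocalRing O]

variable (O) in
/-- The inclusion of `𝔬⟦π⟧`. -/
def powerSeriesToBi : PowerSeries O →+* BiLaurent O :=
  RingHom.codRestrict (RingHom.pi fun n => (HahnSeries.ofPowerSeries ℤ _).comp
    (PowerSeries.map (Ideal.Quotient.mk (maximalIdeal O ^ n)))) (biLaurentRing O) (by
      intro f n
      ext i
      show Ideal.Quotient.factorPow (maximalIdeal O) n.le_succ ((HahnSeries.ofPowerSeries ℤ _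
        (PowerSeries.map (Ideal.Quotient.mk (maximalIdeal O ^ (n + 1))) f)).coeff i) =
        (HahnSeries.ofPowerSeries ℤ _
        (PowerSeries.map (Ideal.Quotient.mk (maximalIdeal O ^ n)) f)).coeff i
      rw [PowerSeries.coeff_coe, PowerSeries.coeff_coe]
      split_ifs
      · exact map_zero _
      · rw [PowerSeries.coeff_map, PowerSeries.coeff_map]
        rfl)

end

section

variable [IsLocalRing O] [IsAdicComplete (maximalIdeal O) O]

theorem coeff_powerSeriesToBi (f : PowerSeries O) (i : ℤ) :
    (powerSeriesToBi O f).coeff i = if i < 0 then 0 else PowerSeries.coeff i.natAbs f :=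
  eq_of_mk_eq fun n => by
    rw [BiLaurent.mk_coeff]
    show (HahnSeries.ofPowerSeries ℤ _
        (PowerSeries.map (Ideal.Quotient.mk (maximalIdeal O ^ n)) f)).coeff i = _
    rw [PowerSeries.coeff_coe]
    split_ifs
    · exact (map_zero _).symm
    · rw [PowerSeries.coeff_map]

end

variable [IsDomain O] [IsDiscreteValuationRing O] [IsAdicComplete (maximalIdeal O) O]

theorem term_map_powerSeriesToBi (F : MvPowerSeries (Fin m ⊕ Fin n) (PowerSeries O)) (i : ℤ) (γ) :
    term (MvPowerSeries.map (powerSeriesToBi O) F) i γ =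
      if i < 0 then 0 else PowerSeries.coeff i.natAbs (MvPowerSeries.coeff γ F) := by
  rw [term, MvPowerSeries.coeff_map, coeff_powerSeriesToBi]

theorem map_uncurrySeries_mem (ρ ω : Set.Ioo (0 : ℝ) 1)
    (G : MvPowerSeries (Fin n) (PowerSeries (MvPolynomial (Fin m) O))) :
    MvPowerSeries.map (powerSeriesToBi O) (uncurrySeries G) ∈ dagger O ρ ω m n := by
  classical
  refine (mem_dagger_iff ρ ω _).2 ⟨⟨0, fun q i γ hi => ?_⟩, fun N M β => ?_⟩
  · rw [term_map_powerSeriesToBi, if_pos (by simpa using hi)]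
    exact zero_mem _
  · let E : (Fin m ⊕ Fin n →₀ ℕ) ≃+ (Fin m →₀ ℕ) × (Fin n →₀ ℕ) :=
      Finsupp.sumFinsuppAddEquivProdFinsupp
    let β' : Fin n →₀ ℕ := Finsupp.equivFunOnFinite.symm β
    have hfin : (⋃ i ∈ Finset.Icc 0 M, (fun α => (i, E.symm (α, β'))) ''
        ((PowerSeries.coeff i.natAbs (MvPowerSeries.coeff β' G)).support : Set (Fin m →₀ ℕ))).Finite :=
      (Finset.Icc 0 M).finite_toSet.biUnion fun i _ => (Finset.finite_toSet _).image _
    refine hfin.subset ?_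
    rintro ⟨i, γ⟩ ⟨h1, h2, h3⟩
    have hβ : (E γ).2 = β' := by ext l; exact h1 l
    have h4 : term (MvPowerSeries.map (powerSeriesToBi O) (uncurrySeries G)) i γ ≠ 0 :=
      fun h0 => h3 (by simp only [h0]; exact zero_mem _)
    rw [term_map_powerSeriesToBi, coeff_uncurrySeries] at h4
    by_cases hi : i < 0
    · exact absurd (if_pos hi) h4
    rw [if_neg hi] at h4
    simp only [Set.mem_iUnion]
    refine ⟨i, Finset.mem_Icc.2 ⟨not_lt.1 hi, h2⟩, (E γ).1, ?_, ?_⟩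
    · rw [Finset.mem_coe, MvPolynomial.mem_support_iff, ← hβ]
      exact h4
    · simp only [← hβ, Prod.mk.eta, AddEquiv.symm_apply_apply]

instance (ρ ω : Set.Ioo (0 : ℝ) 1) : CommRing (dagger O ρ ω m n) := Subalgebra.toCommRing _

variable (O) in
/-- The inclusion of `𝔬[T]⟦π⟧⟦U⟧`. -/
def integralToDagger (ρ ω : Set.Ioo (0 : ℝ) 1) (m n : ℕ) :
    MvPowerSeries (Fin n) (PowerSeries (MvPolynomial (Fin m) O)) →+* dagger O ρ ω m n :=
  RingHom.codRestrict ((MvPowerSeries.map (powerSeriesToBi O)).comp uncurrySeries)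
    (dagger O ρ ω m n) (map_uncurrySeries_mem ρ ω)

variable (O) in
/-- The subring `𝔬[T]⟦π⟧⟦U⟧`. -/
def integralSubring (ρ ω : Set.Ioo (0 : ℝ) 1) (m n : ℕ) : Subring (dagger O ρ ω m n) :=
  (integralToDagger O ρ ω m n).range

/-- Here finiteness must hold exactly and not just modulo powers of `𝔪`, since the coefficients are
polynomials in `T`. -/
theorem mem_integralSubring {ρ ω : Set.Ioo (0 : ℝ) 1} {F : dagger O ρ ω m n}
    (h0 : ∀ i γ, i < 0 → term F.1 i γ = 0)
    (h1 : ∀ (M : ℤ) (β : Fin n → ℕ), {p : ℤ × (Fin m ⊕ Fin n →₀ ℕ) |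
      (∀ l, p.2 (Sum.inr l) = β l) ∧ p.1 ≤ M ∧ term F.1 p.1 p.2 ≠ 0}.Finite) :
    F ∈ integralSubring O ρ ω m n := by
  obtain ⟨G, hG⟩ := exists_uncurrySeries (m := m) (n := n) (fun i γ => term F.1 (i : ℤ) γ)
    fun i β => by
      refine Set.Finite.of_injOn (f := fun γ => ((i : ℤ), γ)) ?_ (fun γ _ γ' _ h => by simpa using h)
        (h1 i β)
      rintro γ ⟨h2, h3⟩
      exact ⟨h2, le_rfl, h3⟩
  refine ⟨G, Subtype.ext (term_ext fun i γ => ?_)⟩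
  show term (MvPowerSeries.map (powerSeriesToBi O) (uncurrySeries G)) i γ = _
  rw [term_map_powerSeriesToBi]
  split_ifs with hi
  · exact (h0 i γ hi).symm
  · rw [hG, Int.natAbs_of_nonneg (not_lt.1 hi)]

theorem term_of_mem_integralSubring {ρ ω : Set.Ioo (0 : ℝ) 1} {F : dagger O ρ ω m n}
    (hF : F ∈ integralSubring O ρ ω m n) {i : ℤ} (hi : i < 0) (γ) : term F.1 i γ = 0 := by
  obtain ⟨G, rfl⟩ := hF
  exact (term_map_powerSeriesToBi _ i γ).trans (if_pos hi)

theorem isNoetherianRing_integralSubring (ρ ω : Set.Ioo (0 : ℝ) 1) :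
    IsNoetherianRing (integralSubring O ρ ω m n) :=
  isNoetherianRing_range (integralToDagger O ρ ω m n)

/-- The monomial `π^j`. -/
def daggerMonomial (ρ ω : Set.Ioo (0 : ℝ) 1) (m n : ℕ) (j : ℤ) : dagger O ρ ω m n :=
  ⟨MvPowerSeries.C (biMonomial O j), by
    have hterm : ∀ i γ, term (MvPowerSeries.C (biMonomial O j) :
        MvPowerSeries (Fin m ⊕ Fin n) (BiLaurent O)) i γ = if γ = 0 ∧ i = j then 1 else 0 := by
      classical
      intro i γ
      rw [term, MvPowerSeries.coeff_C]
      split_ifs with h1 h2 h2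
      · rw [BiLaurent.coeff_biMonomial, if_pos h2.2]
      · rw [BiLaurent.coeff_biMonomial, if_neg fun h => h2 ⟨h1, h⟩]
      · exact absurd h2.1 h1
      · exact BiLaurent.coeff_zero i
    refine (mem_dagger_iff ρ ω _).2 ⟨⟨j.natAbs, fun q i γ hi => ?_⟩, fun N M β => ?_⟩
    · rw [hterm]
      split_ifs with h
      · obtain ⟨-, rfl⟩ := h
        cases q with
        | zero => simp
        | succ q =>
          exfalso
          have h1 : (0 : ℤ) ≤ i.natAbs * q := by positivity
          have h2 : -i ≤ (i.natAbs : ℤ) := by omega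
          rw [Nat.cast_succ, mul_add, mul_one] at hi
          linarith
      · exact zero_mem _
    · refine (Set.finite_singleton (j, (0 : Fin m ⊕ Fin n →₀ ℕ))).subset ?_
      rintro ⟨i, γ⟩ ⟨-, -, h⟩
      by_contra hne
      refine h ?_
      rw [hterm, if_neg fun h' => hne (Prod.ext h'.2 h'.1)]
      exact zero_mem _⟩

theorem daggerMonomial_mul (ρ ω : Set.Ioo (0 : ℝ) 1) (i j : ℤ) :
    daggerMonomial ρ ω m n i * daggerMonomial ρ ω m n j =
      (daggerMonomial ρ ω m n (i + j) : dagger O ρ ω m n) :=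
  Subtype.ext (by
    show MvPowerSeries.C _ * MvPowerSeries.C _ = MvPowerSeries.C _
    rw [← map_mul, biMonomial_mul])

theorem daggerMonomial_zero (ρ ω : Set.Ioo (0 : ℝ) 1) :
    (daggerMonomial ρ ω m n 0 : dagger O ρ ω m n) = 1 := rfl

theorem daggerMonomial_pow (ρ ω : Set.Ioo (0 : ℝ) 1) (i : ℤ) (k : ℕ) :
    (daggerMonomial ρ ω m n i : dagger O ρ ω m n) ^ k = daggerMonomial ρ ω m n (k * i) :=
  Subtype.ext (by
    show MvPowerSeries.C _ ^ k = MvPowerSeries.C _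
    rw [← map_pow, biMonomial_pow])

theorem term_daggerMonomial_mul {ρ ω : Set.Ioo (0 : ℝ) 1} (j : ℤ) (F : dagger O ρ ω m n) (i : ℤ)
    (γ) : term (daggerMonomial ρ ω m n j * F).1 i γ = term F.1 (i - j) γ :=
  term_monomial_mul j F.1 i γ

theorem term_algebraMap_mul' {ρ ω : Set.Ioo (0 : ℝ) 1} (a : O) (F : dagger O ρ ω m n) (i : ℤ)
    (γ) : term (algebraMap O (dagger O ρ ω m n) a * F).1 i γ = a * term F.1 i γ :=
  term_algebraMap_mul a F.1 i γ

theorem dagger_ext {ρ ω : Set.Ioo (0 : ℝ) 1} {F G : dagger O ρ ω m n}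
    (h : ∀ i γ, term F.1 i γ = term G.1 i γ) : F = G :=
  Subtype.ext (term_ext h)

theorem integralToDagger_X (ρ ω : Set.Ioo (0 : ℝ) 1) :
    integralToDagger O ρ ω m n (MvPowerSeries.C PowerSeries.X) = daggerMonomial ρ ω m n 1 := by
  classical
  refine dagger_ext fun i γ => ?_
  rw [← mul_one (daggerMonomial ρ ω m n 1), term_daggerMonomial_mul]
  have h1 : term (1 : dagger O ρ ω m n).1 (i - 1) γ = if γ = 0 then (if i - 1 = 0 then 1 else 0)
      else 0 := by
    show (MvPowerSeries.coeff γ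
      (1 : MvPowerSeries (Fin m ⊕ Fin n) (BiLaurent O))).coeff (i - 1) = _
    rw [MvPowerSeries.coeff_one]
    split_ifs with h2 h3
    · rw [← map_one (algebraMap O _), BiLaurent.coeff_algebraMap, if_pos h3]
    · rw [← map_one (algebraMap O _), BiLaurent.coeff_algebraMap, if_neg h3]
    · exact BiLaurent.coeff_zero _
  rw [h1]
  refine (term_map_powerSeriesToBi _ i γ).trans ?_
  rw [coeff_uncurrySeries, MvPowerSeries.coeff_C]
  have : γ = 0 ↔ (Finsupp.sumFinsuppAddEquivProdFinsupp γ).1 = 0 ∧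
      (Finsupp.sumFinsuppAddEquivProdFinsupp γ).2 = 0 := by
    rw [← map_eq_zero_iff _ (Finsupp.sumFinsuppAddEquivProdFinsupp (M := ℕ)
      (α := Fin m) (β := Fin n)).injective, Prod.ext_iff]
    rfl
  simp only [this]
  generalize (Finsupp.sumFinsuppAddEquivProdFinsupp γ).1 = α
  generalize (Finsupp.sumFinsuppAddEquivProdFinsupp γ).2 = β
  have h3 : PowerSeries.coeff i.natAbs (PowerSeries.X : PowerSeries (MvPolynomial (Fin m) O)) =
      if i.natAbs = 1 then 1 else 0 := PowerSeries.coeff_X _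
  by_cases h2 : β = 0
  · rw [if_pos h2, h3]
    simp only [h2, and_true]
    by_cases hi : i = 1
    · subst hi
      simp [MvPolynomial.coeff_one, eq_comm]
    · have h4 : i - 1 ≠ 0 := by omega
      rw [if_neg h4, ite_self]
      split_ifs with h5 h6
      · rfl
      · omega
      · simp
  · rw [if_neg h2, if_neg fun h : α = 0 ∧ β = 0 => h2 h.2]
    simp

end IntegralDagger

/-! ### Expansions of overconvergent series in integral series -/

section AdicSum

variable {O : Type u} [CommRing O]

/-- `L b` is the sum `∑ ϖ^j b_j`. A single choice of `L` with its shift equation turns the summation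
of series into an instance of `IsSeriesSum.of_step`. -/
theorem exists_adicSum [IsLocalRing O] [IsAdicComplete (maximalIdeal O) O] {ϖ : O} (hϖ : ϖ ∈ maximalIdeal O) :
    ∃ L : (ℕ → O) → O, ∀ b, L b = b 0 + ϖ * L (fun j => b (j + 1)) := by
  have hex : ∀ b : ℕ → O, ∃ s, ∀ n, s - ∑ j ∈ Finset.range n, ϖ ^ j * b j ∈ maximalIdeal O ^ n := by
    intro b
    obtain ⟨s, hs⟩ := IsPrecomplete.prec' (I := maximalIdeal O) (M := O)
      (fun n => ∑ j ∈ Finset.range n, ϖ ^ j * b j) (by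
        intro k l hkl
        rw [SModEq.sub_mem, smul_eq_mul, Ideal.mul_top, ← neg_mem_iff, neg_sub,
          ← Finset.sum_range_add_sum_Ico _ hkl, add_sub_cancel_left]
        exact sum_mem fun j hj => Ideal.mul_mem_right _ _
          (Ideal.pow_le_pow_right (Finset.mem_Ico.1 hj).1 (Ideal.pow_mem_pow hϖ j)))
    refine ⟨s, fun n => ?_⟩
    have := hs n
    rwa [SModEq.sub_mem, smul_eq_mul, Ideal.mul_top, ← neg_mem_iff, neg_sub] at this
  choose L hL using hex
  refine ⟨L, fun b => eq_of_mk_eq fun n => Ideal.Quotient.eq.2 ?_⟩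
  have h1 := Ideal.pow_le_pow_right n.le_succ (hL b (n + 1))
  have h2 := Ideal.mul_mem_left _ ϖ (hL (fun j => b (j + 1)) n)
  convert sub_mem h1 h2 using 1
  rw [Finset.sum_range_succ', mul_sub, Finset.mul_sum]
  simp only [pow_succ', pow_zero, one_mul, mul_assoc]
  ring

theorem adicSum_eq {ϖ : O} {L : (ℕ → O) → O}
    (hL : ∀ b, L b = b 0 + ϖ * L (fun j => b (j + 1))) (b : ℕ → O) (N : ℕ) :
    L b = ∑ j ∈ Finset.range N, ϖ ^ j * b j + ϖ ^ N * L (fun j => b (j + N)) := by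
  induction N with
  | zero => simp
  | succ N ih =>
    rw [ih, hL (fun j => b (j + N)), Finset.sum_range_succ, zero_add, pow_succ]
    simp only [add_right_comm _ 1 N, add_assoc]
    ring

theorem adicSum_mem [IsLocalRing O] {ϖ : O} (hϖ : ϖ ∈ maximalIdeal O) {L : (ℕ → O) → O}
    (hL : ∀ b, L b = b 0 + ϖ * L (fun j => b (j + 1))) (b : ℕ → O) (N : ℕ)
    (hb : ∀ j < N, b j ∈ maximalIdeal O ^ N) : L b ∈ maximalIdeal O ^ N := by
  rw [adicSum_eq hL b N]
  exact add_mem (sum_mem fun j hj => Ideal.mul_mem_left _ _ (hb j (Finset.mem_range.1 hj)))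
    (Ideal.mul_mem_right _ _ (Ideal.pow_mem_pow hϖ N))

end AdicSum

section DaggerGrowth

variable {O : Type u} [CommRing O] [IsDomain O] [IsDiscreteValuationRing O] {m n : ℕ}

theorem IsPolyMod.shift {a : ℤ → (Fin m ⊕ Fin n →₀ ℕ) → O} (ha : IsPolyMod a) (c : ℤ) :
    IsPolyMod fun i γ => a (i + c) γ := fun N M β => by
  refine Set.Finite.of_injOn (f := fun p => (p.1 + c, p.2)) ?_ ?_ (ha N (M + c) β)
  · rintro ⟨i, γ⟩ ⟨h1, h2, h3⟩
    exact ⟨h1, add_le_add_left h2 c, h3⟩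
  · rintro ⟨i, γ⟩ - ⟨i', γ'⟩ - h
    simpa using h

theorem irreducible_mul_mem {ϖ : O} (hϖ : Irreducible ϖ) {a : O} {N : ℕ} :
    ϖ * a ∈ maximalIdeal O ^ (N + 1) ↔ a ∈ maximalIdeal O ^ N := by
  rw [hϖ.maximalIdeal_eq, Ideal.span_singleton_pow, Ideal.span_singleton_pow,
    Ideal.mem_span_singleton, Ideal.mem_span_singleton, pow_succ',
    mul_dvd_mul_iff_left hϖ.ne_zero]

variable [IsAdicComplete (maximalIdeal O) O] {ρ ω : Set.Ioo (0 : ℝ) 1}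

theorem term_step (ϖ : O) (K : ℕ) (F : dagger O ρ ω m n) (i : ℤ) (γ) :
    term (algebraMap O (dagger O ρ ω m n) ϖ * daggerMonomial ρ ω m n (-1) ^ K * F).1 i γ =
      ϖ * term F.1 (i + K) γ := by
  rw [mul_assoc, term_algebraMap_mul', daggerMonomial_pow, term_daggerMonomial_mul, mul_neg_one,
    sub_neg_eq_add]

theorem term_add' (F G : dagger O ρ ω m n) (i : ℤ) (γ) :
    term (F + G).1 i γ = term F.1 i γ + term G.1 i γ :=
  term_add F.1 G.1 i γ

theorem exists_integral_sum {ϖ : O} (hϖ : ϖ ∈ maximalIdeal O) (K : ℕ) (v : ℕ → dagger O ρ ω m n)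
    (hv : ∀ j, v j ∈ integralSubring O ρ ω m n) :
    ∃ s, IsSeriesSum (algebraMap O (dagger O ρ ω m n) ϖ * daggerMonomial ρ ω m n (-1) ^ K) v s := by
  obtain ⟨L, hL⟩ := exists_adicSum hϖ
  -- This is the remainder `∑_j (ϖ π^{-K})^j v_{k+j}`. For an exponent below `-Kq` the first `q`
  -- summands vanish, as the `v_j` have no negative exponents; this is the growth condition.
  have hex : ∀ k, ∃ F : dagger O ρ ω m n, term F.1 = fun i γ =>
      L fun j => term (v (k + j)).1 (i + K * j) γ := by
    intro k
    refine exists_dagger_term ρ ω _ (K := K) (fun q i γ hi => ?_) (fun N M β => ?_)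
    · refine adicSum_mem hϖ hL _ q fun j hj => ?_
      rw [term_of_mem_integralSubring (hv _)]
      · exact zero_mem _
      · have h1 : (K : ℤ) * j ≤ K * q :=
          mul_le_mul_of_nonneg_left (by exact_mod_cast hj.le) (Int.natCast_nonneg K)
        linarith
    · have hfin : (⋃ j ∈ Finset.range N, {p : ℤ × (Fin m ⊕ Fin n →₀ ℕ) |
          (∀ l, p.2 (Sum.inr l) = β l) ∧ p.1 ≤ M ∧
            term (v (k + j)).1 (p.1 + K * j) p.2 ∉ maximalIdeal O ^ N}).Finite :=
        (Finset.range N).finite_toSet.biUnion fun j _ =>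
          ((((mem_dagger_iff ρ ω _).1 (v (k + j)).2).2).shift (K * j)) N M β
      refine hfin.subset ?_
      rintro p ⟨h1, h2, h3⟩
      by_contra hcon
      simp only [Set.mem_iUnion, not_exists] at hcon
      refine h3 (adicSum_mem hϖ hL _ N fun j hj => ?_)
      by_contra h4
      exact hcon j (Finset.mem_range.2 hj) ⟨h1, h2, h4⟩
  choose y hy using hex
  refine ⟨y 0, IsSeriesSum.of_step fun k => dagger_ext fun i γ => ?_⟩
  simp only [term_add', term_step, hy]
  rw [hL]
  congr 1
  · simp
  · congr 2
    ext j
    rw [add_assoc, add_assoc, add_comm 1 j]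
    congr 1
    push_cast
    ring

theorem exists_integral_expansion {ϖ : O} (hϖ : Irreducible ϖ) (s : dagger O ρ ω m n) :
    ∃ (K : ℕ) (v : ℕ → dagger O ρ ω m n), (∀ j, v j ∈ integralSubring O ρ ω m n) ∧
      IsSeriesSum (algebraMap O (dagger O ρ ω m n) ϖ * daggerMonomial ρ ω m n (-1) ^ K) v
        (daggerMonomial ρ ω m n 1 ^ K * s) := by
  classical
  obtain ⟨K, hK⟩ := ((mem_dagger_iff ρ ω s.1).1 s.2).1
  -- The extra power `𝔪^(q+1)` is provided by the factor `π^K`. For `q = 0` it makes the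
  -- coefficients at negative exponents vanish modulo `𝔪`, so that the first digit is integral.
  refine ⟨K, GrowthRing.subset_of_step {G : dagger O ρ ω m n | ∀ (q : ℕ) (i : ℤ) (γ), i < -(K * q : ℤ) →
    term G.1 i γ ∈ maximalIdeal O ^ (q + 1)} ?_ _ ?_⟩
  · intro G hG
    -- A coefficient outside `𝔪` is taken whole as a digit, and one in `𝔪` has digit zero. Thus
    -- nonzero digits occur only at terms that are nonzero modulo `𝔪`, and the digit series is
    -- polynomial in `T` as required.
    have hdig : ∀ a : O, ∃ x y : O, a = x + ϖ * y ∧ (a ∈ maximalIdeal O → x = 0) ∧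
        ∀ N, a ∈ maximalIdeal O ^ (N + 1) → y ∈ maximalIdeal O ^ N := by
      intro a
      by_cases ha : a ∈ maximalIdeal O
      · have ha' := ha
        rw [hϖ.maximalIdeal_eq, Ideal.mem_span_singleton] at ha'
        obtain ⟨y, rfl⟩ := ha'
        exact ⟨0, y, (zero_add _).symm, fun _ => rfl, fun N h => (irreducible_mul_mem hϖ).1 h⟩
      · exact ⟨a, 0, by ring, fun h => absurd h ha, fun _ _ => zero_mem _⟩
    choose x y hxy hx hy using hdig
    have hG2 : IsPolyMod (term G.1) := ((mem_dagger_iff ρ ω G.1).1 G.2).2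
    have hfin : ∀ (M : ℤ) (β : Fin n → ℕ), {p : ℤ × (Fin m ⊕ Fin n →₀ ℕ) |
        (∀ l, p.2 (Sum.inr l) = β l) ∧ p.1 ≤ M ∧ x (term G.1 p.1 p.2) ≠ 0}.Finite := by
      intro M β
      refine (hG2 1 M β).subset ?_
      rintro p ⟨h1, h2, h3⟩
      exact ⟨h1, h2, fun h => h3 (hx _ (by rwa [pow_one] at h))⟩
    have hneg : ∀ (i : ℤ) (γ), i < 0 → x (term G.1 i γ) = 0 := fun i γ hi =>
      hx _ (by simpa using hG 0 i γ (by simpa using hi))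
    obtain ⟨l, hl⟩ := exists_dagger_term ρ ω (fun i γ => x (term G.1 i γ)) (K := 0)
      (fun q i γ hi => by
        simp only [hneg i γ (by simpa using hi)]
        exact zero_mem _)
      (fun N M β => (hfin M β).subset fun p hp =>
        ⟨hp.1, hp.2.1, fun h => hp.2.2 (by simp only [h]; exact zero_mem _)⟩)
    have hGK : ∀ (q : ℕ) (i : ℤ) (γ), i < -(K * q : ℤ) →
        y (term G.1 (i + -K) γ) ∈ maximalIdeal O ^ (q + 1) := fun q i γ hi =>
      hy _ _ (hG (q + 1) _ γ (by push_cast; linarith))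
    obtain ⟨G', hG'⟩ := exists_dagger_term ρ ω (fun i γ => y (term G.1 (i + -K) γ)) (K := K)
      (fun q i γ hi => Ideal.pow_le_pow_right q.le_succ (hGK q i γ hi))
      (fun N M β => ((hG2.shift (-K)) (N + 1) M β).subset fun p hp =>
        ⟨hp.1, hp.2.1, fun h => hp.2.2 (hy _ _ h)⟩)
    refine ⟨l, mem_integralSubring (fun i γ hi => ?_) (fun M β => ?_), G', ?_,
      dagger_ext fun i γ => ?_⟩
    · rw [hl]; exact hneg i γ hi
    · rw [hl]; exact hfin M β
    · intro q i γ hi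
      rw [hG']; exact hGK q i γ hi
    · rw [term_add', term_step, hl, hG']
      simpa using hxy (term G.1 i γ)
  · intro q i γ hi
    rw [daggerMonomial_pow, term_daggerMonomial_mul]
    exact hK _ _ _ (by push_cast; linarith)

theorem exists_series_sum {R : Type u} [CommRing R]
    (G : ℕ → MvPowerSeries (Fin n) (PowerSeries R)) :
    ∃ s, ∀ k, ∃ r, s - ∑ j ∈ Finset.range k, MvPowerSeries.C PowerSeries.X ^ j * G j =
      MvPowerSeries.C PowerSeries.X ^ k * r := by
  -- The remainder `∑_j X^j G_{k+j}`, whose coefficients are finite sums.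
  let y : ℕ → MvPowerSeries (Fin n) (PowerSeries R) := fun k β => PowerSeries.mk fun i =>
    ∑ j ∈ Finset.range (i + 1), PowerSeries.coeff (i - j) (MvPowerSeries.coeff β (G (k + j)))
  have hy : ∀ k β i, PowerSeries.coeff i (MvPowerSeries.coeff β (y k)) = ∑ j ∈ Finset.range (i + 1),
      PowerSeries.coeff (i - j) (MvPowerSeries.coeff β (G (k + j))) := fun k β i => by
    have : MvPowerSeries.coeff β (y k) = y k β := rfl
    rw [this, PowerSeries.coeff_mk]
  refine ⟨y 0, IsSeriesSum.of_step fun k => ?_⟩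
  ext β i
  rw [map_add, map_add, hy, MvPowerSeries.coeff_C_mul, Finset.sum_range_succ', add_comm]
  congr 1
  cases i with
  | zero => simp
  | succ i =>
    rw [PowerSeries.coeff_succ_X_mul, hy]
    refine Finset.sum_congr rfl fun j _ => ?_
    rw [Nat.add_sub_add_right, add_assoc, add_comm 1 j]

theorem isUnit_one_add_X_mul {R : Type u} [CommRing R] (G : MvPowerSeries (Fin n) (PowerSeries R)) :
    IsUnit (1 + MvPowerSeries.C PowerSeries.X * G) := by
  rw [MvPowerSeries.isUnit_iff_constantCoeff, PowerSeries.isUnit_iff_constantCoeff]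
  simp

theorem growthRing_dagger {ϖ : O} (hϖ : Irreducible ϖ) :
    GrowthRing (integralSubring O ρ ω m n) (algebraMap O (dagger O ρ ω m n) ϖ)
      (daggerMonomial ρ ω m n 1) (daggerMonomial ρ ω m n (-1)) where
  noeth := isNoetherianRing_integralSubring ρ ω
  pi_mem := ⟨_, integralToDagger_X ρ ω⟩
  pi_mul := by rw [daggerMonomial_mul, add_neg_cancel, daggerMonomial_zero]
  regular x hx := dagger_ext fun i γ => by
    have h1 := term_algebraMap_mul' ϖ x i γ
    rw [hx] at h1
    have h2 : term (0 : dagger O ρ ω m n).1 i γ = 0 := term_zero i γ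
    rw [h2] at h1 ⊢
    exact (mul_eq_zero.1 h1.symm).resolve_left hϖ.ne_zero
  separated x hx := dagger_ext fun i γ => by
    have h2 : term (0 : dagger O ρ ω m n).1 i γ = 0 := term_zero i γ
    rw [h2]
    refine IsHausdorff.haus' (I := maximalIdeal O) _ fun k => ?_
    rw [SModEq.sub_mem, smul_eq_mul, Ideal.mul_top, sub_zero]
    obtain ⟨y, rfl⟩ := hx k
    rw [← map_pow, term_algebraMap_mul']
    exact Ideal.mul_mem_right _ _ (Ideal.pow_mem_pow
      ((mem_maximalIdeal _).2 hϖ.not_isUnit) k)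
  exists_sum K v hv := exists_integral_sum ((mem_maximalIdeal _).2 hϖ.not_isUnit) K v hv
  exists_expansion s := exists_integral_expansion hϖ s
  complete_pi v hv := by
    choose G hG using hv
    obtain ⟨s, hs⟩ := exists_series_sum G
    refine ⟨integralToDagger O ρ ω m n s, ⟨s, rfl⟩, fun k => ?_⟩
    obtain ⟨r, hr⟩ := hs k
    refine ⟨integralToDagger O ρ ω m n r, ⟨r, rfl⟩, ?_⟩
    have := congrArg (integralToDagger O ρ ω m n) hr
    simpa only [map_sub, map_sum, map_mul, map_pow, integralToDagger_X, hG] using this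
  isUnit_pi v hv := by
    obtain ⟨G, rfl⟩ := hv
    obtain ⟨G', hG'⟩ := (isUnit_one_add_X_mul G).exists_right_inv
    refine ⟨integralToDagger O ρ ω m n G', ⟨G', rfl⟩, ?_⟩
    have := congrArg (integralToDagger O ρ ω m n) hG'
    simpa only [map_add, map_mul, map_one, integralToDagger_X] using this

end DaggerGrowth

/-! ### Homomorphisms between dagger lifts -/

/-- A relation in `M` modulo `t` lifts a relation in the flat algebra `B`. -/
theorem exists_relation_of_flat_quotient {R : Type u} {M : Type v} {A : Type u'} {B : Type v'}
    [CommRing R] [CommRing M] [CommRing A] [CommRing B] [Algebra R M] [Algebra A B]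
    [Module.Flat A B] {q₁ : R →+* A} {q₂ : M →+* B} {t : R}
    (hq₁ : Function.Surjective q₁) (hq₂ : Function.Surjective q₂)
    (hk₁ : ∀ x, q₁ x = 0 ↔ t ∣ x) (hk₂ : ∀ x, q₂ x = 0 ↔ algebraMap R M t ∣ x)
    (hmap : ∀ x, q₂ (algebraMap R M x) = algebraMap A B (q₁ x)) {ι : Type} [Fintype ι]
    (a : ι → R) (y : ι → M) (hy : algebraMap R M t ∣ ∑ i, algebraMap R M (a i) * y i) :
    ∃ (κ : Type) (_ : Fintype κ) (c : ι → κ → R) (z : κ → M),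
      (∀ i, algebraMap R M t ∣ y i - ∑ j, algebraMap R M (c i j) * z j) ∧
        ∀ j, t ∣ ∑ i, a i * c i j := by
  have hrel : ∑ i, q₁ (a i) • q₂ (y i) = 0 := by
    rw [← (hk₂ _).2 hy, map_sum]
    exact Finset.sum_congr rfl fun i _ => by rw [map_mul, hmap, Algebra.smul_def]
  obtain ⟨k, c, z, hz, hc⟩ := Module.Flat.isTrivialRelation_of_sum_smul_eq_zero
    (R := A) (M := B) (f := fun i => q₁ (a i)) (x := fun i => q₂ (y i)) hrel
  simp only at hz hc
  choose c' hc' using fun i j => hq₁ (c i j)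
  choose z' hz' using fun j => hq₂ (z j)
  refine ⟨Fin k, inferInstance, c', z', fun i => (hk₂ _).1 ?_, fun j => (hk₁ _).1 ?_⟩
  · rw [map_sub, hz, map_sum, sub_eq_zero]
    exact Finset.sum_congr rfl fun j _ => by rw [map_mul, hmap, hz', hc', Algebra.smul_def]
  · rw [map_sum, ← hc j]
    exact Finset.sum_congr rfl fun i _ => by rw [map_mul, hc']

namespace GrowthRing

section Lift

variable {S₁ : Type u} {S₂ : Type v} {A₁ : Type u'} {A₂ : Type v'} [CommRing S₁] [CommRing S₂]
  [CommRing A₁] [CommRing A₂] {V₁ : Subring S₁} {V₂ : Subring S₂} {t π₁ e₁ : S₁} {π₂ e₂ : S₂}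
  {g : S₁ →+* S₂} {q₁ : S₁ →+* A₁} {q₂ : S₂ →+* A₂} {gbar : A₁ →+* A₂}

theorem injective_of_mod (h₁ : GrowthRing V₁ t π₁ e₁) (h₂ : GrowthRing V₂ (g t) π₂ e₂)
    (hk₁ : ∀ x, q₁ x = 0 ↔ t ∣ x) (hred : ∀ x, gbar (q₁ x) = q₂ (g x))
    (hg : Function.Injective gbar) :
    Function.Injective g := by
  have hreg : ∀ (n : ℕ) (x : S₂), g t ^ n * x = 0 → x = 0 := by
    intro n
    induction n with
    | zero => intro x hx; simpa using hx
    | succ n ih => exact fun x hx => ih x (h₂.regular _ (by rw [← mul_assoc, ← pow_succ', hx]))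
  refine (injective_iff_map_eq_zero g).2 fun x hx => h₁.separated x fun n => ?_
  induction n with
  | zero => simp
  | succ n ih =>
    obtain ⟨y, rfl⟩ := ih
    have hy : g y = 0 := hreg n _ (by rw [← map_pow, ← map_mul, hx])
    have : q₁ y = 0 := (injective_iff_map_eq_zero gbar).1 hg _ (by rw [hred, hy, map_zero])
    rw [pow_succ]
    exact mul_dvd_mul_left _ ((hk₁ y).1 this)

theorem surjective_of_mod (h₁ : GrowthRing V₁ t π₁ e₁) (h₂ : GrowthRing V₂ (g t) π₂ e₂)
    (hq₁ : Function.Surjective q₁) (hk₂ : ∀ x, q₂ x = 0 ↔ g t ∣ x)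
    (hred : ∀ x, gbar (q₁ x) = q₂ (g x)) (hg : Function.Surjective gbar) :
    Function.Surjective g := by
  intro s
  obtain ⟨x, hx⟩ := h₁.exists_sum_eq_of_mod g h₂ (fun _ : Unit => (1 : S₂)) (fun s => by
    obtain ⟨a, ha⟩ := hg (q₂ s)
    obtain ⟨x, rfl⟩ := hq₁ a
    refine ⟨fun _ => x, (hk₂ _).1 ?_⟩
    simp [← ha, hred]) s
  exact ⟨x (), by simpa using hx.symm⟩

theorem finite_of_mod (h₁ : GrowthRing V₁ t π₁ e₁) (h₂ : GrowthRing V₂ (g t) π₂ e₂)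
    (hq₁ : Function.Surjective q₁) (hq₂ : Function.Surjective q₂) (hk₂ : ∀ x, q₂ x = 0 ↔ g t ∣ x)
    (hred : ∀ x, gbar (q₁ x) = q₂ (g x)) (hg : gbar.Finite) : g.Finite := by
  algebraize [gbar, g]
  obtain ⟨n, b, hb⟩ := Module.Finite.exists_fin (R := A₁) (M := A₂)
  choose b' hb' using fun i => hq₂ (b i)
  have hspan : ∀ s, ∃ x : Fin n → S₁, s = ∑ i, g (x i) * b' i :=
    h₁.exists_sum_eq_of_mod g h₂ b' fun s => by
      have hs : q₂ s ∈ Submodule.span A₁ (Set.range b) := hb ▸ Submodule.mem_top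
      obtain ⟨a, ha⟩ := (Submodule.mem_span_range_iff_exists_fun A₁).1 hs
      choose x hx using fun i => hq₁ (a i)
      refine ⟨x, (hk₂ _).1 ?_⟩
      rw [map_sub, ← ha, map_sum, sub_eq_zero]
      refine Finset.sum_congr rfl fun i _ => ?_
      rw [map_mul, ← hred, hx, hb', Algebra.smul_def]
      rfl
  refine Module.Finite.of_surjective (Fintype.linearCombination S₁ b') fun s => ?_
  obtain ⟨x, rfl⟩ := hspan s
  refine ⟨x, ?_⟩
  rw [Fintype.linearCombination_apply]
  exact Finset.sum_congr rfl fun i _ => Algebra.smul_def _ _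

theorem flat_of_mod (h₁ : GrowthRing V₁ t π₁ e₁) (h₂ : GrowthRing V₂ (g t) π₂ e₂)
    (hq₁ : Function.Surjective q₁) (hq₂ : Function.Surjective q₂)
    (hk₁ : ∀ x, q₁ x = 0 ↔ t ∣ x) (hk₂ : ∀ x, q₂ x = 0 ↔ g t ∣ x)
    (hred : ∀ x, gbar (q₁ x) = q₂ (g x)) (hg : gbar.Flat) : g.Flat := by
  algebraize [gbar, g]
  have := h₁.isNoetherianRing
  have := h₂.isNoetherianRing
  exact flat_of_flat_mod (t := t) h₂.regular h₂.mem_jacobson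
    (exists_relation_of_flat_quotient hq₁ hq₂ hk₁ hk₂ fun x => (hred x).symm)

theorem faithfullyFlat_of_mod (h₁ : GrowthRing V₁ t π₁ e₁) (h₂ : GrowthRing V₂ (g t) π₂ e₂)
    (hq₁ : Function.Surjective q₁) (hq₂ : Function.Surjective q₂)
    (hk₁ : ∀ x, q₁ x = 0 ↔ t ∣ x) (hk₂ : ∀ x, q₂ x = 0 ↔ g t ∣ x)
    (hred : ∀ x, gbar (q₁ x) = q₂ (g x)) (hg : gbar.FaithfullyFlat) : g.FaithfullyFlat := by
  obtain ⟨hg1, hg2⟩ := RingHom.FaithfullyFlat.iff_flat_and_comap_surjective.1 hg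
  have hflat : g.Flat := h₁.flat_of_mod h₂ hq₁ hq₂ hk₁ hk₂ hred hg1
  algebraize [g]
  refine (Module.faithfullyFlat_iff S₁ S₂).2 ⟨hflat, fun m hm htop => ?_⟩
  -- Hence `m` is the preimage of an ideal of `A₁`, over which some prime `P` of `A₂` lies; the
  -- preimage of `P` in `S₂` is proper and contains `m S₂`.
  have htm : t ∈ m := Ideal.mem_sInf.1 h₁.mem_jacobson ⟨bot_le, hm⟩
  have hker : RingHom.ker q₁ ≤ m := fun x hx =>
    m.mem_of_dvd ((hk₁ x).1 hx) htm
  have hprime : (m.map q₁).IsPrime := Ideal.map_isPrime_of_surjective hq₁ hker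
  obtain ⟨P, hP⟩ := hg2 ⟨m.map q₁, hprime⟩
  have hle : m • (⊤ : Submodule S₁ S₂) ≤ (P.asIdeal.comap q₂).restrictScalars S₁ := by
    refine Submodule.smul_le.2 fun r hr s _ => ?_
    have h3 : q₁ r ∈ (PrimeSpectrum.comap gbar P).asIdeal := hP ▸ Ideal.mem_map_of_mem q₁ hr
    have h4 : q₂ (g r) ∈ P.asIdeal := hred r ▸ h3
    show q₂ (r • s) ∈ P.asIdeal
    rw [Algebra.smul_def, map_mul]
    exact Ideal.mul_mem_right _ _ h4
  rw [htop] at hle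
  have h1 : (1 : S₂) ∈ P.asIdeal.comap q₂ := hle Submodule.mem_top
  rw [Ideal.mem_comap, map_one] at h1
  exact P.isPrime.one_notMem h1

end Lift
end GrowthRing

/-! ### Uniformizers and the growth structure of a dagger lift -/

section Lift

variable {O : Type u} [CommRing O] [IsDomain O]

theorem extMax_eq [IsDiscreteValuationRing O] {ϖ : O} (hϖ : Irreducible ϖ) (S : Type v) [CommRing S] [Algebra O S] :
    extMax O S = Ideal.span {algebraMap O S ϖ} := by
  rw [extMax, hϖ.maximalIdeal_eq, Ideal.map_span, Set.image_singleton]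

theorem regular_of_flat {ϖ : O} (hϖ : Irreducible ϖ) (S : Type v) [CommRing S] [Algebra O S]
    [Module.Flat O S] (x : S) (hx : algebraMap O S ϖ * x = 0) : x = 0 := by
  have := Module.Flat.isSMulRegular_of_nonZeroDivisors (M := S)
    (mem_nonZeroDivisors_of_ne_zero hϖ.ne_zero)
  exact this.right_eq_zero_of_smul (by rwa [Algebra.smul_def])

/-- A ring homomorphism that is compatible with reduction modulo `𝔪` maps a uniformizer to a
uniformizer, up to a unit. -/
theorem exists_map_uniformizer [IsDiscreteValuationRing O] {S₁ : Type v} {S₂ : Type w} [CommRing S₁] [CommRing S₂]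
    [Algebra O S₁] [Algebra O S₂] [Module.Flat O S₂] {ϖ : O} (hϖ : Irreducible ϖ) (g : S₁ →+* S₂)
    (hdvd : algebraMap O S₂ ϖ ∣ g (algebraMap O S₁ ϖ))
    (hunif : ringChar O = ringChar (ResidueField O) → extMax O S₂ ≤ (extMax O S₁).map g) :
    ∃ u u', u * u' = 1 ∧ g (algebraMap O S₁ ϖ) = algebraMap O S₂ ϖ * u := by
  have hreg := regular_of_flat hϖ S₂
  obtain ⟨u, hgu⟩ := hdvd
  suffices hu : IsUnit u by
    obtain ⟨u', hu'⟩ := hu.exists_right_inv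
    exact ⟨u, u', hu', hgu⟩
  by_cases hchar : ringChar O = ringChar (ResidueField O)
  · have h1 := hunif hchar
    rw [extMax_eq hϖ, extMax_eq hϖ, Ideal.map_span, Set.image_singleton,
      Ideal.span_singleton_le_span_singleton] at h1
    obtain ⟨c, hc⟩ := h1
    refine IsUnit.of_mul_eq_one c (sub_eq_zero.1 (hreg _ ?_))
    linear_combination -hc - c * hgu
  -- In mixed characteristics `p` is a unit times `ϖ^k` with `k ≥ 1`, and `g` fixes `p` although it
  -- need not be `𝔬`-linear. Comparing both sides shows that `u^k` is a unit.
  · set p := ringChar (ResidueField O)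
    have hp : (p : O) ≠ 0 := fun h0 => by
      refine hchar (Nat.dvd_antisymm (ringChar.dvd h0) (ringChar.dvd ?_))
      rw [← map_natCast (residue O), ringChar.Nat.cast_ringChar, map_zero]
    obtain ⟨k, w, hw⟩ := IsDiscreteValuationRing.eq_unit_mul_pow_irreducible hp hϖ
    have hk : k ≠ 0 := by
      rintro rfl
      have h1 : residue O (p : O) = 0 := by rw [map_natCast, ringChar.Nat.cast_ringChar]
      rw [residue_eq_zero_iff, mem_maximalIdeal, hw, pow_zero, mul_one] at h1
      exact h1 w.isUnit
    have hregk : ∀ (j : ℕ) (x : S₂), algebraMap O S₂ ϖ ^ j * x = 0 → x = 0 := by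
      intro j
      induction j with
      | zero => intro x hx; simpa using hx
      | succ j ih => exact fun x hx => ih x (hreg _ (by rw [← mul_assoc, ← pow_succ', hx]))
    have h1 : g (algebraMap O S₁ (p : O)) = algebraMap O S₂ (p : O) := by simp only [map_natCast]
    rw [hw, map_mul, map_mul, map_mul, map_pow, map_pow, map_pow, hgu, mul_pow] at h1
    have h2 : g (algebraMap O S₁ w) * u ^ k = algebraMap O S₂ w :=
      sub_eq_zero.1 (hregk k _ (by linear_combination h1))
    have h3 : IsUnit (u ^ k) :=
      isUnit_of_dvd_unit (Dvd.intro_left _ h2) (w.isUnit.map (algebraMap O S₂))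
    exact (isUnit_pow_iff hk).1 h3

variable [IsDiscreteValuationRing O] [IsAdicComplete (maximalIdeal O) O] {ρ ω : Set.Ioo (0 : ℝ) 1}

theorem IsDaggerLift.growthRing {S : Type v} {A : Type w} [CommRing S] [Algebra O S] [CommRing A]
    [Algebra (LaurentSeries (ResidueField O)) A] {q : S →+* A} (h : IsDaggerLift O ρ ω q) {ϖ : O}
    (hϖ : Irreducible ϖ) :
    ∃ (V : Subring S) (π e : S), GrowthRing V (algebraMap O S ϖ) π e := by
  obtain ⟨P⟩ := h.exists_presentation
  have := h.flat
  have hmap := (growthRing_dagger (m := P.m) (n := P.n) (ρ := ρ) (ω := ω) hϖ).map P.f.toRingHom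
    P.surjective (fun x hx => regular_of_flat hϖ S x (by simpa using hx))
  have e : P.f.toRingHom (algebraMap O _ ϖ) = algebraMap O S ϖ := P.f.commutes ϖ
  rw [e] at hmap
  exact ⟨_, _, _, hmap⟩

theorem IsDaggerLift.eq_zero_iff {S : Type v} {A : Type w} [CommRing S] [Algebra O S] [CommRing A]
    [Algebra (LaurentSeries (ResidueField O)) A] {q : S →+* A} (h : IsDaggerLift O ρ ω q) {ϖ : O}
    (hϖ : Irreducible ϖ) (x : S) : q x = 0 ↔ algebraMap O S ϖ ∣ x := by
  rw [← RingHom.mem_ker, h.ker_eq, extMax_eq hϖ, Ideal.mem_span_singleton]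

end Lift

end Dagger

end

/-! ### The theorem -/

theorem lemmaL
    {O : Type*} [CommRing O] [IsDomain O] [IsDiscreteValuationRing O]
    [IsAdicComplete (IsLocalRing.maximalIdeal O) O] [PerfectField (IsLocalRing.ResidueField O)]
    (ρ ω : Set.Ioo (0 : ℝ) 1)
    {A₁ : Type*} {A₂ : Type*} {S₁ : Type*} {S₂ : Type*}
    [CommRing A₁] [CommRing A₂] [CommRing S₁] [CommRing S₂]
    [Algebra (LaurentSeries (IsLocalRing.ResidueField O)) A₁]
    [Algebra (LaurentSeries (IsLocalRing.ResidueField O)) A₂]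
    [Algebra O S₁] [Algebra O S₂]
    (hA₁ : Dagger.IsMixedAffinoid (IsLocalRing.ResidueField O) ω A₁)
    (hA₂ : Dagger.IsMixedAffinoid (IsLocalRing.ResidueField O) ω A₂)
    (q₁ : S₁ →+* A₁) (q₂ : S₂ →+* A₂)
    (hS₁ : Dagger.IsDaggerLift O ρ ω q₁) (hS₂ : Dagger.IsDaggerLift O ρ ω q₂)
    (g : S₁ →+* S₂) (gbar : A₁ →+* A₂)
    -- `gbar` is the reduction of `g`
    (hred : gbar.comp q₁ = q₂.comp g)
    -- automatic if `𝔬` has mixed characteristics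
    (hunif : ringChar O = ringChar (IsLocalRing.ResidueField O) →
      Dagger.extMax O S₂ ≤ (Dagger.extMax O S₁).map g) :
    (Dagger.WeaklyContinuous O ρ ω q₁ q₂ g → Dagger.NormCondition (IsLocalRing.ResidueField O) ω gbar →
      (Function.Injective gbar → Function.Injective g) ∧
      (Function.Surjective gbar → Function.Surjective g) ∧
      (gbar.Finite → g.Finite) ∧
      (gbar.Flat → g.Flat) ∧
      (gbar.FaithfullyFlat → g.FaithfullyFlat)) ∧
    (Function.Bijective gbar → Function.Bijective g) := by
  obtain ⟨ϖ, hϖ⟩ := IsDiscreteValuationRing.exists_irreducible O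
  obtain ⟨V₁, π₁, e₁, h₁⟩ := hS₁.growthRing hϖ
  obtain ⟨V₂, π₂, e₂, h₂⟩ := hS₂.growthRing hϖ
  have hk₁ := hS₁.eq_zero_iff hϖ
  have hred' : ∀ x, gbar (q₁ x) = q₂ (g x) := fun x => congrArg (fun f : S₁ →+* A₂ => f x) hred
  have := hS₂.flat
  obtain ⟨u, u', hu, hgu⟩ := Dagger.exists_map_uniformizer hϖ g
    ((hS₂.eq_zero_iff hϖ _).1 (by rw [← hred', (hk₁ _).2 dvd_rfl, map_zero])) hunif
  have hk₂ : ∀ x, q₂ x = 0 ↔ g (algebraMap O S₁ ϖ) ∣ x := fun x => by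
    rw [hS₂.eq_zero_iff hϖ, hgu, (IsUnit.of_mul_eq_one u' hu).mul_right_dvd]
  -- The lemmas on homomorphisms use `g(t)` as the parameter of the target.
  replace h₂ : Dagger.GrowthRing V₂ (g (algebraMap O S₁ ϖ)) π₂ e₂ :=
    by
    rw [hgu]
    exact h₂.change_uniformizer u u' hu
  have hinj := h₁.injective_of_mod h₂ hk₁ hred'
  have hsurj := h₁.surjective_of_mod h₂ hS₁.surjective hk₂ hred'
  exact ⟨fun _ _ => ⟨hinj, hsurj,
    h₁.finite_of_mod h₂ hS₁.surjective hS₂.surjective hk₂ hred',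
    h₁.flat_of_mod h₂ hS₁.surjective hS₂.surjective hk₁ hk₂ hred',
    h₁.faithfullyFlat_of_mod h₂ hS₁.surjective hS₂.surjective hk₁ hk₂ hred'⟩,
    fun h => ⟨hinj h.1, hsurj h.2⟩⟩
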